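/- Let $\mathfrak X$ be a countably infinite alphabet containing pairwise distinct letters $x,y,t,z_i,t_i,y_i,z_i',t_i'$ ($i\ge 1$), let $\mathfrak X^*$ be the free monoid over $\mathfrak X$, and let $S_m$ be the symmetric group on $\{1,\dots,m\}$ (with $i\pi$ the image of $i$ under $\pi$). For $n\ge 1$, $\pi_1\in S_{4n+1}$, $\pi_2\in S_{n+1}$, $\pi_3,\pi_4\in S_{2n+1}$ and $\tau\in S_{2n}$ put \[ \mathbf h_n:=\Bigl(\prod_{i=1}^n z_i't_i'\Bigr)\,xyt\,\Bigl(\prod_{i=n+1}^{2n} z_i't_i'\Bigr)\,x , \] \[ \begin{aligned} \mathbf c_n^{(1)}[\pi_1,\tau]&:=\mathbf h_n\Bigl(\prod_{i=1}^{2n} z_{(2i-1)\pi_1}\,y_i^2\,z_{(2i)\pi_1}\,z_{i\tau}'\Bigr)z_{(4n+1)\pi_1}\,y\,\Bigl(\prod_{i=1}^{4n+1} t_iz_i\Bigr),\\ \mathbf c_n^{(2)}[\pi_2,\tau]&:=\mathbf h_n\Bigl(\prod_{i=1}^{n} z_{i\pi_2}\,z_{(2i-1)\tau}'\,y_i^2\,z_{(2i)\tau}'\Bigr)z_{(n+1)\pi_2}\,y\,\Bigl(\prod_{i=1}^{n+1}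 t_iz_i\Bigr),\\ \mathbf c_n^{(3)}[\pi_3,\tau]&:=\mathbf h_n\Bigl(\prod_{i=1}^{2n} z_{i\pi_3}\,z_{i\tau}'\,y_i^2\Bigr)z_{(2n+1)\pi_3}\,y\,\Bigl(\prod_{i=1}^{2n+1} t_iz_i\Bigr),\\ \mathbf c_n^{(4)}[\pi_4,\tau]&:=\mathbf h_n\Bigl(\prod_{i=1}^{2n} z_{i\pi_4}\,y_i^2\,z_{i\tau}'\Bigr)z_{(2n+1)\pi_4}\,y\,\Bigl(\prod_{i=1}^{2n+1} t_iz_i\Bigr). \end{aligned} \] A variety of monoids is a class of monoids defined by a set of identities $\mathbf u\approx\mathbf v$ with $\mathbf u,\mathbf v\in\mathfrak X^*$; its subvarieties form a lattice under inclusion. For a congruence $\alpha$ on $\mathfrak X^*$ and a set $W$ of $\alpha$-classes, let $W^{\le}$ be the set of all factors in $\mathfrak X^*/\alpha$ of elements of $W$, let $M_\alpha(W)$ be the Rees quotient of the monoid $\mathfrak X^*/\alpha$ over the ideal $(\mathfrak X^*/\alpha)\setminus W^{\le}$, and let $\mathbf M_\alpha(W)$ be the variety of monoids generated by $M_\alpha(W)$.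 When $\alpha$ is equality we write $M(W)$, and $M(\mathbf w)$ for $M(\{\mathbf w\})$. An island of a word is a maximal factor that is a power of a single letter. Write $\mathbf u\mathrel{\gamma}\mathbf v$ if $\mathbf u$ and $\mathbf v$ have the same set of letters occurring exactly once and $\mathbf u$ is obtained from $\mathbf v$ by changing the (positive) exponents of its islands. Write $\mathbf u\mathrel{\gamma'}\mathbf v$ if $\mathbf u\mathrel{\gamma}\mathbf v$ and the monoid $M(xyx)$ satisfies the identity $\mathbf u\approx\mathbf v$. Let $[\mathbf w]^{\gamma'}$ denote the $\gamma'$-class of $\mathbf w$. Proposition. For all $n\ge1$, $\pi_1\in S_{4n+1}$, $\pi_2\in S_{n+1}$, $\pi_3,\pi_4\in S_{2n+1}$ and $\tau\in S_{2n}$, none of the subvariety lattices of the four varieties \[ \mathbf M_{\gamma'}\bigl(\{[\mathbf c_n^{(1)}[\pi_1,\tau]]^{\gamma'}\}\bigr),\quad \mathbf M_{\gamma'}\bigl(\{[\mathbf c_n^{(2)}[\pi_2,\tau]]^{\gamma'}\}\bigr),\quad \mathbf M_{\gamma'}\bigl(\{[\mathbf c_n^{(3)}[\pi_3,\tau]]^{\gamma'}\}\bigr),\quad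 \mathbf M_{\gamma'}\bigl(\{[\mathbf c_n^{(4)}[\pi_4,\tau]]^{\gamma'}\}\bigr) \] is modular. -/

import Mathlib

namespace MonVar

/-! ### Words and identities -/

/-- A countably infinite alphabet, with the letters
`x, y, t` and `zᵢ, tᵢ, yᵢ, zᵢ', tᵢ'` (`i = 0, 1, 2, …`), all distinct. -/
inductive Letter : Type
  | x : Letter
  | y : Letter
  | t : Letter
  | zs (i : ℕ) : Letter
  | ts (i : ℕ) : Letter
  | ys (i : ℕ) : Letter
  | zp (i : ℕ) : Letter
  | tp (i : ℕ) : Letter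
  deriving DecidableEq

theorem Letter.infinite : Infinite Letter :=
  Infinite.of_injective Letter.zs fun i j h => by injection h

theorem Letter.countable : Countable Letter := by
  let f : Letter → ℕ × ℕ := fun a => match a with
    | .x => (0, 0) | .y => (1, 0) | .t => (2, 0) | .zs i => (3, i) | .ts i => (4, i)
    | .ys i => (5, i) | .zp i => (6, i) | .tp i => (7, i)
  have hf : Function.Injective f := by
    intro a b h
    cases a <;> cases b <;> simp_all [f]
  exact hf.countable

/-- Words are the elements of the free monoid over the alphabet. -/
abbrev Word : Type := FreeMonoid Letter

/-- The pair `(u, v)` stands for the identity `u ≈ v`. -/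
abbrev Identity : Type := Word × Word

/-- The monoid `M` satisfies the identity `e`. -/
def Satisfies (M : Type*) [Monoid M] (e : Identity) : Prop :=
  ∀ φ : Letter → M, FreeMonoid.lift φ e.1 = FreeMonoid.lift φ e.2

/-! ### Varieties of monoids -/

/-- The class of all monoids satisfying each identity in `S`. -/
def models (S : Set Identity) : Set MonCat.{0} :=
  {M | ∀ e ∈ S, Satisfies M e}

/-- A variety of monoids: a class of monoids that is defined by some set of identities. -/
structure MonoidVariety where
  carrier : Set MonCat.{0}
  equational : ∃ S : Set Identity, carrier = models S

namespace MonoidVariety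

theorem carrier_injective : Function.Injective carrier := by
  rintro ⟨C, _⟩ ⟨D, _⟩ h
  cases h
  rfl

/-- Varieties are ordered by inclusion. -/
instance : PartialOrder MonoidVariety := PartialOrder.lift carrier carrier_injective

theorem le_def (V W : MonoidVariety) : V ≤ W ↔ V.carrier ⊆ W.carrier := Iff.rfl

/-- The intersection of a family of varieties. -/
instance : InfSet MonoidVariety where
  sInf F :=
    { carrier := {M | ∀ V ∈ F, M ∈ V.carrier}
      equational := by
        refine ⟨{e | ∃ V ∈ F, ∀ M ∈ V.carrier, Satisfies M e}, ?_⟩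
        ext M
        constructor
        · rintro h e ⟨V, hV, he⟩
          exact he M (h V hV)
        · intro h V hV
          obtain ⟨S, hS⟩ := V.equational
          rw [hS]
          intro e he
          refine h e ⟨V, hV, fun N hN => ?_⟩
          rw [hS] at hN
          exact hN e he }

theorem isGLB_sInf (F : Set MonoidVariety) : IsGLB F (sInf F) :=
  ⟨fun _ hV _ hM => hM _ hV, fun _ hW _ hM V hV => hW hV hM⟩

/-- The lattice of all varieties of monoids: meet is intersection, and the join of two varieties
is the least variety containing both. -/
noncomputable instance : CompleteLattice MonoidVariety :=
  completeLatticeOfInf MonoidVariety isGLB_sInf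

/-- The variety generated by the monoid `M`: the class of all monoids that satisfy every identity
of `M`. -/
def generatedBy (M : Type) [Monoid M] : MonoidVariety where
  carrier := models {e | Satisfies M e}
  equational := ⟨_, rfl⟩

theorem isLeast_generatedBy (M : Type) [Monoid M] :
    IsLeast {V : MonoidVariety | MonCat.of M ∈ V.carrier} (generatedBy M) := by
  refine ⟨fun e he => he, ?_⟩
  intro V hV N hN
  obtain ⟨S, hS⟩ := V.equational
  have hM : MonCat.of M ∈ V.carrier := hV
  rw [hS] at hM ⊢
  exact fun e he => hN e (hM e he)

/-- The fully invariant congruence of `V` on the free monoid: `u` and `v` are related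
if and only if `V` satisfies `u ≈ v`. -/
def FIC (V : MonoidVariety) : Con Word where
  r u v := ∀ M ∈ V.carrier, Satisfies M (u, v)
  iseqv :=
    { refl := fun _ _ _ _ => rfl
      symm := fun h M hM φ => (h M hM φ).symm
      trans := fun h k M hM φ => (h M hM φ).trans (k M hM φ) }
  mul' := by
    intro a b c d h k M hM φ
    have h1 := h M hM φ
    have h2 := k M hM φ
    simp only [map_mul] at h1 h2 ⊢
    rw [h1, h2]

end MonoidVariety

/-! ### Rees quotients -/

/-- `W^≤`: the set of all factors of elements of `W`. -/
def factors {S : Type} [Monoid S] (W : Set S) : Set S :=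
  {v | ∃ u ∈ W, ∃ p s : S, u = p * v * s}

/-- The Rees congruence of the ideal `S \ W^≤`, which collapses this ideal to one element and
identifies nothing else. -/
def reesCon {S : Type} [Monoid S] (W : Set S) : Con S where
  r a b := a = b ∨ (a ∉ factors W ∧ b ∉ factors W)
  iseqv :=
    { refl := fun _ => Or.inl rfl
      symm := by
        rintro a b (h | ⟨h, k⟩)
        · exact Or.inl h.symm
        · exact Or.inr ⟨k, h⟩
      trans := by
        rintro a b c (rfl | ⟨h, k⟩) (rfl | ⟨h', k'⟩)
        · exact Or.inl rfl
        · exact Or.inr ⟨h', k'⟩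
        · exact Or.inr ⟨h, k⟩
        · exact Or.inr ⟨h, k'⟩ }
  mul' := by
    have hl : ∀ a b : S, a ∉ factors W → a * b ∉ factors W := by
      rintro a b h ⟨u, hu, p, s, rfl⟩
      exact h ⟨_, hu, p, b * s, by simp only [mul_assoc]⟩
    have hr : ∀ a b : S, b ∉ factors W → a * b ∉ factors W := by
      rintro a b h ⟨u, hu, p, s, rfl⟩
      exact h ⟨_, hu, p * a, s, by simp only [mul_assoc]⟩
    rintro a b c d (rfl | ⟨h, k⟩) (rfl | ⟨h', k'⟩)
    · exact Or.inl rfl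
    · exact Or.inr ⟨hr _ _ h', hr _ _ k'⟩
    · exact Or.inr ⟨hl _ _ h, hl _ _ k⟩
    · exact Or.inr ⟨hl _ _ h, hl _ _ k⟩

/-- The Rees quotient of the monoid `S` over the ideal `S \ W^≤`. For `S = Word` this is `M(W)`. -/
abbrev ReesQuotient {S : Type} [Monoid S] (W : Set S) : Type := (reesCon W).Quotient

/-- `M_α(W)` for a congruence `α` on the free monoid and a set `W` of `α`-classes. -/
abbrev MAlpha (α : Con Word) (W : Set α.Quotient) : Type := ReesQuotient W

/-! ### The congruences `γ` and `γ'` -/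

/-- The set of letters that occur exactly once in `w`. -/
def simpleLetters (w : Word) : Set Letter :=
  {a | w.toList.count a = 1}

/-- The sequence of the letters that form the successive islands of `w`
(an island is a maximal factor that is a power of a letter). -/
def islands (w : Word) : List Letter :=
  w.toList.destutter (· ≠ ·)

/-- Prepend a letter, unless the list already begins with it. -/
def glue (a : Letter) (l : List Letter) : List Letter :=
  if l.head? = some a then l else a :: l

theorem destutter_cons_eq_glue (a : Letter) (l : List Letter) :
    (a :: l).destutter (· ≠ ·) = glue a (l.destutter (· ≠ ·)) := by
  cases l with
  | nil => simp [glue]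
  | cons b l =>
    rw [List.destutter_cons_cons]
    have hb : ∀ m : List Letter, ((b :: m).destutter (· ≠ ·)).head? = some b := by
      intro m
      induction m with
      | nil => simp
      | cons c m ih =>
        rw [List.destutter_cons_cons]
        split_ifs with h
        · rfl
        · simp only [ne_eq, not_not] at h
          subst h
          exact ih
    by_cases h : a = b
    · subst h
      simp [glue, hb]
      rfl
    · have : ¬ b = a := fun e => h e.symm
      simp [glue, hb, h, this]
      rfl

theorem destutter_eq_foldr (l : List Letter) :
    l.destutter (· ≠ ·) = l.foldr glue [] := by
  induction l with
  | nil => rfl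
  | cons a l ih => rw [destutter_cons_eq_glue, ih, List.foldr_cons]

theorem glue_glue (a : Letter) (l : List Letter) : glue a (glue a l) = glue a l := by
  unfold glue
  split_ifs <;> simp_all

theorem foldr_glue_destutter (l m : List Letter) :
    (l.destutter (· ≠ ·)).foldr glue m = l.foldr glue m := by
  induction l with
  | nil => rfl
  | cons a l ih =>
    rw [destutter_cons_eq_glue, List.foldr_cons, ← ih]
    generalize l.destutter (· ≠ ·) = k
    cases k with
    | nil => simp [glue]
    | cons b k =>
      by_cases h : b = a
      · subst h
        have e : glue b (b :: k) = b :: k := by simp [glue]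
        rw [e, List.foldr_cons, glue_glue]
      · simp [glue, h]

theorem islands_mul (u v : Word) :
    islands (u * v) = (islands u).foldr glue (islands v) := by
  unfold islands
  rw [foldr_glue_destutter, FreeMonoid.toList_mul, destutter_eq_foldr, List.foldr_append,
    ← destutter_eq_foldr]

theorem mem_islands_iff (w : Word) (a : Letter) : a ∈ islands w ↔ a ∈ w.toList := by
  unfold islands
  rw [destutter_eq_foldr]
  induction w.toList with
  | nil => simp
  | cons b l ih =>
    rw [List.foldr_cons, List.mem_cons, ← ih]
    generalize l.foldr glue [] = k
    unfold glue
    split_ifs with h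
    · constructor
      · exact Or.inr
      · rintro (rfl | h')
        · exact List.mem_of_mem_head? h
        · exact h'
    · simp

/-- The congruence `γ`: two words are related if and only if they have the same simple letters
and one is obtained from the other by changing the exponents of the islands
(keeping them positive). -/
def gamma : Con Word where
  r u v := simpleLetters u = simpleLetters v ∧ islands u = islands v
  iseqv :=
    { refl := fun _ => ⟨rfl, rfl⟩
      symm := fun h => ⟨h.1.symm, h.2.symm⟩
      trans := fun h k => ⟨h.1.trans k.1, h.2.trans k.2⟩ }
  mul' := by
    rintro u u' v v' ⟨h1, h2⟩ ⟨k1, k2⟩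
    refine ⟨?_, by rw [islands_mul, islands_mul, h2, k2]⟩
    ext a
    have e1 : u.toList.count a = 1 ↔ u'.toList.count a = 1 := Set.ext_iff.1 h1 a
    have e2 : v.toList.count a = 1 ↔ v'.toList.count a = 1 := Set.ext_iff.1 k1 a
    have e3 : 0 < u.toList.count a ↔ 0 < u'.toList.count a := by
      rw [List.count_pos_iff, List.count_pos_iff, ← mem_islands_iff, ← mem_islands_iff, h2]
    have e4 : 0 < v.toList.count a ↔ 0 < v'.toList.count a := by
      rw [List.count_pos_iff, List.count_pos_iff, ← mem_islands_iff, ← mem_islands_iff, k2]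
    simp only [simpleLetters, Set.mem_ofPred_eq, FreeMonoid.toList_mul, List.count_append]
    omega

/-- A letter, as a word of length one. -/
abbrev ltr (a : Letter) : Word := FreeMonoid.of a

open Letter

/-- The monoid `M(xyx)`. -/
abbrev Mxyx : Type := ReesQuotient ({ltr x * ltr y * ltr x} : Set Word)

/-- The congruence `γ' = γ ∧ FIC(𝐌(xyx))`. -/
noncomputable def gamma' : Con Word :=
  gamma ⊓ (MonoidVariety.generatedBy Mxyx).FIC

/-- The variety `𝐌_{γ'}([w]^{γ'})`, generated by the monoid `M_{γ'}([w]^{γ'})`. -/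
noncomputable def varGamma' (w : Word) : MonoidVariety :=
  MonoidVariety.generatedBy (MAlpha gamma' {(w : gamma'.Quotient)})

/-! ### The words `c_n^{(i)}[π, τ]`

All indices are shifted by one: permutations act on `Fin m = {0, …, m - 1}`. -/

/-- `(z₁' t₁' ⋯ zₙ' tₙ') x y t (zₙ₊₁' tₙ₊₁' ⋯ z₂ₙ' t₂ₙ') x`, the common prefix of the words. -/
def cHead (n : ℕ) : Word :=
  (List.ofFn fun i : Fin n => ltr (zp i) * ltr (tp i)).prod *
    (ltr x * ltr y * ltr t) *
    (List.ofFn fun i : Fin n => ltr (zp (n + i)) * ltr (tp (n + i))).prod *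
    ltr x

/-- `t₁ z₁ ⋯ t_m z_m`, the common form of the suffixes of the words. -/
def cTail (m : ℕ) : Word :=
  (List.ofFn fun i : Fin m => ltr (ts i) * ltr (zs i)).prod

def c1 (n : ℕ) (π : Equiv.Perm (Fin (4 * n + 1))) (τ : Equiv.Perm (Fin (2 * n))) : Word :=
  cHead n *
    (List.ofFn fun i : Fin (2 * n) =>
      ltr (zs (π ⟨2 * i, by omega⟩)) * ltr (ys i) ^ 2 * ltr (zs (π ⟨2 * i + 1, by omega⟩)) *
        ltr (zp (τ i))).prod *
    (ltr (zs (π (Fin.last (4 * n)))) * ltr y) *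
    cTail (4 * n + 1)

def c2 (n : ℕ) (π : Equiv.Perm (Fin (n + 1))) (τ : Equiv.Perm (Fin (2 * n))) : Word :=
  cHead n *
    (List.ofFn fun i : Fin n =>
      ltr (zs (π i.castSucc)) * ltr (zp (τ ⟨2 * i, by omega⟩)) * ltr (ys i) ^ 2 *
        ltr (zp (τ ⟨2 * i + 1, by omega⟩))).prod *
    (ltr (zs (π (Fin.last n))) * ltr y) *
    cTail (n + 1)

def c3 (n : ℕ) (π : Equiv.Perm (Fin (2 * n + 1))) (τ : Equiv.Perm (Fin (2 * n))) : Word :=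
  cHead n *
    (List.ofFn fun i : Fin (2 * n) =>
      ltr (zs (π i.castSucc)) * ltr (zp (τ i)) * ltr (ys i) ^ 2).prod *
    (ltr (zs (π (Fin.last (2 * n)))) * ltr y) *
    cTail (2 * n + 1)

def c4 (n : ℕ) (π : Equiv.Perm (Fin (2 * n + 1))) (τ : Equiv.Perm (Fin (2 * n))) : Word :=
  cHead n *
    (List.ofFn fun i : Fin (2 * n) =>
      ltr (zs (π i.castSucc)) * ltr (ys i) ^ 2 * ltr (zp (τ i))).prod *
    (ltr (zs (π (Fin.last (2 * n)))) * ltr y) *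
    cTail (2 * n + 1)

end MonVar

set_option linter.unusedSectionVars false
set_option linter.unusedSimpArgs false

namespace MonVar

/-! A pentagon comes from one word with two switches. Let u_ab (a, b in {0, 1}) be `bigWord`, in
which two copies of the given word interlock: a and b say whether the first occurrences of x and y
in the first and in the second copy stand in the order xy (0) or yx (1). Inside the variety V in
question, let A be defined by u_00 ≈ u_10 and u_01 ≈ u_11, let B be defined by u_00 ≈ u_01 and u_10
≈ u_11, and let C be defined by u_00 ≈ u_10 alone. Then A ≤ C. Three sides of the square give the
fourth, so B ∧ C satisfies u_01 ≈ u_11, and hence so does A ∨ (B ∧ C). Modularity fails once (A ∨ B)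
∧ C violates this identity.

The violating monoid is the syntactic monoid of an intersection K_A ∩ K_B
(`not_isModularLattice_of_languages`). Both languages are unions of classes of the equational theory
of V; K_A is closed under the identities of A, K_B under those of B, and K_A ∩ K_B under u_00 ≈
u_10; the intersection contains u_01 but not u_11. Within the set `Similar`, K_B (`langB`) asks that
the first copy be standard and K_A (`langA`) that the second copy not be standard.

The closure properties rest on a rigidity statement: if v = pre φ(u_ab) post lies in `Similar`, then
the images of x and y of either copy commute, or φ fixes both letters. The identities of the
generating monoid preserve the γ'-class of the given word (`mem_shapeClass_of_satOver`), so each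
substitution that sends the base word into this class restricts v. Suitable substitutions determine
the projections of v onto many pairs of letters, and in particular show that v contains both copies
up to the order of x and y (`exists_chain`, `proj_of_keep`). Consequently only x and y of the same
copy can occur together in two disjoint factors without simple letters (`special_of_linked`). So a
letter that occurs twice in u_ab is sent to a power of one letter (`eq_of_mem_image`), and a pair x,
y with noncommuting images is sent to the pair x, y of some copy (`commute_or_of_image`).

Counting letters between the second x and the second y decides which copy. In the first copy, m + 2
letters begin there: the m letters z_j and both x and y of the second copy. In the second copy only
m + 1 begin there: the z_j and `dd`. Conversely 2n + 1 letters end there in the second copy (the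
z'_i and `cc`), but only 2n in the first. So no copy goes to the other one. The same count shows
that if φ fixes x and y of the first copy, it also fixes those of the second (`image_two_eq_two`). A
nontrivial application of u_00 ≈ u_10 therefore requires a standard second copy, which K_A forbids,
whereas u_01 ≈ u_11 applies to u_01 itself.

The argument uses little about the middle block of the word, namely the conditions in `Core`; all
four families satisfy them for all permutations. -/

/-! ### Identities over arbitrary alphabets and syntactic monoids -/

section Syntactic

variable {Γ Δ : Type}

/-- The monoid `M` satisfies the identity `a ≈ b` over the alphabet `Γ`. -/
def SatOver (M : Type*) [Monoid M] (a b : FreeMonoid Γ) : Prop :=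
  ∀ φ : Γ → M, FreeMonoid.lift φ a = FreeMonoid.lift φ b

/-- The interlocked words need an alphabet with two copies of `Letter`. This lemma transfers their
identities back to the official alphabet; letters outside the range of `f` may be sent to `1`. -/
theorem satisfies_map_iff {f : Γ → Letter} (hf : Function.Injective f) (M : Type*) [Monoid M]
    (a b : FreeMonoid Γ) :
    Satisfies M (FreeMonoid.map f a, FreeMonoid.map f b) ↔ SatOver M a b := by
  have key : ∀ (φ : Letter → M) (c : FreeMonoid Γ),
      FreeMonoid.lift φ (FreeMonoid.map f c) = FreeMonoid.lift (φ ∘ f) c := by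
    intro φ c
    simp [FreeMonoid.lift_apply, FreeMonoid.toList_map, List.map_map]
  constructor
  · intro h φ
    have h1 := h (Function.extend f φ 1)
    simp only [key] at h1
    rwa [Function.extend_comp hf] at h1
  · intro h φ
    simp only [key]
    exact h _

/-- The language `K` is closed under the applications of the identity `a ≈ b`. -/
def ClosedUnder (K : Set (FreeMonoid Γ)) (a b : FreeMonoid Δ) : Prop :=
  ∀ (φ : Δ → FreeMonoid Γ) (p s : FreeMonoid Γ),
    p * FreeMonoid.lift φ a * s ∈ K ↔ p * FreeMonoid.lift φ b * s ∈ K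

/-- The syntactic congruence of a language. -/
def synCon (K : Set (FreeMonoid Γ)) : Con (FreeMonoid Γ) where
  r a b := ∀ p s, p * a * s ∈ K ↔ p * b * s ∈ K
  iseqv :=
    { refl := fun _ _ _ => Iff.rfl
      symm := fun h p s => (h p s).symm
      trans := fun h k p s => (h p s).trans (k p s) }
  mul' := by
    intro a b c d h k p s
    have h1 := h p (c * s)
    have h2 := k (p * b) s
    simp only [mul_assoc] at h1 h2 ⊢
    exact h1.trans h2

/-- Choosing representatives lifts every assignment into the syntactic monoid to a substitution of
words, and equality in that monoid means interchangeability in all contexts. -/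
theorem satOver_synCon_iff (K : Set (FreeMonoid Γ)) (a b : FreeMonoid Δ) :
    SatOver (synCon K).Quotient a b ↔ ClosedUnder K a b := by
  have key : ∀ (φ : Δ → FreeMonoid Γ) (c : FreeMonoid Δ),
      FreeMonoid.lift (fun g => ((φ g : FreeMonoid Γ) : (synCon K).Quotient)) c
        = ((FreeMonoid.lift φ c : FreeMonoid Γ) : (synCon K).Quotient) := by
    intro φ c
    exact (FreeMonoid.hom_map_lift (synCon K).mk' φ c).symm
  constructor
  · intro h φ p s
    have h1 := h fun g => ((φ g : FreeMonoid Γ) : (synCon K).Quotient)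
    rw [key, key, Con.eq] at h1
    exact h1 p s
  · intro h φ
    choose ψ hψ using fun g => Quot.exists_rep (φ g)
    have e : φ = fun g => ((ψ g : FreeMonoid Γ) : (synCon K).Quotient) := by
      funext g
      exact (hψ g).symm
    rw [e, key, key, Con.eq]
    exact fun p s => h ψ p s

end Syntactic

/-! ### Membership in meets and joins of varieties -/

namespace MonoidVariety

/-- The variety defined by a set of identities. -/
def ofIdentities (S : Set Identity) : MonoidVariety := ⟨models S, S, rfl⟩

/-- The union of the two systems of identities defines a common lower bound, so it lies below the
meet. -/
theorem mem_inf {V W : MonoidVariety} {M : MonCat.{0}} (hV : M ∈ V.carrier) (hW : M ∈ W.carrier) :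
    M ∈ (V ⊓ W).carrier := by
  obtain ⟨S, hS⟩ := V.equational
  obtain ⟨R, hR⟩ := W.equational
  let U : MonoidVariety := ofIdentities (S ∪ R)
  have h1 : U ≤ V := by
    intro N hN
    rw [hS]
    exact fun e he => hN e (Or.inl he)
  have h2 : U ≤ W := by
    intro N hN
    rw [hR]
    exact fun e he => hN e (Or.inr he)
  refine (le_inf h1 h2) ?_
  rintro e (he | he)
  · rw [hS] at hV
    exact hV e he
  · rw [hR] at hW
    exact hW e he

/-- Any system that defines the join consists of identities valid in both varieties. -/
theorem mem_sup {V W : MonoidVariety} {M : MonCat.{0}}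
    (h : ∀ e : Identity, (∀ N ∈ V.carrier, Satisfies N e) → (∀ N ∈ W.carrier, Satisfies N e) →
      Satisfies M e) :
    M ∈ (V ⊔ W).carrier := by
  obtain ⟨S, hS⟩ := (V ⊔ W).equational
  have h1 : V ≤ V ⊔ W := le_sup_left
  have h2 : W ≤ V ⊔ W := le_sup_right
  rw [hS]
  intro e he
  refine h e (fun N hN => ?_) (fun N hN => ?_)
  · have := h1 hN
    rw [hS] at this
    exact this e he
  · have := h2 hN
    rw [hS] at this
    exact this e he

end MonoidVariety

open MonoidVariety

/-- A sufficient condition for non-modularity: four words and two languages that are unions of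
classes of the equational theory, such that the pentagon appears on them. -/
theorem not_isModularLattice_of_languages {Γ : Type} [Countable Γ] (M : Type) [Monoid M]
    (KA KB : Set (FreeMonoid Γ)) (u00 u01 u10 u11 : FreeMonoid Γ)
    (hA : ∀ a b : FreeMonoid Γ, SatOver M a b → a ∈ KA → b ∈ KA)
    (hB : ∀ a b : FreeMonoid Γ, SatOver M a b → a ∈ KB → b ∈ KB)
    (hA1 : ClosedUnder KA u00 u10) (hA2 : ClosedUnder KA u01 u11)
    (hB1 : ClosedUnder KB u00 u01) (hB2 : ClosedUnder KB u10 u11)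
    (hC : ClosedUnder (KA ∩ KB) u00 u10)
    (h1 : u01 ∈ KA ∩ KB) (h2 : u11 ∉ KA ∩ KB) :
    ¬ IsModularLattice (Set.Iic (generatedBy M)) := by
  intro hmod
  obtain ⟨f, hf⟩ : ∃ f : Γ → Letter, Function.Injective f := by
    obtain ⟨g, hg⟩ := exists_injective_nat Γ
    exact ⟨fun x => Letter.zs (g x), fun x y h => hg (by injection h)⟩
  let idn : FreeMonoid Γ → FreeMonoid Γ → Identity :=
    fun a b => (FreeMonoid.map f a, FreeMonoid.map f b)
  have hid : ∀ (N : Type) [Monoid N] (a b : FreeMonoid Γ),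
      Satisfies N (idn a b) ↔ SatOver N a b := fun N _ a b => satisfies_map_iff hf N a b
  have hSyn : ∀ (K : Set (FreeMonoid Γ)) (e : Identity),
      Satisfies (synCon K).Quotient e ↔ ClosedUnder K e.1 e.2 :=
    fun K e => satOver_synCon_iff K e.1 e.2
  let V := generatedBy M
  let A := V ⊓ ofIdentities {idn u00 u10, idn u01 u11}
  let B := V ⊓ ofIdentities {idn u00 u01, idn u10 u11}
  let C := V ⊓ ofIdentities {idn u00 u10}
  have symm : ∀ {a b : FreeMonoid Γ}, SatOver M a b → SatOver M b a :=
    fun h φ => (h φ).symm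
  have hsub : ∀ e : Identity, Satisfies M e → ∀ φ : Letter → FreeMonoid Γ, ∀ p s : FreeMonoid Γ,
      SatOver M (p * FreeMonoid.lift φ e.1 * s) (p * FreeMonoid.lift φ e.2 * s) := by
    intro e he φ p s θ
    have := he (fun l => FreeMonoid.lift θ (φ l))
    simp only [map_mul, FreeMonoid.hom_map_lift]
    exact congrArg (fun r => FreeMonoid.lift θ p * r * FreeMonoid.lift θ s) this
  -- A union of classes of the equational theory is closed under every identity of `M`, in every
  -- context.
  have hV : ∀ K : Set (FreeMonoid Γ), (∀ a b : FreeMonoid Γ, SatOver M a b → a ∈ K → b ∈ K) →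
      MonCat.of (synCon K).Quotient ∈ V.carrier := by
    intro K hK e he
    refine (hSyn K e).2 fun φ p s => ?_
    have := hsub e he φ p s
    exact ⟨hK _ _ this, hK _ _ (symm this)⟩
  have hAC : A ≤ C := by
    refine inf_le_inf_left _ ?_
    intro N hN e he
    exact hN e (Or.inl he)
  have mA : MonCat.of (synCon KA).Quotient ∈ A.carrier := by
    refine mem_inf (hV KA hA) ?_
    rintro e (rfl | rfl)
    · exact (hid _ _ _).2 ((satOver_synCon_iff _ _ _).2 hA1)
    · exact (hid _ _ _).2 ((satOver_synCon_iff _ _ _).2 hA2)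
  have mB : MonCat.of (synCon KB).Quotient ∈ B.carrier := by
    refine mem_inf (hV KB hB) ?_
    rintro e (rfl | rfl)
    · exact (hid _ _ _).2 ((satOver_synCon_iff _ _ _).2 hB1)
    · exact (hid _ _ _).2 ((satOver_synCon_iff _ _ _).2 hB2)
  have mC : MonCat.of (synCon (KA ∩ KB)).Quotient ∈ C.carrier := by
    refine mem_inf (hV _ fun a b h hab => ⟨hA a b h hab.1, hB a b h hab.2⟩) ?_
    rintro e rfl
    exact (hid _ _ _).2 ((satOver_synCon_iff _ _ _).2 hC)
  -- An identity of the join holds in both syntactic monoids, so both languages are closed under it,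
  -- and then so is their intersection.
  have mAB : MonCat.of (synCon (KA ∩ KB)).Quotient ∈ (A ⊔ B).carrier := by
    refine mem_sup fun e heA heB => ?_
    have a1 := (hSyn KA e).1 (heA _ mA)
    have b1 := (hSyn KB e).1 (heB _ mB)
    exact (hSyn _ e).2 fun φ p s => and_congr (a1 φ p s) (b1 φ p s)
  have hmem := mem_inf mAB mC
  have leA : A ≤ V := inf_le_left
  have leB : B ≤ V := inf_le_left
  have leC : C ≤ V := inf_le_left
  have hle : (A ⊔ B) ⊓ C ≤ A ⊔ (B ⊓ C) :=
    @IsModularLattice.sup_inf_le_assoc_of_le (Set.Iic V) _ hmod ⟨A, leA⟩ ⟨B, leB⟩ ⟨C, leC⟩ hAC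
  have hA' : A ≤ ofIdentities {idn u01 u11} := by
    refine inf_le_right.trans ?_
    intro N hN e he
    exact hN e (Or.inr he)
  -- Here u01 ≈ u00 ≈ u10 ≈ u11 closes the square.
  have hB' : B ⊓ C ≤ ofIdentities {idn u01 u11} := by
    have e1 : B ⊓ C ≤ ofIdentities {idn u00 u01, idn u10 u11} := inf_le_left.trans inf_le_right
    have e2 : B ⊓ C ≤ ofIdentities {idn u00 u10} := inf_le_right.trans inf_le_right
    rintro N hN e rfl φ
    have i1 := e1 hN _ (Or.inl rfl) φ
    have i2 := e1 hN _ (Or.inr rfl) φ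
    have i3 := e2 hN _ rfl φ
    exact i1.symm.trans (i3.trans i2)
  have hfin := (hle.trans (sup_le hA' hB')) hmem
  -- With the identity substitution and the empty context, `u01` and `u11` would belong to the
  -- intersection together.
  have := (satOver_synCon_iff _ _ _).1 ((hid _ _ _).1 (hfin _ rfl)) FreeMonoid.of 1 1
  have e : ∀ c : FreeMonoid Γ, (1 : FreeMonoid Γ) * FreeMonoid.lift FreeMonoid.of c * 1 = c := by
    intro c
    rw [one_mul, mul_one]
    have : FreeMonoid.lift (FreeMonoid.of : Γ → FreeMonoid Γ) = MonoidHom.id _ :=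
      FreeMonoid.hom_eq fun x => by simp
    rw [this]
    rfl
  rw [e, e] at this
  exact h2 (this.1 h1)

/-! ### Projections of lists onto two letters -/

section Lists

variable {α β : Type} [DecidableEq α] [DecidableEq β]

/-- The projection of a list onto two letters. -/
def filter2 (p q : α) (v : List α) : List α := v.filter fun g => g = p ∨ g = q

theorem filter2_append (p q : α) (v w : List α) :
    filter2 p q (v ++ w) = filter2 p q v ++ filter2 p q w := List.filter_append ..

@[simp] theorem filter2_nil (p q : α) : filter2 p q [] = [] := rfl

theorem filter2_cons (p q a : α) (v : List α) :
    filter2 p q (a :: v) = if a = p ∨ a = q then a :: filter2 p q v else filter2 p q v := by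
  simp [filter2, List.filter_cons]

theorem filter2_comm (p q : α) (v : List α) : filter2 p q v = filter2 q p v := by
  simp only [filter2, or_comm]

theorem mem_filter2 {p q g : α} {v : List α} : g ∈ filter2 p q v ↔ g ∈ v ∧ (g = p ∨ g = q) := by
  simp [filter2]

theorem count_filter2_left (p q : α) (v : List α) : (filter2 p q v).count p = v.count p :=
  List.count_filter (by simp)

theorem count_filter2_right (p q : α) (v : List α) : (filter2 p q v).count q = v.count q :=
  List.count_filter (by simp)

theorem filter2_eq_nil {p q : α} {v : List α} (hp : p ∉ v) (hq : q ∉ v) : filter2 p q v = [] := by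
  rw [filter2, List.filter_eq_nil_iff]
  intro a ha
  simp only [decide_eq_true_eq, not_or]
  exact ⟨fun e => hp (e ▸ ha), fun e => hq (e ▸ ha)⟩

/-- The projection onto the two first letters forces them to agree; cancelling this letter preserves
the equality of all projections. -/
theorem eq_of_filter2_eq : ∀ {v w : List α}, (∀ p q, filter2 p q v = filter2 p q w) → v = w
  | [], [], _ => rfl
  | [], b :: w, h => by simpa [filter2_cons] using h b b
  | a :: v, [], h => by simpa [filter2_cons] using h a a
  | a :: v, b :: w, h => by
    have h1 := h a b
    simp only [filter2_cons, true_or, or_true, if_true, List.cons.injEq] at h1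
    obtain ⟨rfl, -⟩ := h1
    congr 1
    refine eq_of_filter2_eq fun p q => ?_
    have := h p q
    rw [filter2_cons, filter2_cons] at this
    split_ifs at this
    · exact (List.cons.inj this).2
    · exact this

theorem filter2_flatMap (p q : β) (ψ : α → List β) (v : List α) :
    filter2 p q (v.flatMap ψ) = v.flatMap fun g => filter2 p q (ψ g) := by
  induction v with
  | nil => rfl
  | cons a v ih => rw [List.flatMap_cons, List.flatMap_cons, filter2_append, ih]

theorem flatMap_code (p q : α) (s s' : β) (v : List α) :
    (v.flatMap fun g => if g = p then [s] else if g = q then [s'] else []) =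
      (filter2 p q v).map fun g => if g = p then s else s' := by
  induction v with
  | nil => rfl
  | cons a v ih =>
    rw [List.flatMap_cons, ih, filter2_cons]
    by_cases h1 : a = p
    · simp [h1]
    · by_cases h2 : a = q
      · subst h2
        simp [h1]
      · simp [h1, h2]

/-- If the images of the projections onto two letters under a renaming agree, then so do the
projections. -/
theorem filter2_eq_of_code {p q : α} {s s' : β} (hs : s ≠ s') {v w : List α}
    (h : (v.flatMap fun g => if g = p then [s] else if g = q then [s'] else []) =
      (w.flatMap fun g => if g = p then [s] else if g = q then [s'] else [])) :
    filter2 p q v = filter2 p q w := by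
  rw [flatMap_code, flatMap_code] at h
  have hv : ∀ g ∈ filter2 p q v, g = p ∨ g = q := fun g hg => (mem_filter2.1 hg).2
  have hw : ∀ g ∈ filter2 p q w, g = p ∨ g = q := fun g hg => (mem_filter2.1 hg).2
  generalize filter2 p q v = v' at h hv
  generalize filter2 p q w = w' at h hw
  induction v' generalizing w' with
  | nil => simpa using h.symm
  | cons a v ih =>
    cases w' with
    | nil => simp at h
    | cons b w =>
      simp only [List.map_cons, List.cons.injEq] at h
      have hab : a = b := by
        have h1 := h.1
        rcases hv a (by simp) with rfl | rfl <;> rcases hw b (by simp) with rfl | rfl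
        · rfl
        · by_contra hne
          rw [if_pos rfl, if_neg (fun e => hne e.symm)] at h1
          exact hs h1
        · by_contra hne
          rw [if_pos rfl, if_neg hne] at h1
          exact hs h1.symm
        · rfl
      rw [hab, ih (fun g hg => hv g (by simp [hg])) w h.2 (fun g hg => hw g (by simp [hg]))]

/-- Reduces statements about prefixes of `v` to the finitely many prefixes of a short projection. -/
theorem exists_take_of_filter2 {p q : α} {v W L R : List α} (h : filter2 p q v = W)
    (hv : v = L ++ R) :
    ∃ i ≤ W.length, L.count p = (W.take i).count p ∧ L.count q = (W.take i).count q := by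
  subst hv
  rw [filter2_append] at h
  refine ⟨(filter2 p q L).length, ?_, ?_, ?_⟩
  · rw [← h]
    simp
  · rw [← h, List.take_left, count_filter2_left]
  · rw [← h, List.take_left, count_filter2_right]

/-- The possible counts in a prefix of a list with projection `ppqq`. -/
theorem counts_aabb {p q : α} (hpq : p ≠ q) {v L R : List α} (h : filter2 p q v = [p, p, q, q])
    (hv : v = L ++ R) :
    (L.count p = 2 ∨ L.count q = 0) ∧ L.count p ≤ 2 ∧ L.count q ≤ 2 := by
  obtain ⟨i, hi, h1, h2⟩ := exists_take_of_filter2 h hv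
  have hqp := hpq.symm
  simp only [List.length_cons, List.length_nil] at hi
  interval_cases i <;> simp_all

/-- The possible counts in a prefix of a list with projection `pqpq`. -/
theorem counts_abab {p q : α} (hpq : p ≠ q) {v L R : List α} (h : filter2 p q v = [p, q, p, q])
    (hv : v = L ++ R) :
    L.count q ≤ L.count p ∧ L.count p ≤ L.count q + 1 ∧ L.count p ≤ 2 := by
  obtain ⟨i, hi, h1, h2⟩ := exists_take_of_filter2 h hv
  have hqp := hpq.symm
  simp only [List.length_cons, List.length_nil] at hi
  interval_cases i <;> simp_all

/-- The possible counts in a prefix of a list with projection `pqqp`. -/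
theorem counts_abba {p q : α} (hpq : p ≠ q) {v L R : List α} (h : filter2 p q v = [p, q, q, p])
    (hv : v = L ++ R) :
    (L.count p = 0 → L.count q = 0) ∧ (L.count p = 2 → L.count q = 2) ∧ L.count p ≤ 2 ∧
      L.count q ≤ 2 := by
  obtain ⟨i, hi, h1, h2⟩ := exists_take_of_filter2 h hv
  have hqp := hpq.symm
  simp only [List.length_cons, List.length_nil] at hi
  interval_cases i <;> simp_all

/-! ### Position of a letter relative to a separating letter -/

/-- The position of all occurrences of a letter relative to a separating letter. -/
inductive Loc : Type
  | aft : Loc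
  | str : Loc
  | bfr : Loc

/-- The letter `p` lies after the letter `σ`, has one occurrence on each side of `σ`,
or lies before `σ`. -/
def At (v : List α) (σ p : α) : Loc → Prop
  | .aft => ∀ L R, v = L ++ σ :: R → p ∉ L
  | .str => ∀ L R, v = L ++ σ :: R → L.count p = 1 ∧ R.count p = 1
  | .bfr => ∀ L R, v = L ++ σ :: R → p ∉ R

theorem At.of_filter2 {v W : List α} {σ p : α} {r : Loc} (h : filter2 σ p v = W)
    (hW : At W σ p r) : At v σ p r := by
  have key : ∀ L R, v = L ++ σ :: R → W = filter2 σ p L ++ σ :: filter2 σ p R := by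
    rintro L R rfl
    rw [← h, filter2_append, filter2_cons, if_pos (Or.inl rfl)]
  cases r
  · exact fun L R e hp => hW _ _ (key L R e) (mem_filter2.2 ⟨hp, Or.inr rfl⟩)
  · intro L R e
    have := hW _ _ (key L R e)
    rwa [count_filter2_right, count_filter2_right] at this
  · exact fun L R e hp => hW _ _ (key L R e) (mem_filter2.2 ⟨hp, Or.inr rfl⟩)

/-- Since `σ` occurs once, the only split of the projection at `σ` is the projection of the split of
`v`. -/
theorem At.filter2 {v : List α} {σ p : α} {r : Loc} (h : At v σ p r)
    (hσ : v.count σ = 1) : At (filter2 σ p v) σ p r := by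
  by_cases hpσ : p = σ
  · subst hpσ
    obtain ⟨L, R, rfl⟩ := List.append_of_mem (List.count_pos_iff.1 (by omega : 0 < v.count p))
    simp only [List.count_append, List.count_cons_self] at hσ
    have hL : p ∉ L := List.count_eq_zero.1 (by omega)
    have hR : p ∉ R := List.count_eq_zero.1 (by omega)
    cases r
    · intro L' R' e hp
      have := congrArg (List.count p) e
      rw [count_filter2_left] at this
      simp only [List.count_append, List.count_cons_self] at this
      have := List.count_pos_iff.2 hp
      omega
    · have := h L R rfl
      simp [List.count_eq_zero.2 hL] at this
    · intro L' R' e hp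
      have := congrArg (List.count p) e
      rw [count_filter2_left] at this
      simp only [List.count_append, List.count_cons_self] at this
      have := List.count_pos_iff.2 hp
      omega
  · obtain ⟨L, R, rfl⟩ := List.append_of_mem (List.count_pos_iff.1 (by omega : 0 < v.count σ))
    have key : ∀ L' R', MonVar.filter2 σ p (L ++ σ :: R) = L' ++ σ :: R' →
        L' = MonVar.filter2 σ p L ∧ R' = MonVar.filter2 σ p R := by
      intro L' R' e
      rw [filter2_append, filter2_cons, if_pos (Or.inl rfl)] at e
      simp only [List.count_append, List.count_cons_self] at hσ
      have hL : σ ∉ MonVar.filter2 σ p L := fun hm =>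
        absurd (List.count_pos_iff.2 (mem_filter2.1 hm).1) (by omega)
      have hR : σ ∉ MonVar.filter2 σ p R := fun hm =>
        absurd (List.count_pos_iff.2 (mem_filter2.1 hm).1) (by omega)
      have e' := e
      rw [List.append_eq_append_iff] at e'
      rcases e' with ⟨a, h1, h2⟩ | ⟨a, h1, h2⟩
      · cases a with
        | nil => simp_all
        | cons b a =>
          simp only [List.cons_append, List.cons.injEq] at h2
          exact absurd (by rw [h2.2]; simp) hR
      · cases a with
        | nil => simp_all
        | cons b a =>
          simp only [List.cons_append, List.cons.injEq] at h2
          exact absurd (by rw [h1, h2.1]; simp) hL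
    cases r
    · intro L' R' e
      obtain ⟨rfl, rfl⟩ := key L' R' e
      exact fun hm => h L R rfl (mem_filter2.1 hm).1
    · intro L' R' e
      obtain ⟨rfl, rfl⟩ := key L' R' e
      rw [count_filter2_right, count_filter2_right]
      exact h L R rfl
    · intro L' R' e
      obtain ⟨rfl, rfl⟩ := key L' R' e
      exact fun hm => h L R rfl (mem_filter2.1 hm).1

theorem At.map {f : α → β} (hf : Function.Injective f) {v : List α} {σ p : α} {r : Loc}
    (h : At v σ p r) : At (v.map f) (f σ) (f p) r := by
  have key : ∀ L R, v.map f = L ++ f σ :: R → ∃ L' R', L = L'.map f ∧ R = R'.map f ∧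
      v = L' ++ σ :: R' := by
    intro L R e
    obtain ⟨L', R', rfl, rfl, e2⟩ := List.map_eq_append_iff.1 e
    obtain ⟨a, R'', rfl, e3, rfl⟩ := List.map_eq_cons_iff.1 e2
    rw [hf e3]
    exact ⟨L', R'', rfl, rfl, rfl⟩
  cases r
  · intro L R e hm
    obtain ⟨L', R', rfl, rfl, e'⟩ := key L R e
    exact h _ _ e' ((List.mem_map_of_injective hf).1 hm)
  · intro L R e
    obtain ⟨L', R', rfl, rfl, e'⟩ := key L R e
    rw [List.count_map_of_injective _ _ hf, List.count_map_of_injective _ _ hf]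
    exact h _ _ e'
  · intro L R e hm
    obtain ⟨L', R', rfl, rfl, e'⟩ := key L R e
    exact h _ _ e' ((List.mem_map_of_injective hf).1 hm)

theorem at_str_of_filter2 {v : List α} {σ p : α} (hne : p ≠ σ) (h : filter2 p σ v = [p, σ, p]) :
    At v σ p .str := by
  rw [filter2_comm] at h
  refine At.of_filter2 h fun L R e => ?_
  rcases L with _ | ⟨_, _ | ⟨_, _ | ⟨_, L⟩⟩⟩ <;> simp_all
  obtain ⟨rfl, rfl⟩ := e
  simp

theorem at_bfr_of_filter2 {v : List α} {σ p : α} (hne : p ≠ σ) (h : filter2 p σ v = [p, p, σ]) :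
    At v σ p .bfr := by
  rw [filter2_comm] at h
  refine At.of_filter2 h fun L R e => ?_
  rcases L with _ | ⟨_, _ | ⟨_, _ | ⟨_, L⟩⟩⟩ <;> simp_all

theorem at_aft_of_filter2 {v : List α} {σ p : α} (hne : p ≠ σ) (h : filter2 p σ v = [σ, p, p]) :
    At v σ p .aft := by
  rw [filter2_comm] at h
  refine At.of_filter2 h fun L R e => ?_
  rcases L with _ | ⟨_, _ | ⟨_, _ | ⟨_, L⟩⟩⟩ <;> simp_all

/-- Two letters are linked if both occur in two disjoint factors without letters from `S`. -/
def Linked (S : α → Prop) (v : List α) (p q : α) : Prop :=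
  ∃ v0 A r1 B r3, v = v0 ++ (A ++ (r1 ++ (B ++ r3))) ∧ (p ∈ A ∧ q ∈ A ∧ p ∈ B ∧ q ∈ B) ∧
    (∀ g ∈ A, ¬ S g) ∧ ∀ g ∈ B, ¬ S g

theorem Linked.symm {S : α → Prop} {v : List α} {p q : α} (h : Linked S v p q) :
    Linked S v q p := by
  obtain ⟨v0, A, r1, B, r3, e, ⟨h1, h2, h3, h4⟩, h5⟩ := h
  exact ⟨v0, A, r1, B, r3, e, ⟨h2, h1, h4, h3⟩, h5⟩

/-- The letter `σ` lies outside the factors `A` and `B`, thus before both, between them or after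
both. Each case leaves a single possible location, common to `p` and `q`. -/
theorem Linked.loc_eq {S : α → Prop} {v : List α} {p q σ : α} (h : Linked S v p q) (hS : S σ)
    (hσ : σ ∈ v) {r r' : Loc} (hp : At v σ p r) (hq : At v σ q r') : r = r' := by
  have three : ∃ L R, v = L ++ σ :: R ∧
      ((2 ≤ R.count p ∧ 2 ≤ R.count q) ∨ (p ∈ L ∧ p ∈ R ∧ q ∈ L ∧ q ∈ R) ∨
        (2 ≤ L.count p ∧ 2 ≤ L.count q)) := by
    obtain ⟨v0, A, r1, B, r3, rfl, ⟨h1, h2, h3, h4⟩, hA, hB⟩ := h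
    have c1 := List.count_pos_iff.2 h1
    have c2 := List.count_pos_iff.2 h2
    have c3 := List.count_pos_iff.2 h3
    have c4 := List.count_pos_iff.2 h4
    simp only [List.mem_append] at hσ
    rcases hσ with h | h | h | h | h
    · obtain ⟨L, R, rfl⟩ := List.append_of_mem h
      refine ⟨L, R ++ (A ++ (r1 ++ (B ++ r3))), by simp, Or.inl ?_⟩
      simp only [List.count_append]
      omega
    · exact absurd hS (hA _ h)
    · obtain ⟨L, R, rfl⟩ := List.append_of_mem h
      refine ⟨v0 ++ A ++ L, R ++ (B ++ r3), by simp, Or.inr (Or.inl ?_)⟩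
      simp [h1, h2, h3, h4]
    · exact absurd hS (hB _ h)
    · obtain ⟨L, R, rfl⟩ := List.append_of_mem h
      refine ⟨v0 ++ A ++ r1 ++ B ++ L, R, by simp, Or.inr (Or.inr ?_)⟩
      simp only [List.count_append]
      omega
  obtain ⟨L, R, e, h⟩ := three
  have mp : ∀ {l : List α} {g : α}, 2 ≤ l.count g → g ∈ l := fun h =>
    List.count_pos_iff.1 (by omega)
  cases r <;> cases r' <;> first | rfl | exfalso
  all_goals
    have a1 := hp L R e
    have a2 := hq L R e
    rcases h with ⟨h1, h2⟩ | ⟨h1, h2, h3, h4⟩ | ⟨h1, h2⟩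
  all_goals first
    | exact a1 (mp h1)
    | exact a2 (mp h2)
    | exact a1 h1
    | exact a1 h2
    | exact a2 h3
    | exact a2 h4
    | omega

/-! ### Changing the exponents of islands -/

/-- Replace each letter by its power with the given exponent. -/
def expand (e : α → ℕ) (L : List α) : List α := L.flatMap fun l => List.replicate (e l) l

@[simp] theorem expand_nil (e : α → ℕ) : expand e [] = [] := rfl

theorem expand_cons (e : α → ℕ) (a : α) (L : List α) :
    expand e (a :: L) = List.replicate (e a) a ++ expand e L := rfl

theorem expand_append (e : α → ℕ) (L R : List α) :
    expand e (L ++ R) = expand e L ++ expand e R := List.flatMap_append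

theorem expand_eq_self {e : α → ℕ} {L : List α} (h : ∀ a ∈ L, e a = 1) : expand e L = L := by
  induction L with
  | nil => rfl
  | cons a L ih => simp [expand_cons, h a (by simp), ih fun b hb => h b (by simp [hb])]

theorem count_expand (e : α → ℕ) (a : α) (L : List α) :
    (expand e L).count a = e a * L.count a := by
  induction L with
  | nil => simp
  | cons b L ih =>
    rw [expand_cons, List.count_append, ih, List.count_replicate, List.count_cons]
    by_cases h : b = a
    · subst h
      simp
      ring
    · simp [h]

theorem expand_congr {e e' : α → ℕ} {L : List α} (h : ∀ a ∈ L, e a = e' a) :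
    expand e L = expand e' L := by
  induction L with
  | nil => rfl
  | cons a L ih => rw [expand_cons, expand_cons, h a (by simp), ih fun b hb => h b (by simp [hb])]

end Lists

theorem foldr_glue_expand (e : Letter → ℕ) (he : ∀ a, 1 ≤ e a) (L : List Letter) :
    (expand e L).foldr glue [] = L.foldr glue [] := by
  have rep : ∀ (k : ℕ) (a : Letter) (m : List Letter),
      (List.replicate (k + 1) a).foldr glue m = glue a m := by
    intro k a m
    induction k with
    | zero => rfl
    | succ k ih => rw [List.replicate_succ, List.foldr_cons, ih, glue_glue]
  induction L with
  | nil => rfl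
  | cons a L ih =>
    obtain ⟨k, hk⟩ := Nat.exists_eq_add_of_le' (he a)
    rw [expand_cons, List.foldr_append, ih, hk, rep, List.foldr_cons]

theorem count_foldr_glue_le (l : List Letter) (a : Letter) :
    (l.foldr glue []).count a ≤ l.count a := by
  induction l with
  | nil => simp
  | cons b l ih =>
    rw [List.foldr_cons]
    have h : ∀ k, (glue b k).count a ≤ (b :: k).count a := by
      intro k
      unfold glue
      split_ifs
      · rw [List.count_cons]
        omega
      · exact le_rfl
    have := h (l.foldr glue [])
    rw [List.count_cons] at this ⊢
    omega

theorem mem_foldr_glue (l : List Letter) (a : Letter) : a ∈ l.foldr glue [] ↔ a ∈ l := by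
  have := mem_islands_iff (FreeMonoid.ofList l) a
  rwa [islands, destutter_eq_foldr] at this

/-- A word is recovered from the sequence of its islands if every letter either has only islands
of length one or has only one island. -/
theorem eq_expand_of_foldr_glue (v : List Letter) : ∀ e : Letter → ℕ,
    (∀ a, (e a = 1 ∧ v.count a = (v.foldr glue []).count a) ∨
      ((v.foldr glue []).count a = 1 ∧ e a = v.count a) ∨ a ∉ v) →
    v = expand e (v.foldr glue []) := by
  induction v with
  | nil => simp
  | cons b v ih =>
    intro e h
    rw [List.foldr_cons] at h ⊢
    by_cases hd : (v.foldr glue []).head? = some b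
    · have hg : glue b (v.foldr glue []) = v.foldr glue [] := by simp [glue, hd]
      rw [hg] at h ⊢
      obtain ⟨L, hL⟩ : ∃ L, v.foldr glue [] = b :: L := by
        cases hv : v.foldr glue [] with
        | nil => simp [hv] at hd
        | cons c L =>
          rw [hv] at hd
          simp only [List.head?_cons, Option.some.injEq] at hd
          exact ⟨L, by rw [hd]⟩
      have hb : (v.foldr glue []).count b = 1 ∧ e b = v.count b + 1 := by
        rcases h b with ⟨-, h1⟩ | ⟨h1, h2⟩ | h1
        · have := count_foldr_glue_le v b
          rw [List.count_cons_self] at h1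
          omega
        · rw [List.count_cons_self] at h2
          exact ⟨h1, h2⟩
        · simp at h1
      -- The first letter only lengthens the single island of `b`, so the shorter list needs an
      -- exponent smaller by one at `b`.
      have ih' := ih (Function.update e b (v.count b)) (by
        intro a
        by_cases hab : a = b
        · subst hab
          exact Or.inr (Or.inl ⟨hb.1, by simp⟩)
        · have := h a
          rw [List.count_cons_of_ne (Ne.symm hab)] at this
          rw [Function.update_of_ne hab]
          simpa [hab] using this)
      rw [hL] at ih' hb ⊢
      rw [expand_cons] at ih' ⊢
      have hbL : b ∉ L := by
        intro hm
        have := List.count_pos_iff.2 hm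
        have := hb.1
        rw [List.count_cons_self] at this
        omega
      rw [hb.2, List.replicate_succ, List.cons_append]
      congr 1
      rw [Function.update_self, expand_congr (e' := e)] at ih'
      · exact ih'
      · intro a ha
        exact Function.update_of_ne (fun hab : a = b => hbL (hab ▸ ha)) _ _
    · have hg : glue b (v.foldr glue []) = b :: v.foldr glue [] := by simp [glue, hd]
      rw [hg] at h ⊢
      rw [expand_cons]
      have hb : e b = 1 := by
        rcases h b with ⟨h1, -⟩ | ⟨h1, h2⟩ | h1
        · exact h1
        · rw [List.count_cons_self] at h1 h2
          have h3 : b ∉ v := fun hm => by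
            have := List.count_pos_iff.2 ((mem_foldr_glue v b).2 hm)
            omega
          rw [h2, List.count_eq_zero.2 h3]
        · simp at h1
      rw [hb, List.replicate_one, List.singleton_append]
      congr 1
      refine ih e fun a => ?_
      have := h a
      by_cases hab : a = b
      · subst hab
        simp only [List.count_cons_self] at this
        rcases this with ⟨h1, h2⟩ | ⟨h1, h2⟩ | h1
        · exact Or.inl ⟨h1, by omega⟩
        · refine Or.inr (Or.inr fun hm => ?_)
          have := List.count_pos_iff.2 ((mem_foldr_glue v a).2 hm)
          omega
        · simp at h1
      · simpa [hab, List.count_cons_of_ne (Ne.symm hab)] using this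

open Letter

/-! ### The common shape of the words `c_n^{(i)}[π, τ]` -/

/-- `z'_a t'_a ⋯ z'_{a+k-1} t'_{a+k-1}`. -/
def primes (a : ℕ) : ℕ → List Letter
  | 0 => []
  | k + 1 => primes a k ++ [zp (a + k), tp (a + k)]

/-- `t_0 z_0 ⋯ t_{k-1} z_{k-1}`. -/
def tailW : ℕ → List Letter
  | 0 => []
  | k + 1 => tailW k ++ [ts k, zs k]

/-- The letters that occur once. -/
def smp : Letter → Bool
  | t => true
  | ts _ => true
  | tp _ => true
  | _ => false

/-- The letters whose occurrences form one island. -/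
def sq : Letter → Bool
  | ys _ => true
  | _ => false

/-- Exponents that are allowed for the letters of a word. -/
structure Adm (e : Letter → ℕ) : Prop where
  two_le : ∀ i, 2 ≤ e (ys i)
  eq_one : ∀ l, sq l = false → e l = 1

/-- The middle part of the word, with the squares replaced by letters. -/
structure Core (n m : ℕ) (C : List Letter) : Prop where
  pos : 1 ≤ n
  nodup : C.Nodup
  zs_mem : ∀ j, zs j ∈ C ↔ j < m
  zp_mem : ∀ i, zp i ∈ C ↔ i < 2 * n
  x_notMem : x ∉ C
  y_notMem : y ∉ C
  smp_notMem : ∀ l, smp l = true → l ∉ C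
  head : ∃ j C', C = zs j :: C'
  last : ∃ j C', C = C' ++ [zs j]

/-- The word with the middle part `C`, and with the letters `X` in place of `xy`. -/
def shape (n m : ℕ) (C X : List Letter) : List Letter :=
  primes 0 n ++ (X ++ (t :: (primes n n ++ (x :: (C ++ (y :: tailW m))))))

/-! ### Letters and multiplicities in the outer blocks -/

section Counts

theorem mem_primes {a k : ℕ} {l : Letter} :
    l ∈ primes a k ↔ ∃ i < k, l = zp (a + i) ∨ l = tp (a + i) := by
  induction k with
  | zero => simp [primes]
  | succ k ih =>
    simp only [primes, List.mem_append, ih, List.mem_cons, List.not_mem_nil, or_false]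
    constructor
    · rintro (⟨i, hi, h⟩ | h)
      · exact ⟨i, by omega, h⟩
      · exact ⟨k, by omega, h⟩
    · rintro ⟨i, hi, h⟩
      rcases Nat.lt_succ_iff_lt_or_eq.1 hi with hi | rfl
      · exact Or.inl ⟨i, hi, h⟩
      · exact Or.inr h

theorem mem_tailW {k : ℕ} {l : Letter} : l ∈ tailW k ↔ ∃ i < k, l = ts i ∨ l = zs i := by
  induction k with
  | zero => simp [tailW]
  | succ k ih =>
    simp only [tailW, List.mem_append, ih, List.mem_cons, List.not_mem_nil, or_false]
    constructor
    · rintro (⟨i, hi, h⟩ | h)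
      · exact ⟨i, by omega, h⟩
      · exact ⟨k, by omega, h⟩
    · rintro ⟨i, hi, h⟩
      rcases Nat.lt_succ_iff_lt_or_eq.1 hi with hi | rfl
      · exact Or.inl ⟨i, hi, h⟩
      · exact Or.inr h

theorem nodup_primes (a k : ℕ) : (primes a k).Nodup := by
  induction k with
  | zero => simp [primes]
  | succ k ih =>
    rw [primes, List.nodup_append]
    refine ⟨ih, by simp, ?_⟩
    intro b hb c hc hbc
    subst hbc
    obtain ⟨i, hi, h⟩ := mem_primes.1 hb
    simp only [List.mem_cons, List.not_mem_nil, or_false] at hc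
    rcases h with rfl | rfl <;> rcases hc with hc | hc <;> injection hc <;> omega

theorem nodup_tailW (k : ℕ) : (tailW k).Nodup := by
  induction k with
  | zero => simp [tailW]
  | succ k ih =>
    rw [tailW, List.nodup_append]
    refine ⟨ih, by simp, ?_⟩
    intro b hb c hc hbc
    subst hbc
    obtain ⟨i, hi, h⟩ := mem_tailW.1 hb
    simp only [List.mem_cons, List.not_mem_nil, or_false] at hc
    rcases h with rfl | rfl <;> rcases hc with hc | hc <;> injection hc <;> omega

theorem zp_mem_primes {a k i : ℕ} : zp i ∈ primes a k ↔ a ≤ i ∧ i < a + k := by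
  rw [mem_primes]
  constructor
  · rintro ⟨j, hj, h | h⟩ <;> injection h
    omega
  · intro h
    exact ⟨i - a, by omega, Or.inl (by congr 1; omega)⟩

theorem tp_mem_primes {a k i : ℕ} : tp i ∈ primes a k ↔ a ≤ i ∧ i < a + k := by
  rw [mem_primes]
  constructor
  · rintro ⟨j, hj, h | h⟩ <;> injection h
    omega
  · intro h
    exact ⟨i - a, by omega, Or.inr (by congr 1; omega)⟩

theorem zs_mem_tailW {k i : ℕ} : zs i ∈ tailW k ↔ i < k := by
  rw [mem_tailW]
  constructor
  · rintro ⟨j, hj, h | h⟩ <;> injection h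
    omega
  · intro h
    exact ⟨i, h, Or.inr rfl⟩

theorem ts_mem_tailW {k i : ℕ} : ts i ∈ tailW k ↔ i < k := by
  rw [mem_tailW]
  constructor
  · rintro ⟨j, hj, h | h⟩ <;> injection h
    omega
  · intro h
    exact ⟨i, h, Or.inl rfl⟩

@[simp] theorem x_notMem_primes {a k : ℕ} : x ∉ primes a k := by simp [mem_primes]
@[simp] theorem y_notMem_primes {a k : ℕ} : y ∉ primes a k := by simp [mem_primes]
@[simp] theorem t_notMem_primes {a k : ℕ} : t ∉ primes a k := by simp [mem_primes]
@[simp] theorem zs_notMem_primes {a k i : ℕ} : zs i ∉ primes a k := by simp [mem_primes]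
@[simp] theorem ts_notMem_primes {a k i : ℕ} : ts i ∉ primes a k := by simp [mem_primes]
@[simp] theorem ys_notMem_primes {a k i : ℕ} : ys i ∉ primes a k := by simp [mem_primes]
@[simp] theorem x_notMem_tailW {k : ℕ} : x ∉ tailW k := by simp [mem_tailW]
@[simp] theorem y_notMem_tailW {k : ℕ} : y ∉ tailW k := by simp [mem_tailW]
@[simp] theorem t_notMem_tailW {k : ℕ} : t ∉ tailW k := by simp [mem_tailW]
@[simp] theorem zp_notMem_tailW {k i : ℕ} : zp i ∉ tailW k := by simp [mem_tailW]
@[simp] theorem tp_notMem_tailW {k i : ℕ} : tp i ∉ tailW k := by simp [mem_tailW]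
@[simp] theorem ys_notMem_tailW {k i : ℕ} : ys i ∉ tailW k := by simp [mem_tailW]

theorem count_primes (a k : ℕ) (l : Letter) :
    (primes a k).count l = if l ∈ primes a k then 1 else 0 := (nodup_primes a k).count

theorem count_tailW (k : ℕ) (l : Letter) :
    (tailW k).count l = if l ∈ tailW k then 1 else 0 := (nodup_tailW k).count

theorem tailW_split {j m : ℕ} (h : j < m) : ∃ R, tailW m = tailW j ++ ts j :: zs j :: R := by
  induction m with
  | zero => omega
  | succ m ih =>
    rcases Nat.lt_succ_iff_lt_or_eq.1 h with h | rfl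
    · obtain ⟨R, hR⟩ := ih h
      exact ⟨R ++ [ts m, zs m], by simp [tailW, hR]⟩
    · exact ⟨[], by simp [tailW]⟩

theorem primes_split {a i k : ℕ} (h : i < k) :
    ∃ R, primes a k = primes a i ++ zp (a + i) :: tp (a + i) :: R := by
  induction k with
  | zero => omega
  | succ k ih =>
    rcases Nat.lt_succ_iff_lt_or_eq.1 h with h | rfl
    · obtain ⟨R, hR⟩ := ih h
      exact ⟨R ++ [zp (a + k), tp (a + k)], by simp [primes, hR]⟩
    · exact ⟨[], by simp [primes]⟩

end Counts

theorem Adm.sq_le {e : Letter → ℕ} (he : Adm e) (l : Letter) : 1 ≤ e l := by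
  cases l with
  | ys i => exact le_trans (by norm_num) (he.two_le i)
  | _ => exact (he.eq_one _ rfl).ge

namespace Core

variable {n m : ℕ} {C : List Letter} (hC : Core n m C)
include hC

theorem m_pos : 0 < m := by
  obtain ⟨j, C', h⟩ := hC.head
  have := (hC.zs_mem j).1 (by simp [h])
  omega

theorem count (l : Letter) : C.count l = if l ∈ C then 1 else 0 := hC.nodup.count

theorem count_shape (l : Letter) : (shape n m C [x, y]).count l =
    match l with
    | x => 2
    | y => 2
    | t => 1
    | zs j => if j < m then 2 else 0
    | zp i => if i < 2 * n then 2 else 0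
    | ts j => if j < m then 1 else 0
    | tp i => if i < 2 * n then 1 else 0
    | ys i => if ys i ∈ C then 1 else 0 := by
  have h1 := hC.x_notMem
  have h2 := hC.y_notMem
  have h3 : t ∉ C := hC.smp_notMem _ rfl
  have h4 : ∀ i, ts i ∉ C := fun i => hC.smp_notMem _ rfl
  have h5 : ∀ i, tp i ∉ C := fun i => hC.smp_notMem _ rfl
  cases l <;>
    simp [shape, count_primes, count_tailW, hC.count, h1, h2, h3, h4, h5,
      zp_mem_primes, tp_mem_primes, zs_mem_tailW, ts_mem_tailW, hC.zs_mem, hC.zp_mem]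
  all_goals split_ifs <;> omega

theorem isChain_shape : (shape n m C [x, y]).IsChain (· ≠ ·) := by
  have h1 := hC.x_notMem
  have h2 := hC.y_notMem
  have e : shape n m C [x, y] =
      (primes 0 n ++ [x, y, t] ++ primes n n) ++ ((x :: C ++ [y]) ++ tailW m) := by
    simp [shape]
  obtain ⟨k, hk⟩ := Nat.exists_eq_add_of_le' hC.pos
  rw [e, List.isChain_append, List.isChain_append (l₁ := x :: C ++ [y])]
  refine ⟨List.Pairwise.isChain ?_, ⟨List.Pairwise.isChain ?_,
    List.Pairwise.isChain (nodup_tailW m), ?_⟩, ?_⟩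
  · show List.Nodup _
    rw [List.nodup_append, List.nodup_append]
    refine ⟨⟨nodup_primes _ _, by simp, ?_⟩, nodup_primes _ _, ?_⟩
    · intro a ha b hb hab
      subst hab
      obtain ⟨i, hi, rfl | rfl⟩ := mem_primes.1 ha <;> simp at hb
    · intro a ha b hb hab
      subst hab
      obtain ⟨i, hi, rfl | rfl⟩ := mem_primes.1 hb <;>
        simp [zp_mem_primes, tp_mem_primes] at ha
  · show List.Nodup _
    rw [List.cons_append, List.nodup_cons, List.nodup_append]
    refine ⟨by simp [h1], hC.nodup, by simp, ?_⟩
    intro a ha b hb hab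
    simp only [List.mem_singleton] at hb
    subst hab hb
    exact h2 ha
  · intro a ha b hb hab
    subst hab
    have hb' := List.mem_of_mem_head? hb
    rw [List.getLast?_append] at ha
    simp only [List.getLast?_singleton, Option.some_or, Option.mem_def, Option.some.injEq] at ha
    subst ha
    exact y_notMem_tailW hb'
  · intro a ha b hb hab
    simp only [List.cons_append, List.head?_cons, Option.mem_def, Option.some.injEq] at hb
    subst hab hb
    rw [List.getLast?_append, hk] at ha
    simp [primes, List.getLast?_append] at ha

theorem foldr_glue_shape : (shape n m C [x, y]).foldr glue [] = shape n m C [x, y] := by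
  rw [← destutter_eq_foldr]
  exact List.destutter_of_isChain _ _ hC.isChain_shape

theorem foldr_glue_expand_shape {e : Letter → ℕ} (he : Adm e) :
    (expand e (shape n m C [x, y])).foldr glue [] = shape n m C [x, y] := by
  rw [foldr_glue_expand e he.sq_le, hC.foldr_glue_shape]

end Core

/-! ### Positions read off from a split at a letter that occurs once -/

section Position

theorem eq_of_split {α : Type} [DecidableEq α] {v L R L' R' : List α} {σ : α}
    (hv : v = L ++ σ :: R) (hv' : v = L' ++ σ :: R') (hσ : v.count σ = 1) : L = L' ∧ R = R' := by
  subst hv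
  have h1 : σ ∉ L := fun hm => by
    have := List.count_pos_iff.2 hm
    simp only [List.count_append, List.count_cons_self] at hσ
    omega
  rw [List.append_eq_append_iff] at hv'
  rcases hv' with ⟨a, h2, h3⟩ | ⟨a, h2, h3⟩
  · cases a with
    | nil => simp_all
    | cons b a =>
      simp only [List.cons_append, List.cons.injEq] at h3
      obtain ⟨rfl, rfl⟩ := h3
      simp at hσ
      omega
  · cases a with
    | nil => simp_all
    | cons b a =>
      simp only [List.cons_append, List.cons.injEq] at h3
      obtain ⟨rfl, rfl⟩ := h3
      simp [h2] at h1

theorem at_aft_of_split {α : Type} [DecidableEq α] {v L R : List α} {σ p : α}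
    (hv : v = L ++ σ :: R) (hσ : v.count σ = 1) (h : p ∉ L) : At v σ p .aft := by
  intro L' R' e
  rw [← (eq_of_split hv e hσ).1]
  exact h

theorem at_bfr_of_split {α : Type} [DecidableEq α] {v L R : List α} {σ p : α}
    (hv : v = L ++ σ :: R) (hσ : v.count σ = 1) (h : p ∉ R) : At v σ p .bfr := by
  intro L' R' e
  rw [← (eq_of_split hv e hσ).2]
  exact h

theorem at_str_of_split {α : Type} [DecidableEq α] {v L R : List α} {σ p : α}
    (hv : v = L ++ σ :: R) (hσ : v.count σ = 1) (h : L.count p = 1) (h' : R.count p = 1) :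
    At v σ p .str := by
  intro L' R' e
  rw [← (eq_of_split hv e hσ).2, ← (eq_of_split hv e hσ).1]
  exact ⟨h, h'⟩

theorem filter2_of_at_str {α : Type} [DecidableEq α] {v : List α} {σ p : α} (hne : p ≠ σ)
    (hσ : v.count σ = 1) (h : At v σ p .str) : filter2 p σ v = [p, σ, p] := by
  obtain ⟨L, R, rfl⟩ := List.append_of_mem (List.count_pos_iff.1 (by omega : 0 < v.count σ))
  obtain ⟨h1, h2⟩ := h L R rfl
  simp only [List.count_append, List.count_cons_self] at hσ
  have key : ∀ K : List α, K.count σ = 0 → K.count p = 1 → filter2 p σ K = [p] := by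
    intro K h0 h1
    obtain ⟨A, B, rfl⟩ := List.append_of_mem (List.count_pos_iff.1 (by omega : 0 < K.count p))
    simp only [List.count_append, List.count_cons_self, List.count_cons_of_ne hne] at h0 h1
    rw [filter2_append, filter2_cons, if_pos (Or.inl rfl),
      filter2_eq_nil (List.count_eq_zero.1 (by omega)) (List.count_eq_zero.1 (by omega)),
      filter2_eq_nil (List.count_eq_zero.1 (by omega)) (List.count_eq_zero.1 (by omega))]
    rfl
  rw [filter2_append, filter2_cons, if_pos (Or.inr rfl), key L (by omega) h1, key R (by omega) h2]
  rfl

end Position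

section Lists

variable {α : Type} [DecidableEq α]

theorem filter2_of_notMem_right {p q : α} {v : List α} (h : q ∉ v) :
    filter2 p q v = List.replicate (v.count p) p := by
  have h1 : ∀ b ∈ filter2 p q v, b = p := by
    intro b hb
    rcases (mem_filter2.1 hb).2 with h' | rfl
    · exact h'
    · exact absurd (mem_filter2.1 hb).1 h
  rw [← count_filter2_left p q v]
  generalize filter2 p q v = w at h1
  rw [List.eq_replicate_iff]
  exact ⟨(List.count_eq_length.2 fun b hb => (h1 b hb).symm).symm, h1⟩

theorem filter2_of_notMem_left {p q : α} {v : List α} (h : p ∉ v) :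
    filter2 p q v = List.replicate (v.count q) q := by
  rw [filter2_comm, filter2_of_notMem_right h]

theorem mem_expand {e : α → ℕ} {l : α} {L : List α} (h : l ∈ expand e L) : l ∈ L := by
  obtain ⟨a, ha, hl⟩ := List.mem_flatMap.1 h
  rw [List.eq_of_mem_replicate hl]
  exact ha

end Lists

namespace Adm

variable {e : Letter → ℕ} (he : Adm e)
include he

theorem expand_primes (a k : ℕ) : expand e (primes a k) = primes a k :=
  expand_eq_self fun l hl => by
    obtain ⟨i, -, rfl | rfl⟩ := mem_primes.1 hl <;> exact he.eq_one _ rfl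

theorem expand_tailW (k : ℕ) : expand e (tailW k) = tailW k :=
  expand_eq_self fun l hl => by
    obtain ⟨i, -, rfl | rfl⟩ := mem_tailW.1 hl <;> exact he.eq_one _ rfl

theorem expand_shape {n m : ℕ} {C X : List Letter} (hX : ∀ l ∈ X, sq l = false) :
    expand e (shape n m C X) = shape n m (expand e C) X := by
  have h1 : e t = 1 := he.eq_one _ rfl
  have h2 : e x = 1 := he.eq_one _ rfl
  have h3 : e y = 1 := he.eq_one _ rfl
  have h4 : expand e X = X := expand_eq_self fun l hl => he.eq_one _ (hX l hl)
  simp [shape, expand_append, expand_cons, he.expand_primes, he.expand_tailW, h1, h2, h3, h4]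

theorem expand_shape_xy {n m : ℕ} {C : List Letter} :
    expand e (shape n m C [x, y]) = shape n m (expand e C) [x, y] :=
  he.expand_shape (by simp [sq])

end Adm

namespace Core

variable {n m : ℕ} {C : List Letter} (hC : Core n m C)
include hC

/-- Expanding islands does not move a letter past `σ`, so the number of occurrences of `p` before
`σ` in the contracted word already decides the location. -/
theorem at_expand {e : Letter → ℕ} (he : Adm e) {L R : List Letter} {σ p : Letter}
    (hs : shape n m C [x, y] = L ++ σ :: R) (hσ : smp σ = true) (hp : smp p = false) :
    (L.count p = 0 → At (expand e (shape n m C [x, y])) σ p .aft) ∧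
    (L.count p = (shape n m C [x, y]).count p → At (expand e (shape n m C [x, y])) σ p .bfr) ∧
    (sq p = false → L.count p = 1 → (shape n m C [x, y]).count p = 2 →
      At (expand e (shape n m C [x, y])) σ p .str) := by
  have hne : σ ≠ p := by
    rintro rfl
    simp [hσ] at hp
  have hσ1 : e σ = 1 := by
    refine he.eq_one _ ?_
    cases σ <;> simp_all [smp, sq]
  have hc : (shape n m C [x, y]).count σ = 1 := by
    have h0 : 0 < (shape n m C [x, y]).count σ := List.count_pos_iff.2 (by simp [hs])
    rw [hC.count_shape] at h0 ⊢
    cases σ <;> simp_all [smp]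
    all_goals
      by_contra hlt
      simp [hlt] at h0
  have hs' : expand e (shape n m C [x, y]) = expand e L ++ σ :: expand e R := by
    rw [hs, expand_append, expand_cons, hσ1, List.replicate_one, List.singleton_append]
  have hc' : (expand e (shape n m C [x, y])).count σ = 1 := by rw [count_expand, hσ1, hc]
  have hsum : (shape n m C [x, y]).count p = L.count p + R.count p := by
    rw [hs, List.count_append, List.count_cons_of_ne hne]
  refine ⟨fun h => ?_, fun h => ?_, fun hq h1 h2 => ?_⟩
  · exact at_aft_of_split hs' hc' fun hm => List.count_eq_zero.1 h (mem_expand hm)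
  · exact at_bfr_of_split hs' hc' fun hm =>
      List.count_eq_zero.1 (by omega : R.count p = 0) (mem_expand hm)
  · refine at_str_of_split hs' hc' ?_ ?_
    · rw [count_expand, he.eq_one _ hq, h1]
    · rw [count_expand, he.eq_one _ hq]
      omega

/-! ### Positions of the letters relative to particular simple letters -/

section Position

variable {e : Letter → ℕ} (he : Adm e)
include he

theorem split_ts {j : ℕ} (hj : j < m) : ∃ R, shape n m C [x, y] =
    (primes 0 n ++ ([x, y] ++ (t :: (primes n n ++ (x :: (C ++ (y :: tailW j))))))) ++ ts j :: R := by
  obtain ⟨R, hR⟩ := tailW_split hj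
  exact ⟨zs j :: R, by simp [shape, hR]⟩

theorem at_ts_bfr {j : ℕ} (hj : j < m) {p : Letter} (hp : smp p = false) (hz : ∀ i, p ≠ zs i) :
    At (expand e (shape n m C [x, y])) (ts j) p .bfr := by
  obtain ⟨R, hR⟩ := hC.split_ts he hj
  refine (hC.at_expand he hR rfl hp).2.1 ?_
  have h1 : p ∉ tailW j := by
    intro h
    obtain ⟨i, -, rfl | rfl⟩ := mem_tailW.1 h
    · simp [smp] at hp
    · exact hz i rfl
  have h2 : p ∉ tailW m := by
    intro h
    obtain ⟨i, -, rfl | rfl⟩ := mem_tailW.1 h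
    · simp [smp] at hp
    · exact hz i rfl
  simp [shape, List.count_cons, count_tailW, h1, h2]

/-- One occurrence of `zs i` is in the middle block, and the other comes right after `ts i`. -/
theorem at_ts_zs {i j : ℕ} (hj : j < m) (hi : i < m) :
    At (expand e (shape n m C [x, y])) (ts j) (zs i) (if i < j then .bfr else .str) := by
  obtain ⟨R, hR⟩ := hC.split_ts he hj
  have h := hC.at_expand he (p := zs i) hR rfl rfl
  split_ifs with hij
  · refine h.2.1 ?_
    simp [shape, count_tailW, count_primes, zs_mem_tailW, hij, hi]
  · refine h.2.2 rfl ?_ ?_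
    · simp [count_tailW, count_primes, zs_mem_tailW, hij, hC.count, hC.zs_mem, hi]
    · simp [hC.count_shape, hi]

theorem at_t {p : Letter} (hp : smp p = false) :
    (p = x ∨ p = y ∨ (∃ i < n, p = zp i) → At (expand e (shape n m C [x, y])) t p .str) ∧
    (p ≠ x → p ≠ y → (∀ i < n, p ≠ zp i) → At (expand e (shape n m C [x, y])) t p .aft) := by
  have hs : shape n m C [x, y] = (primes 0 n ++ [x, y]) ++ t ::
      (primes n n ++ (x :: (C ++ (y :: tailW m)))) := by simp [shape]
  have h := hC.at_expand he hs rfl hp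
  constructor
  · rintro (rfl | rfl | ⟨i, hi, rfl⟩)
    · exact h.2.2 rfl (by simp [count_primes]) (by simp [hC.count_shape])
    · exact h.2.2 rfl (by simp [count_primes]) (by simp [hC.count_shape])
    · refine h.2.2 rfl (by simp [count_primes, zp_mem_primes, hi]) ?_
      simp only [hC.count_shape]
      rw [if_pos (by omega)]
  · intro h1 h2 h3
    refine h.1 (List.count_eq_zero.2 ?_)
    simp only [List.mem_append, mem_primes, List.mem_cons, List.not_mem_nil, or_false, not_or,
      not_exists, not_and, zero_add]
    refine ⟨fun i hi => ⟨h3 i hi, ?_⟩, h1, h2⟩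
    rintro rfl
    simp [smp] at hp

/-- The letter `tp (2 * n - 1)` immediately precedes the second `x`: it splits all letters whose
first occurrences are in the head of the word and precedes the letters `zs` and `ys`. -/
theorem at_tp_last {p : Letter} (hp : smp p = false) :
    (p = x ∨ p = y ∨ (∃ i < 2 * n, p = zp i) →
      At (expand e (shape n m C [x, y])) (tp (2 * n - 1)) p .str) ∧
    (p ≠ x → p ≠ y → (∀ i < 2 * n, p ≠ zp i) →
      At (expand e (shape n m C [x, y])) (tp (2 * n - 1)) p .aft) := by
  obtain ⟨k, hk⟩ := Nat.exists_eq_add_of_le' hC.pos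
  have hs : shape n m C [x, y] = (primes 0 n ++ ([x, y, t] ++ (primes n k ++ [zp (n + k)]))) ++
      tp (2 * n - 1) :: (x :: (C ++ (y :: tailW m))) := by
    have h1 : 2 * n - 1 = n + k := by omega
    have h2 : primes n n = primes n k ++ [zp (n + k), tp (n + k)] := by
      conv_lhs => rw [show primes n n = primes n (k + 1) by rw [← hk]]
      rfl
    simp [shape, h1, h2]
  have h := hC.at_expand he hs rfl hp
  constructor
  · rintro (rfl | rfl | ⟨i, hi, rfl⟩)
    · exact h.2.2 rfl (by simp [count_primes]) (by simp [hC.count_shape])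
    · exact h.2.2 rfl (by simp [count_primes]) (by simp [hC.count_shape])
    · refine h.2.2 rfl ?_ (by simp only [hC.count_shape]; rw [if_pos hi])
      simp only [List.count_append, count_primes, zp_mem_primes]
      simp only [List.count_cons, List.count_nil]
      simp
      split_ifs <;> omega
  · intro h1 h2 h3
    refine h.1 (List.count_eq_zero.2 ?_)
    simp only [List.mem_append, mem_primes, List.mem_cons, List.not_mem_nil, or_false, not_or,
      not_exists, not_and, zero_add]
    refine ⟨fun i hi => ⟨h3 i (by omega), ?_⟩, ⟨h1, h2, ?_⟩, fun i hi => ⟨h3 _ (by omega), ?_⟩,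
      h3 _ (by omega)⟩ <;>
    · rintro rfl
      simp [smp] at hp

/-- The letter `t'_i` lies before the letters `z'_j` with `i < j`, and before `x` and `y`
if `i < n`. -/
theorem at_tp {i : ℕ} (hi : i < 2 * n) :
    At (expand e (shape n m C [x, y])) (tp i) (zp i) .str ∧
    (∀ j, i < j → At (expand e (shape n m C [x, y])) (tp i) (zp j) .aft) ∧
    (i < n → At (expand e (shape n m C [x, y])) (tp i) x .aft ∧
      At (expand e (shape n m C [x, y])) (tp i) y .aft) := by
  have h2 : (shape n m C [x, y]).count (zp i) = 2 := by
    simp only [hC.count_shape]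
    rw [if_pos hi]
  by_cases hin : i < n
  · obtain ⟨R, hR⟩ := primes_split (a := 0) hin
    rw [zero_add] at hR
    have hs : shape n m C [x, y] = (primes 0 i ++ [zp i]) ++ tp i ::
        (R ++ ([x, y] ++ (t :: (primes n n ++ (x :: (C ++ (y :: tailW m))))))) := by
      simp [shape, hR]
    refine ⟨(hC.at_expand he hs rfl rfl).2.2 rfl (by simp [count_primes, zp_mem_primes]) h2,
      fun j hj => (hC.at_expand he hs rfl rfl).1 (List.count_eq_zero.2 ?_),
      fun _ => ⟨(hC.at_expand he hs rfl rfl).1 (by simp [count_primes]),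
        (hC.at_expand he hs rfl rfl).1 (by simp [count_primes])⟩⟩
    simp [zp_mem_primes]
    omega
  · obtain ⟨k, rfl⟩ := Nat.exists_eq_add_of_le (Nat.le_of_not_lt hin)
    obtain ⟨R, hR⟩ := primes_split (a := n) (show k < n by omega)
    have hs : shape n m C [x, y] = (primes 0 n ++ ([x, y, t] ++ (primes n k ++ [zp (n + k)]))) ++
        tp (n + k) :: (R ++ (x :: (C ++ (y :: tailW m)))) := by
      simp [shape, hR]
    refine ⟨(hC.at_expand he hs rfl rfl).2.2 rfl (by simp [count_primes, zp_mem_primes]) h2,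
      fun j hj => (hC.at_expand he hs rfl rfl).1 (List.count_eq_zero.2 ?_), fun h => absurd h hin⟩
    simp [zp_mem_primes]
    omega

end Position

/-! ### Projections of the word onto two letters -/

section Projection

variable {e : Letter → ℕ} (he : Adm e)
include he

theorem count_expand_C {l : Letter} (hl : l ∈ C) (h : sq l = false) :
    (expand e C).count l = 1 := by
  rw [count_expand, he.eq_one _ h, hC.count, if_pos hl]

theorem filter2_x_zs {j : ℕ} (hj : j < m) :
    filter2 x (zs j) (expand e (shape n m C [x, y])) = [x, x, zs j, zs j] := by
  have h1 : x ∉ expand e C := fun h => hC.x_notMem (mem_expand h)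
  rw [he.expand_shape_xy, shape]
  simp [filter2_append, filter2_cons, filter2_of_notMem_left, h1, count_primes, count_tailW,
    hC.count_expand_C he ((hC.zs_mem j).2 hj) rfl, zs_mem_tailW, hj]

theorem filter2_y_zs {j : ℕ} (hj : j < m) :
    filter2 y (zs j) (expand e (shape n m C [x, y])) = [y, zs j, y, zs j] := by
  have h1 : y ∉ expand e C := fun h => hC.y_notMem (mem_expand h)
  rw [he.expand_shape_xy, shape]
  simp [filter2_append, filter2_cons, filter2_of_notMem_left, h1, count_primes, count_tailW,
    hC.count_expand_C he ((hC.zs_mem j).2 hj) rfl, zs_mem_tailW, hj]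

theorem filter2_x_y :
    filter2 x y (expand e (shape n m C [x, y])) = [x, y, x, y] := by
  have h1 : y ∉ expand e C := fun h => hC.y_notMem (mem_expand h)
  have h2 : x ∉ expand e C := fun h => hC.x_notMem (mem_expand h)
  rw [he.expand_shape_xy, shape]
  simp [filter2_append, filter2_cons, filter2_eq_nil, h1, h2]

theorem filter2_x_zp {i : ℕ} (hi : i < 2 * n) :
    filter2 x (zp i) (expand e (shape n m C [x, y])) =
      if i < n then [zp i, x, x, zp i] else [x, zp i, x, zp i] := by
  have h1 : x ∉ expand e C := fun h => hC.x_notMem (mem_expand h)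
  rw [he.expand_shape_xy, shape]
  split_ifs with h
  · simp [filter2_append, filter2_cons, filter2_of_notMem_left, h1, count_primes, count_tailW,
      hC.count_expand_C he ((hC.zp_mem i).2 hi) rfl, zp_mem_primes, h, Nat.not_le.2 h]
  · simp [filter2_append, filter2_cons, filter2_of_notMem_left, h1, count_primes, count_tailW,
      hC.count_expand_C he ((hC.zp_mem i).2 hi) rfl, zp_mem_primes, h, Nat.le_of_not_lt h]
    rw [if_pos (by omega)]
    rfl

theorem filter2_y_zp {i : ℕ} (hi : i < 2 * n) :
    filter2 y (zp i) (expand e (shape n m C [x, y])) =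
      if i < n then [zp i, y, zp i, y] else [y, zp i, zp i, y] := by
  have h1 : y ∉ expand e C := fun h => hC.y_notMem (mem_expand h)
  rw [he.expand_shape_xy, shape]
  split_ifs with h
  · simp [filter2_append, filter2_cons, filter2_of_notMem_left, h1, count_primes, count_tailW,
      hC.count_expand_C he ((hC.zp_mem i).2 hi) rfl, zp_mem_primes, h, Nat.not_le.2 h]
  · simp [filter2_append, filter2_cons, filter2_of_notMem_left, h1, count_primes, count_tailW,
      hC.count_expand_C he ((hC.zp_mem i).2 hi) rfl, zp_mem_primes, h, Nat.le_of_not_lt h]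
    rw [if_pos (by omega)]
    rfl

/-- The occurrences of two letters with one island each are not interleaved. -/
theorem filter2_sq {i j : ℕ} (hij : i ≠ j) :
    ∃ a b, filter2 (ys i) (ys j) (expand e (shape n m C [x, y])) =
        List.replicate a (ys i) ++ List.replicate b (ys j) ∨
      filter2 (ys i) (ys j) (expand e (shape n m C [x, y])) =
        List.replicate b (ys j) ++ List.replicate a (ys i) := by
  have h0 : filter2 (ys i) (ys j) (expand e (shape n m C [x, y])) =
      filter2 (ys i) (ys j) (expand e C) := by
    rw [he.expand_shape_xy, shape]
    simp [filter2_append, filter2_cons, filter2_eq_nil]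
  rw [h0]
  by_cases hi : ys i ∈ C
  · obtain ⟨A, B, hAB⟩ := List.append_of_mem hi
    have hnd := hC.nodup
    rw [hAB, List.nodup_append, List.nodup_cons] at hnd
    obtain ⟨-, ⟨hB, -⟩, hA⟩ := hnd
    have hA' : ys i ∉ expand e A := fun h => hA _ (mem_expand h) (ys i) (by simp) rfl
    have hB' : ys i ∉ expand e B := fun h => hB (mem_expand h)
    have hj : C.count (ys j) ≤ 1 := List.nodup_iff_count_le_one.1 hC.nodup _
    have hne : ys i ≠ ys j := fun h => hij (by injection h)
    rw [hAB, List.count_append, List.count_cons_of_ne hne] at hj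
    rw [hAB, expand_append, expand_cons, filter2_append, filter2_append,
      filter2_of_notMem_left hA', filter2_of_notMem_left hB', filter2_of_notMem_right (by
        intro h
        exact hne (List.eq_of_mem_replicate h).symm), List.count_replicate_self]
    rw [count_expand, count_expand]
    rcases Nat.eq_zero_or_pos (A.count (ys j)) with h | h
    · exact ⟨e (ys i), e (ys j) * B.count (ys j), Or.inl (by simp [h])⟩
    · have h' : B.count (ys j) = 0 := by omega
      exact ⟨e (ys i), e (ys j) * A.count (ys j), Or.inr (by simp [h'])⟩
  · have hi' : ys i ∉ expand e C := fun h => hi (mem_expand h)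
    exact ⟨0, (expand e C).count (ys j), Or.inl (by rw [filter2_of_notMem_left hi']; simp)⟩

end Projection

end Core

/-! ### The `γ'`-class of the word -/

/-- For a nonempty word `p` and `k ≥ 2`, the first letter of `p` occurs twice in `p ^ k`. Were this
a factor of `xyx`, that letter would be `x` and, by length, `p = x`; but `xx` is not a factor of
`xyx`. So all such powers are collapsed to zero. -/
theorem mxyx_pow {k l : ℕ} (hk : 2 ≤ k) (hl : 2 ≤ l) (a : Mxyx) : a ^ k = a ^ l := by
  have key : ∀ (k : ℕ), 2 ≤ k → ∀ p : Word, p ≠ 1 →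
      p ^ k ∉ factors ({ltr x * ltr y * ltr x} : Set Word) := by
    rintro k hk p hp ⟨u, rfl, q, s, h⟩
    obtain ⟨j, rfl⟩ := Nat.exists_eq_add_of_le hk
    obtain ⟨a, p', rfl⟩ : ∃ a p', p = ltr a * p' := by
      cases hp' : FreeMonoid.toList p with
      | nil => exact absurd hp' hp
      | cons a l => exact ⟨a, FreeMonoid.ofList l, hp'⟩
    have h' := congrArg FreeMonoid.toList h
    rw [pow_add, pow_two] at h'
    simp only [FreeMonoid.toList_mul, FreeMonoid.toList_of, List.append_assoc,
      List.singleton_append] at h'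
    generalize FreeMonoid.toList p' = p'' at h'
    generalize FreeMonoid.toList q = q' at h'
    generalize FreeMonoid.toList s = s' at h'
    have hlen := congrArg List.length h'
    simp only [List.length_cons, List.length_append, List.length_nil] at hlen
    have hc1 := congrArg (List.count a) h'
    simp only [List.count_cons_self, List.count_append] at hc1
    have hy : a ≠ y := by
      rintro rfl
      simp at hc1
      omega
    have hx : a = x := by
      have h1 : a ∈ [x, y] ++ [x] := by rw [h']; simp
      simpa [hy] using h1
    subst hx
    simp at hc1
    have hp0 : p'' = [] := by
      cases p'' with
      | nil => rfl
      | cons b p3 =>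
        simp at hlen
        omega
    subst hp0
    rcases q' with _ | ⟨_, _ | ⟨_, q'⟩⟩ <;> simp at h'
    have := congrArg List.length h'.2.2
    simp at this
    omega
  induction a using Con.induction_on with
  | H p =>
    by_cases hp : p = 1
    · subst hp
      simp
    · show (Con.mk' _ p) ^ k = (Con.mk' _ p) ^ l
      rw [← map_pow, ← map_pow]
      exact (Con.eq _).2 (Or.inr ⟨key k hk p hp, key l hl p hp⟩)

theorem satisfies_mxyx_expand {e e' : Letter → ℕ} (he : Adm e) (he' : Adm e') (L : List Letter) :
    Satisfies Mxyx (FreeMonoid.ofList (expand e L), FreeMonoid.ofList (expand e' L)) := by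
  intro φ
  have key : ∀ e : Letter → ℕ, FreeMonoid.lift φ (FreeMonoid.ofList (expand e L)) =
      (L.map fun l => φ l ^ e l).prod := by
    intro e
    rw [FreeMonoid.lift_ofList]
    induction L with
    | nil => rfl
    | cons a L ih =>
      rw [expand_cons, List.map_append, List.prod_append, ih, List.map_cons, List.prod_cons,
        List.map_replicate, List.prod_replicate]
  show FreeMonoid.lift φ (FreeMonoid.ofList (expand e L)) =
    FreeMonoid.lift φ (FreeMonoid.ofList (expand e' L))
  rw [key, key]
  congr 1
  refine List.map_congr_left fun l _ => ?_
  by_cases hl : sq l = false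
  · rw [he.eq_one l hl, he'.eq_one l hl]
  · cases l <;> simp [sq] at hl
    exact mxyx_pow (he.two_le _) (he'.two_le _) _

/-- If `M(xyx)` satisfies `u ≈ v`, and the occurrences of `p` in `u` are separated by `σ`, then
`p` occurs twice in `v`. -/
theorem count_eq_two_of_satisfies_mxyx {u v : List Letter} {p σ : Letter} (hne : p ≠ σ)
    (h : Satisfies Mxyx (FreeMonoid.ofList v, FreeMonoid.ofList u))
    (hu : filter2 p σ u = [p, σ, p]) : v.count p = 2 := by
  let code : Letter → List Letter := fun g => if g = p then [x] else if g = σ then [y] else []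
  have key : ∀ w : List Letter, FreeMonoid.lift
      (fun g => ((FreeMonoid.ofList (code g) : Word) : Mxyx)) (FreeMonoid.ofList w) =
      ((FreeMonoid.ofList (w.flatMap code) : Word) : Mxyx) := by
    intro w
    rw [FreeMonoid.lift_ofList]
    induction w with
    | nil => rfl
    | cons a w ih =>
      rw [List.map_cons, List.prod_cons, ih, List.flatMap_cons, FreeMonoid.ofList_append,
        Con.coe_mul]
  have h1 := h fun g => ((FreeMonoid.ofList (code g) : Word) : Mxyx)
  simp only [key] at h1
  have hu' : u.flatMap code = [x, y, x] := by
    rw [flatMap_code, hu]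
    simp [hne.symm]
  rw [hu'] at h1
  -- The word `xyx` is a factor of itself, so it is not in the collapsed ideal.
  have h2 : FreeMonoid.ofList (v.flatMap code) = FreeMonoid.ofList [x, y, x] := by
    rcases (Con.eq _).1 h1 with h2 | ⟨-, h2⟩
    · exact h2
    · exact absurd ⟨_, rfl, 1, 1, by rw [one_mul, mul_one]; rfl⟩ h2
  have h3 : v.flatMap code = [x, y, x] := h2
  have h4 : ∀ w : List Letter, (w.flatMap code).count x = w.count p := by
    intro w
    induction w with
    | nil => rfl
    | cons a w ih =>
      rw [List.flatMap_cons, List.count_append, ih, List.count_cons]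
      by_cases ha : a = p
      · simp [code, ha]
        omega
      · by_cases ha' : a = σ <;> simp [code, ha, ha', hne.symm]
  rw [← h4, h3]
  rfl

namespace Core

variable {n m : ℕ} {C : List Letter} (hC : Core n m C)
include hC

/-- The separators are `ts 0` for the letters `zs` and `tp (2 * n - 1)` for `x`, `y` and the letters
`zp`. -/
theorem exists_sep {p : Letter} {e : Letter → ℕ} (he : Adm e)
    (hp : (shape n m C [x, y]).count p = 2) :
    ∃ σ, p ≠ σ ∧ (expand e (shape n m C [x, y])).count σ = 1 ∧
      At (expand e (shape n m C [x, y])) σ p .str := by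
  have hn := hC.pos
  have c1 : ∀ {σ : Letter}, smp σ = true → (shape n m C [x, y]).count σ = 1 →
      (expand e (shape n m C [x, y])).count σ = 1 := by
    intro σ h h1
    rw [count_expand, h1, he.eq_one]
    cases σ <;> simp_all [smp, sq]
  have c2 := c1 (σ := tp (2 * n - 1)) rfl (by
    simp only [hC.count_shape]
    rw [if_pos (by omega)])
  have c3 := c1 (σ := ts 0) rfl (by simp [hC.count_shape, hC.m_pos])
  rw [hC.count_shape] at hp
  cases p <;> simp at hp
  · exact ⟨_, by simp, c2, (hC.at_tp_last he rfl).1 (by simp)⟩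
  · exact ⟨_, by simp, c2, (hC.at_tp_last he rfl).1 (by simp)⟩
  · exact ⟨_, by simp, c3, by simpa using hC.at_ts_zs he hC.m_pos hp⟩
  · split_ifs at hp
    omega
  · split_ifs at hp
    omega
  · exact ⟨_, by simp, c2, (hC.at_tp_last he rfl).1 (by simpa using hp)⟩
  · split_ifs at hp
    omega

/-- The relation `gamma` fixes the islands and the simple letters. A nonsquare letter that occurs
twice has its occurrences separated by a simple letter, so the identities of `M(xyx)` prevent its
islands from growing. Only the exponents of the letters `ys` remain free, and these are at least two
because the `ys` that occur are not simple. -/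
theorem gamma'_iff {e' : Letter → ℕ} (he' : Adm e') (v : List Letter) :
    gamma' (FreeMonoid.ofList v) (FreeMonoid.ofList (expand e' (shape n m C [x, y]))) ↔
      ∃ e, Adm e ∧ v = expand e (shape n m C [x, y]) := by
  constructor
  · rintro ⟨⟨h1, h2⟩, h3⟩
    have hsat : Satisfies Mxyx
        (FreeMonoid.ofList v, FreeMonoid.ofList (expand e' (shape n m C [x, y]))) :=
      h3 (MonCat.of Mxyx) (MonoidVariety.isLeast_generatedBy Mxyx).1
    have hisl : v.foldr glue [] = shape n m C [x, y] := by
      have : islands (FreeMonoid.ofList v) = v.foldr glue [] := by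
        rw [islands, destutter_eq_foldr]
        rfl
      rw [← this, h2, islands, destutter_eq_foldr]
      exact hC.foldr_glue_expand_shape he'
    have hs1 : ∀ l, v.count l = 1 ↔ (expand e' (shape n m C [x, y])).count l = 1 :=
      fun l => Set.ext_iff.1 h1 l
    have hmem : ∀ l, l ∈ v ↔ l ∈ shape n m C [x, y] := by
      intro l
      rw [← hisl, mem_foldr_glue]
    have hnsq : ∀ l, sq l = false → l ∈ v → v.count l = (shape n m C [x, y]).count l := by
      intro l hl hm
      have h0 := List.count_pos_iff.2 ((hmem l).1 hm)
      have hle : (shape n m C [x, y]).count l = 1 ∨ (shape n m C [x, y]).count l = 2 := by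
        rw [hC.count_shape] at h0 ⊢
        cases l <;> simp_all [sq] <;> split_ifs at * <;> simp_all
      rcases hle with h | h
      · rw [h, hs1, count_expand, h, he'.eq_one l hl]
      · rw [h]
        obtain ⟨σ, h4, h5, h6⟩ := hC.exists_sep he' h
        exact count_eq_two_of_satisfies_mxyx h4 hsat (filter2_of_at_str h4 h5 h6)
    -- Exponents of the squares are read off from `v`; the value `e' l` serves only to make `e`
    -- admissible at squares that do not occur.
    let e : Letter → ℕ := fun l => if sq l = true ∧ l ∈ v then v.count l else e' l
    refine ⟨e, ⟨fun i => ?_, fun l hl => ?_⟩, ?_⟩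
    · by_cases hi : ys i ∈ v
      · have h4 := List.count_pos_iff.2 hi
        have h5 : v.count (ys i) ≠ 1 := by
          intro h5
          have h6 := (hs1 _).1 h5
          rw [count_expand] at h6
          have := Nat.eq_one_of_mul_eq_one_right h6
          have := he'.two_le i
          omega
        simp only [e, sq, hi, and_self, if_true]
        omega
      · simp only [e, hi, and_false, if_false]
        exact he'.two_le i
    · simp only [e, hl, Bool.false_eq_true, false_and, if_false]
      exact he'.eq_one l hl
    · rw [← hisl]
      refine eq_expand_of_foldr_glue v e fun l => ?_
      by_cases hm : l ∈ v
      · by_cases hl : sq l = false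
        · refine Or.inl ⟨?_, ?_⟩
          · simp only [e, hl, Bool.false_eq_true, false_and, if_false]
            exact he'.eq_one l hl
          · rw [hisl]
            exact hnsq l hl hm
        · refine Or.inr (Or.inl ⟨?_, by simp [e, hl, hm]⟩)
          rw [hisl]
          have h0 := List.count_pos_iff.2 ((hmem l).1 hm)
          rw [hC.count_shape] at h0 ⊢
          cases l <;> simp [sq] at hl
          simp only at h0 ⊢
          split_ifs at h0 ⊢
          · rfl
          · omega
      · exact Or.inr (Or.inr hm)
  · rintro ⟨e, he, rfl⟩
    refine ⟨⟨?_, ?_⟩, ?_⟩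
    · ext l
      show (expand e _).count l = 1 ↔ (expand e' _).count l = 1
      rw [count_expand, count_expand]
      by_cases hl : sq l = false
      · rw [he.eq_one l hl, he'.eq_one l hl]
      · cases l <;> simp [sq] at hl
        rename_i i
        have h1 := he.two_le i
        have h2 := he'.two_le i
        constructor <;>
        · intro h
          have := Nat.eq_one_of_mul_eq_one_right h
          omega
    · rw [islands, islands, destutter_eq_foldr, destutter_eq_foldr]
      exact (hC.foldr_glue_expand_shape he).trans (hC.foldr_glue_expand_shape he').symm
    · intro M hM
      exact hM _ (satisfies_mxyx_expand he he' _)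

end Core

/-! ### Words that contain two copies of the word -/

/-- Two copies of the alphabet, and two more letters. -/
inductive Alph : Type
  | one (l : Letter) : Alph
  | two (l : Letter) : Alph
  | cc : Alph
  | dd : Alph
  deriving DecidableEq

namespace Alph

instance : Countable Alph := by
  have := Letter.countable
  let f : Alph → Option Letter × Bool := fun a => match a with
    | .one l => (some l, true) | .two l => (some l, false) | .cc => (none, true)
    | .dd => (none, false)
  have hf : Function.Injective f := by
    intro a b h
    cases a <;> cases b <;> simp_all [f]
  exact hf.countable

theorem one_injective : Function.Injective one := fun _ _ h => by injection h
theorem two_injective : Function.Injective two := fun _ _ h => by injection h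

end Alph

open Alph

/-- The least allowed exponents. -/
def stdExp (l : Letter) : ℕ := if sq l = true then 2 else 1

theorem adm_stdExp : Adm stdExp where
  two_le i := by simp [stdExp, sq]
  eq_one l hl := by simp [stdExp, hl]

/-- The class of the word under the congruence `γ'`. -/
def shapeClass (n m : ℕ) (C : List Letter) : Set (List Letter) :=
  {v | ∃ e, Adm e ∧ v = expand e (shape n m C [x, y])}

/-- Two interlocked copies of the word. The list `X` stands for the first occurrences of `x` and `y`
of the first copy, and `Y` for those of the second copy. -/
def bigWord (n m : ℕ) (C : List Letter) (X Y : List Alph) : List Alph :=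
  (primes 0 n).map one ++ (X ++ (one t :: ((primes 0 n).map two ++ (cc :: ((primes n n).map one ++
  (one x :: (Y ++ ((expand stdExp C).map one ++ (one y :: two t :: ((primes n n).map two ++
  (two x :: dd :: cc :: ((expand stdExp C).map two ++ (two y :: ((tailW m).map two ++
  ((tailW m).map one ++ [dd])))))))))))))))

/-- The standard interlocked word. -/
abbrev baseWord (n m : ℕ) (C : List Letter) : List Alph :=
  bigWord n m C [one x, one y] [two x, two y]

/-- The words that agree with the standard interlocked word in every deduction from the word that
does not depend on the order of the first occurrences of `x` and `y` in the two copies. -/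
def Similar (n m : ℕ) (C : List Letter) : Set (List Alph) :=
  {v | ∀ (ψ : Alph → List Letter) (pre post : List Letter),
    ψ (one x) ++ ψ (one y) = ψ (one y) ++ ψ (one x) →
    ψ (two x) ++ ψ (two y) = ψ (two y) ++ ψ (two x) →
    pre ++ ((baseWord n m C).flatMap ψ ++ post) ∈ shapeClass n m C →
    pre ++ (v.flatMap ψ ++ post) ∈ shapeClass n m C}

/-- The projections onto the two copies of the alphabet. -/
def fst : Alph → List Letter
  | one l => [l]
  | _ => []

/-- The projection onto the second copy. -/
def snd : Alph → List Letter
  | two l => [l]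
  | _ => []

section Lists

variable {α β : Type} [DecidableEq α] [DecidableEq β]

theorem flatMap_eq_self {f : α → List α} {L : List α} (h : ∀ l ∈ L, f l = [l]) :
    L.flatMap f = L := by
  induction L with
  | nil => rfl
  | cons a L ih =>
    rw [List.flatMap_cons, h a (by simp), ih fun l hl => h l (by simp [hl])]
    rfl

theorem flatMap_eq_nil {f : α → List β} {L : List α} (h : ∀ l ∈ L, f l = []) :
    L.flatMap f = [] := List.flatMap_eq_nil_iff.2 h

/-- The projection of a list onto a set of letters. -/
def keep (S : List α) (v : List α) : List α := v.filter fun g => g ∈ S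

theorem keep_append (S v w : List α) : keep S (v ++ w) = keep S v ++ keep S w :=
  List.filter_append ..

theorem keep_cons (S : List α) (a : α) (v : List α) :
    keep S (a :: v) = if a ∈ S then a :: keep S v else keep S v := by
  simp [keep, List.filter_cons]

@[simp] theorem keep_nil (S : List α) : keep S [] = [] := rfl

theorem keep_eq_nil {S v : List α} (h : ∀ g ∈ S, g ∉ v) : keep S v = [] := by
  rw [keep, List.filter_eq_nil_iff]
  intro a ha hS
  exact h a (by simpa using hS) ha

theorem keep_eq_singleton {S v : List α} {g : α} (hg : g ∈ S) (hv : v.count g = 1)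
    (h : ∀ a ∈ S, a ≠ g → a ∉ v) : keep S v = [g] := by
  have h1 : ∀ b ∈ keep S v, b = g := by
    intro b hb
    rw [keep, List.mem_filter] at hb
    by_contra hne
    exact h b (by simpa using hb.2) hne hb.1
  have h2 : (keep S v).count g = 1 := by
    rw [keep, List.count_filter (by simpa using hg), hv]
  have h3 := List.eq_replicate_iff.2
    ⟨(List.count_eq_length.2 fun b hb => (h1 b hb).symm).symm, h1⟩
  rw [h2] at h3
  simpa using h3

theorem flatMap_keep {S v : List α} {f : α → List β} (h : ∀ g, g ∉ S → f g = []) :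
    v.flatMap f = (keep S v).flatMap f := by
  induction v with
  | nil => rfl
  | cons a v ih =>
    rw [keep_cons, List.flatMap_cons, ih]
    split_ifs with ha
    · rfl
    · rw [h a ha]
      rfl

theorem filter2_keep {S v : List α} {p q : α} (hp : p ∈ S) (hq : q ∈ S) :
    filter2 p q (keep S v) = filter2 p q v := by
  rw [filter2, keep, List.filter_filter, filter2]
  congr 1
  funext g
  by_cases h1 : g = p
  · subst h1
    simp [hp]
  · by_cases h2 : g = q
    · subst h2
      simp [hq]
    · simp [h1, h2]

end Lists

theorem filter2_expand_congr {e e' : Letter → ℕ} {p q : Letter} {L : List Letter}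
    (hp : e p = e' p) (hq : e q = e' q) :
    filter2 p q (expand e L) = filter2 p q (expand e' L) := by
  have key : ∀ (e : Letter → ℕ) (a : Letter), filter2 p q (List.replicate (e a) a) =
      if a = p ∨ a = q then List.replicate (e a) a else [] := by
    intro e a
    rw [filter2, List.filter_replicate]
    by_cases h : a = p ∨ a = q <;> simp [h]
  induction L with
  | nil => rfl
  | cons a L ih =>
    rw [expand_cons, expand_cons, filter2_append, filter2_append, ih, key, key]
    split_ifs with h
    · rcases h with rfl | rfl
      · rw [hp]
      · rw [hq]
    · rfl

/-! ### Recovering each copy up to the order of x and y -/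

section Chains

variable {n m : ℕ} {C : List Letter}

theorem fst_bigWord (X Y : List Alph) (hY : Y.flatMap fst = []) :
    (bigWord n m C X Y).flatMap fst = shape n m (expand stdExp C) (X.flatMap fst) := by
  have h1 : ∀ L : List Letter, (L.map one).flatMap fst = L := by
    intro L
    rw [List.flatMap_map]
    exact flatMap_eq_self fun l _ => rfl
  have h2 : ∀ L : List Letter, (L.map two).flatMap fst = [] := by
    intro L
    rw [List.flatMap_map]
    exact flatMap_eq_nil fun l _ => rfl
  simp [bigWord, shape, List.flatMap_append, List.flatMap_cons, h1, h2, hY, fst]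

theorem snd_bigWord (X Y : List Alph) (hX : X.flatMap snd = []) :
    (bigWord n m C X Y).flatMap snd = shape n m (expand stdExp C) (Y.flatMap snd) := by
  have h1 : ∀ L : List Letter, (L.map two).flatMap snd = L := by
    intro L
    rw [List.flatMap_map]
    exact flatMap_eq_self fun l _ => rfl
  have h2 : ∀ L : List Letter, (L.map one).flatMap snd = [] := by
    intro L
    rw [List.flatMap_map]
    exact flatMap_eq_nil fun l _ => rfl
  simp [bigWord, shape, List.flatMap_append, List.flatMap_cons, h1, h2, hX, snd]

/-- A substitution that deletes `y` and leaves the word unchanged. -/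
def dropY (l : Letter) : List Letter :=
  if l = y then [] else if l = t then [y, t] else if l = ts 0 then [y, ts 0] else [l]

/-- A substitution that deletes `x` and leaves the word unchanged. -/
def dropX (n : ℕ) (l : Letter) : List Letter :=
  if l = x then [] else if l = tp (n - 1) then [tp (n - 1), x]
  else if l = tp (2 * n - 1) then [tp (2 * n - 1), x] else [l]

variable (hC : Core n m C)
include hC

theorem tailW_eq_cons : tailW m = ts 0 :: (tailW m).tail ∧ ts 0 ∉ (tailW m).tail := by
  obtain ⟨R, hR⟩ := tailW_split hC.m_pos
  have h1 : tailW m = ts 0 :: zs 0 :: R := by rw [hR]; rfl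
  have h2 := nodup_tailW m
  rw [h1, List.nodup_cons] at h2
  rw [h1]
  exact ⟨rfl, h2.1⟩

/-- The letters `t` and `ts 0` come immediately after the two occurrences of `y`, so they can
restore it. -/
theorem shape_flatMap_dropY :
    (shape n m (expand stdExp C) [x, y]).flatMap dropY = shape n m (expand stdExp C) [x, y] := by
  obtain ⟨h1, h2⟩ := tailW_eq_cons hC
  have hp : ∀ a k, (primes a k).flatMap dropY = primes a k := fun a k =>
    flatMap_eq_self fun l hl => by
      obtain ⟨i, -, rfl | rfl⟩ := mem_primes.1 hl <;> simp [dropY]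
  have hE : (expand stdExp C).flatMap dropY = expand stdExp C :=
    flatMap_eq_self fun l hl => by
      have hl' := mem_expand hl
      have e1 : l ≠ y := fun h => hC.y_notMem (h ▸ hl')
      have e2 : l ≠ t := fun h => hC.smp_notMem _ rfl (h ▸ hl')
      have e3 : l ≠ ts 0 := fun h => hC.smp_notMem _ rfl (h ▸ hl')
      simp [dropY, e1, e2, e3]
  have hT : (tailW m).tail.flatMap dropY = (tailW m).tail :=
    flatMap_eq_self fun l hl => by
      have e3 : l ≠ ts 0 := fun h => h2 (h ▸ hl)
      have hl' := List.mem_of_mem_tail hl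
      have e1 : l ≠ y := fun h => y_notMem_tailW (h ▸ hl')
      have e2 : l ≠ t := fun h => t_notMem_tailW (h ▸ hl')
      simp [dropY, e1, e2, e3]
  rw [shape, h1]
  simp [List.flatMap_append, List.flatMap_cons, hp, hE, hT, dropY]

/-- The letters `tp (n - 1)` and `tp (2 * n - 1)` come immediately before the two occurrences of
`x`. -/
theorem shape_flatMap_dropX :
    (shape n m (expand stdExp C) [x, y]).flatMap (dropX n) =
      shape n m (expand stdExp C) [x, y] := by
  obtain ⟨k, rfl⟩ := Nat.exists_eq_add_of_le' hC.pos
  have hp : ∀ a, (primes a k).flatMap (dropX (k + 1)) = if a = 0 ∨ a = k + 1 then primes a k else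
      (primes a k).flatMap (dropX (k + 1)) := by
    intro a
    split_ifs with h
    · refine flatMap_eq_self fun l hl => ?_
      obtain ⟨i, hi, rfl | rfl⟩ := mem_primes.1 hl
      · simp [dropX]
      · have e1 : a + i ≠ k + 1 - 1 := by omega
        have e2 : a + i ≠ 2 * (k + 1) - 1 := by omega
        simp only [dropX, reduceCtorEq, if_false, Letter.tp.injEq, e1, e2]
    · rfl
  have h0 := hp 0
  have h1 := hp (k + 1)
  simp only [true_or, or_true, if_true] at h0 h1
  have hE : (expand stdExp C).flatMap (dropX (k + 1)) = expand stdExp C :=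
    flatMap_eq_self fun l hl => by
      have hl' := mem_expand hl
      have e1 : l ≠ x := fun h => hC.x_notMem (h ▸ hl')
      have e2 : l ≠ tp (k + 1 - 1) := fun h => hC.smp_notMem _ rfl (h ▸ hl')
      have e3 : l ≠ tp (2 * (k + 1) - 1) := fun h => hC.smp_notMem _ rfl (h ▸ hl')
      simp only [dropX, e1, e2, e3, if_false]
  have hT : (tailW m).flatMap (dropX (k + 1)) = tailW m :=
    flatMap_eq_self fun l hl => by
      obtain ⟨i, -, rfl | rfl⟩ := mem_tailW.1 hl <;> simp [dropX]
  have e1 : k + 1 + k = 2 * (k + 1) - 1 := by omega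
  have e2 : k ≠ 2 * (k + 1) - 1 := by omega
  have e3 : 2 * (k + 1) - 1 ≠ k := by omega
  simp [shape, primes, List.flatMap_append, List.flatMap_cons, h0, h1, hE, hT, e1]
  simp [dropX, e3]

/-- The projections of a word that is similar to the standard one onto pairs of letters of one
copy. -/
theorem exists_chain {v : List Alph} (hv : v ∈ Similar n m C) {ι : Letter → Alph}
    {π : Alph → List Letter} (hι : ∀ l, π (ι l) = [l]) (hπ : ∀ g, (∃ l, g = ι l) ∨ π g = [])
    (hb : (baseWord n m C).flatMap π = shape n m (expand stdExp C) [x, y])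
    (hone : ι = one ∨ π (one x) = [] ∧ π (one y) = [])
    (htwo : ι = two ∨ π (two x) = [] ∧ π (two y) = []) :
    ∃ e, Adm e ∧ ∀ p q, ¬ (p = x ∧ q = y) → ¬ (p = y ∧ q = x) →
      filter2 (ι p) (ι q) v = (filter2 p q (expand e (shape n m C [x, y]))).map ι := by
  have hinj : Function.Injective ι := by
    intro a b h
    have := congrArg π h
    rw [hι, hι] at this
    simpa using this
  have hstd : shape n m (expand stdExp C) [x, y] ∈ shapeClass n m C :=
    ⟨stdExp, adm_stdExp, adm_stdExp.expand_shape_xy.symm⟩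
  -- A substitution that deletes `x` or `y` meets the commutation conditions of `Similar` trivially.
  -- It inserts only the deleted letter `z`, so projections onto pairs avoiding `z` are unaffected.
  have general : ∀ (f : Letter → List Letter) (z : Letter),
      f z = [] → (∀ p, p ≠ z → ∀ q, q ≠ z → ∀ l, filter2 p q (f l) = filter2 p q [l]) →
      z = x ∨ z = y →
      (shape n m (expand stdExp C) [x, y]).flatMap f = shape n m (expand stdExp C) [x, y] →
      ∃ e, Adm e ∧ ∀ p q, p ≠ z → q ≠ z →
        filter2 (ι p) (ι q) v = (filter2 p q (expand e (shape n m C [x, y]))).map ι := by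
    intro f z hz hf hxy hs
    have hcomm : ∀ j : Letter → Alph, ι = j ∨ π (j x) = [] ∧ π (j y) = [] →
        (π (j x)).flatMap f ++ (π (j y)).flatMap f = (π (j y)).flatMap f ++ (π (j x)).flatMap f := by
      rintro j (rfl | ⟨h1, h2⟩)
      · rw [hι, hι]
        rcases hxy with rfl | rfl <;> simp [hz]
      · simp [h1, h2]
    obtain ⟨e, he, hve⟩ := hv (fun g => (π g).flatMap f) [] [] (hcomm one hone) (hcomm two htwo) (by
      rw [List.nil_append, List.append_nil, ← List.flatMap_assoc, hb, hs]
      exact hstd)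
    refine ⟨e, he, fun p q hp hq => ?_⟩
    rw [← hve, List.nil_append, List.append_nil, filter2_flatMap]
    have key : ∀ w : List Alph, filter2 (ι p) (ι q) w =
        (w.flatMap fun g => filter2 p q ((π g).flatMap f)).map ι := by
      intro w
      induction w with
      | nil => rfl
      | cons g w ih =>
        rw [filter2_cons, List.flatMap_cons, List.map_append, ← ih]
        rcases hπ g with ⟨l, rfl⟩ | hg
        · rw [hι, List.flatMap_singleton, hf p hp q hq, filter2_cons]
          simp only [hinj.eq_iff]
          split_ifs <;> simp
        · rw [hg, if_neg]
          · simp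
          · rintro (rfl | rfl) <;> simp [hι] at hg
    exact key v
  obtain ⟨e1, he1, H1⟩ := general dropY y (by simp [dropY]) (by
    intro p hp q hq l
    unfold dropY
    split_ifs with h1 h2 h3
    · subst h1
      simp [filter2_cons, hp.symm, hq.symm]
    · subst h2
      simp [filter2_cons, hp.symm, hq.symm]
    · subst h3
      simp [filter2_cons, hp.symm, hq.symm]
    · rfl) (Or.inr rfl) (shape_flatMap_dropY hC)
  obtain ⟨e2, he2, H2⟩ := general (dropX n) x (by simp [dropX]) (by
    intro p hp q hq l
    unfold dropX
    split_ifs with h1 h2 h3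
    · subst h1
      simp [filter2_cons, hp.symm, hq.symm]
    · subst h2
      simp [filter2_cons, hp.symm, hq.symm]
    · subst h3
      simp [filter2_cons, hp.symm, hq.symm]
    · rfl) (Or.inl rfl) (shape_flatMap_dropX hC)
  -- The two deletions might yield different exponents of squares; counting a square letter in `v`
  -- shows that they agree.
  have hexp : expand e1 (shape n m C [x, y]) = expand e2 (shape n m C [x, y]) := by
    refine expand_congr fun l hl => ?_
    by_cases hs : sq l = false
    · rw [he1.eq_one l hs, he2.eq_one l hs]
    · cases l <;> simp [sq] at hs
      rename_i i
      have h3 := H1 (ys i) (ys i) (by simp) (by simp)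
      rw [H2 (ys i) (ys i) (by simp) (by simp)] at h3
      have h4 := congrArg (List.count (ι (ys i))) h3
      rw [List.count_map_of_injective _ _ hinj, List.count_map_of_injective _ _ hinj,
        count_filter2_left, count_filter2_left, count_expand, count_expand] at h4
      have h5 := List.count_pos_iff.2 hl
      exact (Nat.eq_of_mul_eq_mul_right h5 h4).symm
  refine ⟨e1, he1, fun p q h1 h2 => ?_⟩
  -- Every pair other than `x`, `y` avoids `y` or avoids `x`.
  by_cases hy : p ≠ y ∧ q ≠ y
  · exact H1 p q hy.1 hy.2
  · rw [hexp]
    refine H2 p q ?_ ?_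
    · rintro rfl
      refine h1 ⟨rfl, ?_⟩
      by_contra hq
      exact hy ⟨by simp, hq⟩
    · rintro rfl
      refine h2 ⟨?_, rfl⟩
      by_contra hp
      exact hy ⟨hp, by simp⟩

end Chains

/-! ### Substitutions that extend short patterns to the whole word -/

section Embeddings

variable {n m : ℕ} {C : List Letter}

/-- All letters outside `S` are erased, and the pattern left in the base word is completed to the
given word. Membership in `Similar` then puts the image of `v` in the class, where the projection
onto `s`, `s'` is determined; these two letters encode `p` and `q`. Since `S` contains no full pair
x, y, the commutation conditions are automatic. -/
theorem proj_of_keep {v : List Alph} (hv : v ∈ Similar n m C) {S pat : List Alph}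
    (hS : keep S (baseWord n m C) = pat) (h1 : ¬ (one x ∈ S ∧ one y ∈ S))
    (h2 : ¬ (two x ∈ S ∧ two y ∈ S)) (ψ : Alph → List Letter) (hψ : ∀ g, g ∉ S → ψ g = [])
    {p q : Alph} (hp : p ∈ S) (hq : q ∈ S) {s s' : Letter} (hs : s ≠ s') (hs1 : sq s = false)
    (hs2 : sq s' = false)
    (hcode : ∀ g ∈ S, filter2 s s' (ψ g) = if g = p then [s] else if g = q then [s'] else [])
    (pre post : List Letter)
    (hw : pre ++ (pat.flatMap ψ ++ post) = shape n m (expand stdExp C) [x, y]) :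
    filter2 p q v = filter2 p q pat := by
  have hw' : pre ++ ((baseWord n m C).flatMap ψ ++ post) = expand stdExp (shape n m C [x, y]) := by
    rw [flatMap_keep hψ, hS, hw, adm_stdExp.expand_shape_xy]
  have comm : ∀ a b : Alph, ¬ (a ∈ S ∧ b ∈ S) → ψ a ++ ψ b = ψ b ++ ψ a := by
    intro a b hab
    by_cases ha : a ∈ S
    · rw [hψ b fun hb => hab ⟨ha, hb⟩]
      simp
    · rw [hψ a ha]
      simp
  obtain ⟨e, he, hve⟩ := hv ψ pre post (comm _ _ h1) (comm _ _ h2) ⟨_, adm_stdExp, hw'⟩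
  have h3 : filter2 s s' (v.flatMap ψ) = filter2 s s' ((baseWord n m C).flatMap ψ) := by
    have := congrArg (filter2 s s') hve
    rw [filter2_expand_congr (e' := stdExp) (by rw [he.eq_one _ hs1, adm_stdExp.eq_one _ hs1])
      (by rw [he.eq_one _ hs2, adm_stdExp.eq_one _ hs2]), ← hw'] at this
    simp only [filter2_append] at this
    simpa using this
  have code : ∀ g, filter2 s s' (ψ g) = if g = p then [s] else if g = q then [s'] else [] := by
    intro g
    by_cases hg : g ∈ S
    · exact hcode g hg
    · rw [hψ g hg, if_neg (fun h : g = p => hg (h ▸ hp)),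
        if_neg (fun h : g = q => hg (h ▸ hq))]
      rfl
  rw [filter2_flatMap, filter2_flatMap] at h3
  simp only [code] at h3
  rw [filter2_eq_of_code hs h3, ← filter2_keep hp hq, hS]

variable (hC : Core n m C) {v : List Alph} (hv : v ∈ Similar n m C)
include hC

theorem tp_zero_notMem_primes : tp 0 ∉ primes n n := by
  have := hC.pos
  simp only [tp_mem_primes]
  omega

theorem filter2_primes : filter2 x (tp 0) (primes 0 n) = [tp 0] := by
  have := hC.pos
  rw [filter2_of_notMem_left x_notMem_primes, count_primes, if_pos (tp_mem_primes.2 (by omega))]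
  rfl

theorem x_notMem_expand : x ∉ expand stdExp C := fun h => hC.x_notMem (mem_expand h)
theorem y_notMem_expand : y ∉ expand stdExp C := fun h => hC.y_notMem (mem_expand h)
theorem smp_notMem_expand {l : Letter} (hl : smp l = true) : l ∉ expand stdExp C :=
  fun h => hC.smp_notMem l hl (mem_expand h)

include hv

/-- The pattern pσp is embedded with p as `x` and with σ as the whole factor between the two
occurrences of `x`. -/
theorem proj_str {p σ : Alph} (hne : p ≠ σ) (hS : keep [p, σ] (baseWord n m C) = [p, σ, p])
    (h1 : ¬ (one x ∈ [p, σ] ∧ one y ∈ [p, σ])) (h2 : ¬ (two x ∈ [p, σ] ∧ two y ∈ [p, σ])) :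
    filter2 p σ v = [p, σ, p] := by
  have hne' := hne.symm
  rw [proj_of_keep hv hS h1 h2
    (fun g => if g = p then [x] else if g = σ then y :: t :: primes n n else [])
    (p := p) (q := σ) (s := x) (s' := t) ?_ (by simp) (by simp) (by simp) rfl rfl ?_
    (primes 0 n) (expand stdExp C ++ y :: tailW m) ?_]
  · simp [filter2_cons]
  · intro g hg
    simp only [List.mem_cons, List.not_mem_nil, or_false, not_or] at hg
    simp [hg]
  · intro g hg
    by_cases e1 : g = p
    · simp [e1, filter2_cons]
    · by_cases e2 : g = σ
      · simp [e2, hne', filter2_cons, filter2_eq_nil]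
      · simp [e1, e2]
  · simp [shape, hne']

/-- Here p becomes `x`, τ fills the gap between its occurrences, and σ becomes everything after the
second `x`; `ts 0` marks σ. -/
theorem proj_bfr {p τ σ : Alph} (hnd : [p, τ, σ].Nodup)
    (hS : keep [p, τ, σ] (baseWord n m C) = [p, τ, p, σ])
    (h1 : ¬ (one x ∈ [p, τ, σ] ∧ one y ∈ [p, τ, σ]))
    (h2 : ¬ (two x ∈ [p, τ, σ] ∧ two y ∈ [p, τ, σ])) :
    filter2 p σ v = [p, p, σ] := by
  simp only [List.nodup_cons, List.mem_cons, List.not_mem_nil, or_false, not_or,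
    List.nodup_nil, not_false_eq_true, and_true] at hnd
  obtain ⟨⟨n1, n2⟩, n3⟩ := hnd
  have n1' := Ne.symm n1
  have n2' := Ne.symm n2
  have n3' := Ne.symm n3
  obtain ⟨hT, hT'⟩ := tailW_eq_cons hC
  have hx := x_notMem_expand hC
  have ht : ts 0 ∉ expand stdExp C := smp_notMem_expand hC rfl
  have hx' : x ∉ (tailW m).tail := fun h => x_notMem_tailW (List.mem_of_mem_tail h)
  rw [proj_of_keep hv hS h1 h2
    (fun g => if g = p then [x] else if g = τ then y :: t :: primes n n else
      if g = σ then expand stdExp C ++ y :: ts 0 :: (tailW m).tail else [])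
    (p := p) (q := σ) (s := x) (s' := ts 0) ?_ (by simp) (by simp) (by simp) rfl rfl ?_
    (primes 0 n) [] ?_]
  · simp [filter2_cons, n1', n3]
  · intro g hg
    simp only [List.mem_cons, List.not_mem_nil, or_false, not_or] at hg
    simp [hg]
  · intro g hg
    by_cases e1 : g = p
    · simp [e1, filter2_cons]
    · by_cases e2 : g = τ
      · simp [e2, n1', n3, filter2_eq_nil]
      · by_cases e3 : g = σ
        · simp [e3, n2', n3', filter2_cons, filter2_append, filter2_eq_nil, hx, ht, hx', hT']
        · simp [e1, e2, e3]
  · simp [shape, n1', n2', n3', ← hT]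

/-- Here σ becomes everything before the first `x`; `tp 0` marks it. -/
theorem proj_aft {p τ σ : Alph} (hnd : [p, τ, σ].Nodup)
    (hS : keep [p, τ, σ] (baseWord n m C) = [σ, p, τ, p])
    (h1 : ¬ (one x ∈ [p, τ, σ] ∧ one y ∈ [p, τ, σ]))
    (h2 : ¬ (two x ∈ [p, τ, σ] ∧ two y ∈ [p, τ, σ])) :
    filter2 p σ v = [σ, p, p] := by
  simp only [List.nodup_cons, List.mem_cons, List.not_mem_nil, or_false, not_or,
    List.nodup_nil, not_false_eq_true, and_true] at hnd
  obtain ⟨⟨n1, n2⟩, n3⟩ := hnd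
  have n1' := Ne.symm n1
  have n2' := Ne.symm n2
  have n3' := Ne.symm n3
  have htp := tp_zero_notMem_primes hC
  have hP := filter2_primes hC
  rw [proj_of_keep hv hS h1 h2
    (fun g => if g = p then [x] else if g = τ then y :: t :: primes n n else
      if g = σ then primes 0 n else [])
    (p := p) (q := σ) (s := x) (s' := tp 0) ?_ (by simp) (by simp) (by simp) rfl rfl ?_
    [] (expand stdExp C ++ y :: tailW m) ?_]
  · simp [filter2_cons, n1', n3]
  · intro g hg
    simp only [List.mem_cons, List.not_mem_nil, or_false, not_or] at hg
    simp [hg]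
  · intro g hg
    by_cases e1 : g = p
    · simp [e1, filter2_cons]
    · by_cases e2 : g = τ
      · simp [e2, n1', n3, filter2_eq_nil, htp]
      · by_cases e3 : g = σ
        · simp [e3, n2', n3', hP]
        · simp [e1, e2, e3]
  · simp [shape, n1', n2', n3']

/-- The middle block begins with some `zs j`, directly after the second `x`. So p and q become `x`
and `zs j`, and σ and τ fill the gaps between the equal letters. -/
theorem proj_aabb {p σ q τ : Alph} (hnd : [p, σ, q, τ].Nodup)
    (hS : keep [p, σ, q, τ] (baseWord n m C) = [p, σ, p, q, τ, q])
    (h1 : ¬ (one x ∈ [p, σ, q, τ] ∧ one y ∈ [p, σ, q, τ]))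
    (h2 : ¬ (two x ∈ [p, σ, q, τ] ∧ two y ∈ [p, σ, q, τ])) :
    filter2 p q v = [p, p, q, q] := by
  simp only [List.nodup_cons, List.mem_cons, List.not_mem_nil, or_false, not_or,
    List.nodup_nil, not_false_eq_true, and_true] at hnd
  obtain ⟨⟨n1, n2, n3⟩, ⟨n4, n5⟩, n6⟩ := hnd
  have n1' := Ne.symm n1
  have n2' := Ne.symm n2
  have n3' := Ne.symm n3
  have n4' := Ne.symm n4
  have n5' := Ne.symm n5
  have n6' := Ne.symm n6
  obtain ⟨j, C', hC'⟩ := hC.head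
  have hj : j < m := (hC.zs_mem j).1 (by simp [hC'])
  have hjC : zs j ∉ C' := by
    have := hC.nodup
    rw [hC', List.nodup_cons] at this
    exact this.1
  have hE : expand stdExp C = zs j :: expand stdExp C' := by
    rw [hC', expand_cons]
    rfl
  have hjE : zs j ∉ expand stdExp C' := fun h => hjC (mem_expand h)
  have hxE : x ∉ expand stdExp C' := fun h => x_notMem_expand hC (by rw [hE]; simp [h])
  obtain ⟨R, hR⟩ := tailW_split hj
  rw [proj_of_keep hv hS h1 h2
    (fun g => if g = p then [x] else if g = σ then y :: t :: primes n n else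
      if g = q then [zs j] else if g = τ then expand stdExp C' ++ y :: (tailW j ++ [ts j]) else [])
    (p := p) (q := q) (s := x) (s' := zs j) ?_ (by simp) (by simp) (by simp) rfl rfl ?_
    (primes 0 n) R ?_]
  · simp [filter2_cons, n1', n4, n3', n6']
  · intro g hg
    simp only [List.mem_cons, List.not_mem_nil, or_false, not_or] at hg
    simp [hg]
  · intro g hg
    by_cases e1 : g = p
    · simp [e1, filter2_cons]
    · by_cases e2 : g = σ
      · simp [e2, n1', n4, filter2_eq_nil]
      · by_cases e3 : g = q
        · simp [e3, n2', n4', filter2_cons]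
        · by_cases e4 : g = τ
          · simp [e4, n3', n5', n6', filter2_eq_nil, hjE, hxE,
              zs_mem_tailW]
          · simp [e1, e2, e3, e4]
  · simp [shape, n1', n2', n3', n4', n5', n6', hE, hR]

/-- The middle block ends with some `zs j`, directly before the second `y`. So p and q become `y`
and `zs j`, whose occurrences alternate. -/
theorem proj_abab {p σ q τ : Alph} (hnd : [p, σ, q, τ].Nodup)
    (hS : keep [p, σ, q, τ] (baseWord n m C) = [p, σ, q, p, τ, q])
    (h1 : ¬ (one x ∈ [p, σ, q, τ] ∧ one y ∈ [p, σ, q, τ]))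
    (h2 : ¬ (two x ∈ [p, σ, q, τ] ∧ two y ∈ [p, σ, q, τ])) :
    filter2 p q v = [p, q, p, q] := by
  simp only [List.nodup_cons, List.mem_cons, List.not_mem_nil, or_false, not_or,
    List.nodup_nil, not_false_eq_true, and_true] at hnd
  obtain ⟨⟨n1, n2, n3⟩, ⟨n4, n5⟩, n6⟩ := hnd
  have n1' := Ne.symm n1
  have n2' := Ne.symm n2
  have n3' := Ne.symm n3
  have n4' := Ne.symm n4
  have n5' := Ne.symm n5
  have n6' := Ne.symm n6
  obtain ⟨j, C', hC'⟩ := hC.last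
  have hj : j < m := (hC.zs_mem j).1 (by simp [hC'])
  have hjC : zs j ∉ C' := by
    intro h
    have := hC.nodup
    rw [hC', List.nodup_append] at this
    exact this.2.2 _ h _ (by simp) rfl
  have hE : expand stdExp C = expand stdExp C' ++ [zs j] := by
    rw [hC', expand_append]
    rfl
  have hjE : zs j ∉ expand stdExp C' := fun h => hjC (mem_expand h)
  have hyE : y ∉ expand stdExp C' := fun h => y_notMem_expand hC (by rw [hE]; simp [h])
  obtain ⟨R, hR⟩ := tailW_split hj
  rw [proj_of_keep hv hS h1 h2
    (fun g => if g = p then [y] else if g = σ then t :: (primes n n ++ x :: expand stdExp C') else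
      if g = q then [zs j] else if g = τ then tailW j ++ [ts j] else [])
    (p := p) (q := q) (s := y) (s' := zs j) ?_ (by simp) (by simp) (by simp) rfl rfl ?_
    (primes 0 n ++ [x]) R ?_]
  · simp [filter2_cons, n1', n4, n3', n6']
  · intro g hg
    simp only [List.mem_cons, List.not_mem_nil, or_false, not_or] at hg
    simp [hg]
  · intro g hg
    by_cases e1 : g = p
    · simp [e1, filter2_cons]
    · by_cases e2 : g = σ
      · simp [e2, n1', n4, filter2_eq_nil, hjE, hyE]
      · by_cases e3 : g = q
        · simp [e3, n2', n4', filter2_cons]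
        · by_cases e4 : g = τ
          · simp [e4, n3', n5', n6', filter2_eq_nil, zs_mem_tailW]
          · simp [e1, e2, e3, e4]
  · simp [shape, n1', n2', n3', n4', n5', n6', hE, hR]

end Embeddings

/-! ### Short patterns occurring in the interlocked word -/

section Keep

variable {n m : ℕ} {C : List Letter}

theorem keep_eq_keep_singleton {α : Type} [DecidableEq α] {S v : List α} {g : α}
    (hv : v.count g = 1) (h : ∀ a ∈ S, a ≠ g → a ∉ v) : keep S v = keep S [g] := by
  by_cases hg : g ∈ S
  · rw [keep_eq_singleton hg hv h, keep_cons, if_pos hg, keep_nil]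
  · rw [keep_cons, if_neg hg, keep_nil]
    exact keep_eq_nil fun a ha => h a ha fun e => hg (e ▸ ha)

theorem one_mem_map {l : Letter} {L : List Letter} : one l ∈ L.map one ↔ l ∈ L :=
  List.mem_map_of_injective one_injective
theorem two_mem_map {l : Letter} {L : List Letter} : two l ∈ L.map two ↔ l ∈ L :=
  List.mem_map_of_injective two_injective
theorem cc_notMem_map {L : List Letter} : cc ∉ L.map one ∧ cc ∉ L.map two := by simp
theorem dd_notMem_map {L : List Letter} : dd ∉ L.map one ∧ dd ∉ L.map two := by simp
theorem one_notMem_map {l : Letter} {L : List Letter} : one l ∉ L.map two := by simp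
theorem two_notMem_map {l : Letter} {L : List Letter} : two l ∉ L.map one := by simp

/-- The projection of the standard interlocked word onto some letters. -/
def outline (n j i : ℕ) : List Alph :=
  [one x, one y, one t, two (tp i), cc, one (tp (2 * n - 1)), one x, two x, two y,
    one (zs j), one y, two t, two x, dd, cc, two (zs j), two y, two (ts 0), two (zs j),
    one (ts 0), one (zs j), dd]

/-- Each block of the base word contains at most one occurrence of a letter of the outline, so
patterns can be computed in a list of fixed length. -/
theorem keep_baseWord (hC : Core n m C) {j : ℕ} (hj : j < m) {i : ℕ} (hi : i < n) {S : List Alph}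
    (hS : S ⊆ outline n j i) : keep S (baseWord n m C) = keep S (outline n j i) := by
  obtain ⟨T, hT, hT0⟩ : ∃ T, tailW m = ts 0 :: T ∧ ts 0 ∉ T := ⟨_, tailW_eq_cons hC⟩
  have hn := hC.pos
  have hx := x_notMem_expand hC
  have hy := y_notMem_expand hC
  have hsm : ∀ {l : Letter}, smp l = true → l ∉ expand stdExp C := smp_notMem_expand hC
  have s1 : t ∉ expand stdExp C := hsm rfl
  have s2 : ∀ i, ts i ∉ expand stdExp C := fun i => hsm rfl
  have s3 : ∀ i, tp i ∉ expand stdExp C := fun i => hsm rfl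
  have ht : ∀ {l : Letter}, l ∉ tailW m → l ∉ T := fun h h' =>
    h (by rw [hT]; simp [h'])
  have t1 : x ∉ T := ht x_notMem_tailW
  have t2 : y ∉ T := ht y_notMem_tailW
  have t3 : t ∉ T := ht t_notMem_tailW
  have t4 : ∀ i, tp i ∉ T := fun i => ht (by simp [mem_tailW])
  have hcz : T.count (zs j) = 1 := by
    have : (tailW m).count (zs j) = 1 := by rw [count_tailW, if_pos (zs_mem_tailW.2 hj)]
    rw [hT, List.count_cons] at this
    simpa using this
  have hce := hC.count_expand_C adm_stdExp ((hC.zs_mem j).2 hj) rfl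
  have tac : ∀ {L : List Alph}, (∀ g ∈ outline n j i, g ∉ L) → keep S L = [] := fun h =>
    keep_eq_nil fun g hg => h g (hS hg)
  have tac' : ∀ {L : List Alph} {g : Alph}, L.count g = 1 →
      (∀ a ∈ outline n j i, a ≠ g → a ∉ L) → keep S L = keep S [g] := fun hv h =>
    keep_eq_keep_singleton hv fun a ha => h a (hS ha)
  have e1 : n ≠ 0 := by omega
  have e2 : ¬ (2 * n - 1 < n) := by omega
  have e3 : n ≤ 2 * n - 1 ∧ 2 * n - 1 < n + n := by omega
  have e4 : ¬ n ≤ i := by omega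
  have p1 : keep S ((primes 0 n).map one) = [] := tac (by simp [-List.mem_map, one_mem_map, two_mem_map, one_notMem_map,
      two_notMem_map, cc_notMem_map, dd_notMem_map, outline, tp_mem_primes, e2])
  have p2 : keep S ((primes 0 n).map two) = keep S [two (tp i)] := by
    refine tac' ?_ (by simp [-List.mem_map, one_mem_map, two_mem_map, one_notMem_map,
      two_notMem_map, cc_notMem_map, dd_notMem_map, outline, tp_mem_primes])
    rw [List.count_map_of_injective _ _ two_injective, count_primes,
      if_pos (tp_mem_primes.2 (by omega))]
  have q1 : keep S ((primes n n).map one) = keep S [one (tp (2 * n - 1))] := by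
    refine tac' ?_ (by simp [-List.mem_map, one_mem_map, two_mem_map, one_notMem_map,
      two_notMem_map, cc_notMem_map, dd_notMem_map, outline, tp_mem_primes])
    rw [List.count_map_of_injective _ _ one_injective, count_primes,
      if_pos (tp_mem_primes.2 (by omega))]
  have q2 : keep S ((primes n n).map two) = [] := tac (by simp [-List.mem_map, one_mem_map, two_mem_map, one_notMem_map,
      two_notMem_map, cc_notMem_map, dd_notMem_map, outline, tp_mem_primes, e4])
  have c1 : keep S ((expand stdExp C).map one) = keep S [one (zs j)] := by
    refine tac' ?_ (by simp [-List.mem_map, one_mem_map, two_mem_map, one_notMem_map,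
      two_notMem_map, cc_notMem_map, dd_notMem_map, outline, hx, hy, s1, s2, s3])
    rw [List.count_map_of_injective _ _ one_injective, hce]
  have c2 : keep S ((expand stdExp C).map two) = keep S [two (zs j)] := by
    refine tac' ?_ (by simp [-List.mem_map, one_mem_map, two_mem_map, one_notMem_map,
      two_notMem_map, cc_notMem_map, dd_notMem_map, outline, hx, hy, s1, s2, s3])
    rw [List.count_map_of_injective _ _ two_injective, hce]
  have r1 : keep S (T.map one) = keep S [one (zs j)] := by
    refine tac' ?_ (by simp [-List.mem_map, one_mem_map, two_mem_map, one_notMem_map,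
      two_notMem_map, cc_notMem_map, dd_notMem_map, outline, t1, t2, t3, t4, hT0])
    rw [List.count_map_of_injective _ _ one_injective, hcz]
  have r2 : keep S (T.map two) = keep S [two (zs j)] := by
    refine tac' ?_ (by simp [-List.mem_map, one_mem_map, two_mem_map, one_notMem_map,
      two_notMem_map, cc_notMem_map, dd_notMem_map, outline, t1, t2, t3, t4, hT0])
    rw [List.count_map_of_injective _ _ two_injective, hcz]
  have hb : baseWord n m C = (primes 0 n).map one ++ ([one x, one y, one t] ++
      ((primes 0 n).map two ++ ([cc] ++ ((primes n n).map one ++ ([one x, two x, two y] ++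
      ((expand stdExp C).map one ++ ([one y, two t] ++ ((primes n n).map two ++
      ([two x, dd, cc] ++ ((expand stdExp C).map two ++ ([two y, two (ts 0)] ++
      (T.map two ++ ([one (ts 0)] ++ (T.map one ++ [dd])))))))))))))) := by
    simp only [baseWord, bigWord]
    rw [hT]
    simp
  rw [hb]
  simp only [keep_append]
  rw [p1, p2, q1, q2, c1, c2, r1, r2]
  simp only [List.nil_append, ← keep_append]
  rfl

end Keep

/-! ### Projections of the words that agree with the interlocked word

In the names of the projections, `g` is the last letter `tp` of the first copy, `h` the letter `t`
of the second copy, `k` and `l` the letters `ts 0` of the second and first copy, and `e` a letter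
`tp` of the second copy. -/

section Facts

variable {n m : ℕ} {C : List Letter} (hC : Core n m C) {v : List Alph} (hv : v ∈ Similar n m C)
include hC hv

theorem filter2_cc_g : filter2 cc (one (tp (2 * n - 1))) v = [cc, one (tp (2 * n - 1)), cc] :=
  proj_str hC hv (by simp)
    ((keep_baseWord hC hC.m_pos hC.pos (by simp [outline])).trans (by simp [outline, keep_cons]))
    (by simp) (by simp)

theorem filter2_cc_h : filter2 cc (two t) v = [cc, two t, cc] :=
  proj_str hC hv (by simp)
    ((keep_baseWord hC hC.m_pos hC.pos (by simp [outline])).trans (by simp [outline, keep_cons]))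
    (by simp) (by simp)

theorem filter2_dd_k : filter2 dd (two (ts 0)) v = [dd, two (ts 0), dd] :=
  proj_str hC hv (by simp)
    ((keep_baseWord hC hC.m_pos hC.pos (by simp [outline])).trans (by simp [outline, keep_cons]))
    (by simp) (by simp)

theorem filter2_dd_l : filter2 dd (one (ts 0)) v = [dd, one (ts 0), dd] :=
  proj_str hC hv (by simp)
    ((keep_baseWord hC hC.m_pos hC.pos (by simp [outline])).trans (by simp [outline, keep_cons]))
    (by simp) (by simp)

theorem filter2_dd_h : filter2 dd (two t) v = [two t, dd, dd] :=
  proj_aft hC hv (τ := two (ts 0)) (by simp)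
    ((keep_baseWord hC hC.m_pos hC.pos (by simp [outline])).trans (by simp [outline, keep_cons]))
    (by simp) (by simp)

theorem filter2_cc_e {i : ℕ} (hi : i < n) :
    filter2 cc (two (tp i)) v = [two (tp i), cc, cc] :=
  proj_aft hC hv (τ := two t) (by simp)
    ((keep_baseWord hC hC.m_pos hi (by simp [outline])).trans (by simp [outline, keep_cons]))
    (by simp) (by simp)

theorem filter2_one_x_h : filter2 (one x) (two t) v = [one x, one x, two t] :=
  proj_bfr hC hv (τ := one t) (by simp)
    ((keep_baseWord hC hC.m_pos hC.pos (by simp [outline])).trans (by simp [outline, keep_cons]))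
    (by simp) (by simp)

theorem filter2_one_y_h : filter2 (one y) (two t) v = [one y, one y, two t] :=
  proj_bfr hC hv (τ := one t) (by simp)
    ((keep_baseWord hC hC.m_pos hC.pos (by simp [outline])).trans (by simp [outline, keep_cons]))
    (by simp) (by simp)

theorem filter2_two_x_g :
    filter2 (two x) (one (tp (2 * n - 1))) v = [one (tp (2 * n - 1)), two x, two x] :=
  proj_aft hC hv (τ := two t) (by simp)
    ((keep_baseWord hC hC.m_pos hC.pos (by simp [outline])).trans (by simp [outline, keep_cons]))
    (by simp) (by simp)

theorem filter2_two_y_g :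
    filter2 (two y) (one (tp (2 * n - 1))) v = [one (tp (2 * n - 1)), two y, two y] :=
  proj_aft hC hv (τ := two t) (by simp)
    ((keep_baseWord hC hC.m_pos hC.pos (by simp [outline])).trans (by simp [outline, keep_cons]))
    (by simp) (by simp)

theorem filter2_one_zs_h {j : ℕ} (hj : j < m) :
    filter2 (one (zs j)) (two t) v = [one (zs j), two t, one (zs j)] :=
  proj_str hC hv (by simp)
    ((keep_baseWord hC hj hC.pos (by simp [outline])).trans (by simp [outline, keep_cons]))
    (by simp) (by simp)

theorem filter2_one_zs_k {j : ℕ} (hj : j < m) :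
    filter2 (one (zs j)) (two (ts 0)) v = [one (zs j), two (ts 0), one (zs j)] :=
  proj_str hC hv (by simp)
    ((keep_baseWord hC hj hC.pos (by simp [outline])).trans (by simp [outline, keep_cons]))
    (by simp) (by simp)

theorem filter2_one_zs_g {j : ℕ} (hj : j < m) :
    filter2 (one (zs j)) (one (tp (2 * n - 1))) v =
      [one (tp (2 * n - 1)), one (zs j), one (zs j)] :=
  proj_aft hC hv (τ := two t) (by simp)
    ((keep_baseWord hC hj hC.pos (by simp [outline])).trans (by simp [outline, keep_cons]))
    (by simp) (by simp)

theorem filter2_two_zs_l {j : ℕ} (hj : j < m) :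
    filter2 (two (zs j)) (one (ts 0)) v = [two (zs j), two (zs j), one (ts 0)] :=
  proj_bfr hC hv (τ := two (ts 0)) (by simp)
    ((keep_baseWord hC hj hC.pos (by simp [outline])).trans (by simp [outline, keep_cons]))
    (by simp) (by simp)

theorem filter2_one_x_two_x : filter2 (one x) (two x) v = [one x, one x, two x, two x] :=
  proj_aabb hC hv (σ := one t) (τ := two t) (by simp)
    ((keep_baseWord hC hC.m_pos hC.pos (by simp [outline])).trans (by simp [outline, keep_cons]))
    (by simp) (by simp)

theorem filter2_one_x_two_y : filter2 (one x) (two y) v = [one x, one x, two y, two y] :=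
  proj_aabb hC hv (σ := one t) (τ := two t) (by simp)
    ((keep_baseWord hC hC.m_pos hC.pos (by simp [outline])).trans (by simp [outline, keep_cons]))
    (by simp) (by simp)

theorem filter2_two_x_dd : filter2 (two x) dd v = [two x, two x, dd, dd] :=
  proj_aabb hC hv (σ := two t) (τ := one (ts 0)) (by simp)
    ((keep_baseWord hC hC.m_pos hC.pos (by simp [outline])).trans (by simp [outline, keep_cons]))
    (by simp) (by simp)

theorem filter2_cc_two_zs {j : ℕ} (hj : j < m) :
    filter2 cc (two (zs j)) v = [cc, cc, two (zs j), two (zs j)] :=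
  proj_aabb hC hv (σ := two t) (τ := two (ts 0)) (by simp)
    ((keep_baseWord hC hj hC.pos (by simp [outline])).trans (by simp [outline, keep_cons]))
    (by simp) (by simp)

theorem filter2_one_y_two_x : filter2 (one y) (two x) v = [one y, two x, one y, two x] :=
  proj_abab hC hv (σ := one t) (τ := two t) (by simp)
    ((keep_baseWord hC hC.m_pos hC.pos (by simp [outline])).trans (by simp [outline, keep_cons]))
    (by simp) (by simp)

theorem filter2_one_y_two_y : filter2 (one y) (two y) v = [one y, two y, one y, two y] :=
  proj_abab hC hv (σ := one t) (τ := two t) (by simp)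
    ((keep_baseWord hC hC.m_pos hC.pos (by simp [outline])).trans (by simp [outline, keep_cons]))
    (by simp) (by simp)

theorem filter2_cc_dd : filter2 cc dd v = [cc, dd, cc, dd] :=
  proj_abab hC hv (σ := two t) (τ := one (ts 0)) (by simp)
    ((keep_baseWord hC hC.m_pos hC.pos (by simp [outline])).trans (by simp [outline, keep_cons]))
    (by simp) (by simp)

end Facts

/-! ### Separation of letters -/

/-- Linked letters would give an occurrence of `q` in the first factor before an occurrence of `p`
in the second. -/
theorem not_linked_of_filter2 {α : Type} [DecidableEq α] {S : α → Prop} {v : List α} {p q : α}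
    (hpq : p ≠ q) {a b : ℕ}
    (h : filter2 p q v = List.replicate a p ++ List.replicate b q) : ¬ Linked S v p q := by
  rintro ⟨v0, A, r1, B, r3, rfl, ⟨-, h2, h3, -⟩, -, -⟩
  have e : filter2 p q (v0 ++ A) ++ filter2 p q (r1 ++ (B ++ r3)) =
      List.replicate a p ++ List.replicate b q := by
    rw [← h, ← filter2_append, List.append_assoc]
  have hq : q ∈ filter2 p q (v0 ++ A) := mem_filter2.2 ⟨by simp [h2], Or.inr rfl⟩
  have hp : p ∈ filter2 p q (r1 ++ (B ++ r3)) := mem_filter2.2 ⟨by simp [h3], Or.inl rfl⟩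
  rcases List.append_eq_append_iff.1 e with ⟨c, h4, -⟩ | ⟨c, -, h5⟩
  · exact hpq (List.eq_of_mem_replicate (n := a) (by rw [h4]; simp [hq])).symm
  · exact hpq (List.eq_of_mem_replicate (n := b) (by rw [h5]; simp [hp]))

section Chain

variable {n m : ℕ} {C : List Letter}

/-- The word `v` contains a copy of the given word, up to the order of `x` and `y`. -/
structure HasCopy (n m : ℕ) (C : List Letter) (v : List Alph) (ι : Letter → Alph)
    (e : Letter → ℕ) : Prop where
  adm : Adm e
  inj : Function.Injective ι
  eq : ∀ p q, ¬ (p = x ∧ q = y) → ¬ (p = y ∧ q = x) →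
    filter2 (ι p) (ι q) v = (filter2 p q (expand e (shape n m C [x, y]))).map ι

variable {v : List Alph} {ι : Letter → Alph} {e : Letter → ℕ}

theorem HasCopy.count (h : HasCopy n m C v ι e) (p : Letter) :
    v.count (ι p) = e p * (shape n m C [x, y]).count p := by
  have := congrArg (List.count (ι p)) (h.eq p p (by rintro ⟨rfl, h⟩; cases h)
    (by rintro ⟨rfl, h⟩; cases h))
  rwa [List.count_map_of_injective _ _ h.inj, count_filter2_left, count_filter2_left,
    count_expand] at this

theorem HasCopy.at (h : HasCopy n m C v ι e) {σ p : Letter} (hs : smp σ = true)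
    (hσ : (shape n m C [x, y]).count σ = 1) {r : Loc}
    (ha : At (expand e (shape n m C [x, y])) σ p r) : At v (ι σ) (ι p) r := by
  refine At.of_filter2 (h.eq σ p (by rintro ⟨rfl, -⟩; cases hs) (by rintro ⟨rfl, -⟩; cases hs))
    ((ha.filter2 ?_).map h.inj)
  rw [count_expand, hσ, h.adm.eq_one]
  cases σ <;> first | rfl | cases hs

variable (hC : Core n m C)
include hC

/-- For i < j, `ts j` separates `zs i` from `zs j`, and `tp i` separates `zp i` from `zp j`. The
letter `ts 0` separates the `zs` from all other nonsimple letters, and `tp (2 * n - 1)` separates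
the `ys` from `x`, `y` and the `zp`. Finally `zp i` is separated from `x` and `y` by `tp i` if i < n
and by `t` otherwise. -/
theorem Core.separated (he : Adm e) {p q : Letter} (hpq : p ≠ q) (hp : smp p = false)
    (hq : smp q = false) (hp' : 0 < (shape n m C [x, y]).count p)
    (hq' : 0 < (shape n m C [x, y]).count q) :
    (∃ σ r r', smp σ = true ∧ (shape n m C [x, y]).count σ = 1 ∧
      At (expand e (shape n m C [x, y])) σ p r ∧ At (expand e (shape n m C [x, y])) σ q r' ∧
      r ≠ r') ∨ (p = x ∧ q = y ∨ p = y ∧ q = x) ∨ ∃ i j, p = ys i ∧ q = ys j := by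
  have hn := hC.pos
  have hm := hC.m_pos
  have zs_zs : ∀ {i j : ℕ}, i < j → j < m →
      ∃ σ r r', smp σ = true ∧ (shape n m C [x, y]).count σ = 1 ∧
      At (expand e (shape n m C [x, y])) σ (zs i) r ∧
      At (expand e (shape n m C [x, y])) σ (zs j) r' ∧ r ≠ r' := by
    intro i j hij hj
    have h1 := hC.at_ts_zs he hj (hij.trans hj)
    have h2 := hC.at_ts_zs he hj hj
    rw [if_pos hij] at h1
    rw [if_neg (lt_irrefl _)] at h2
    exact ⟨ts j, _, _, rfl, by simp [hC.count_shape, hj], h1, h2, by simp⟩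
  have zp_zp : ∀ {i j : ℕ}, i < j → j < 2 * n →
      ∃ σ r r', smp σ = true ∧ (shape n m C [x, y]).count σ = 1 ∧
      At (expand e (shape n m C [x, y])) σ (zp i) r ∧
      At (expand e (shape n m C [x, y])) σ (zp j) r' ∧ r ≠ r' := by
    intro i j hij hj
    have h1 := hC.at_tp he (hij.trans hj)
    exact ⟨tp i, _, _, rfl, by simp [hC.count_shape, hij.trans hj], h1.1, h1.2.1 j hij, by simp⟩
  have zs_o : ∀ {i : ℕ} {q : Letter}, i < m → smp q = false → (∀ j, q ≠ zs j) →
      ∃ σ r r', smp σ = true ∧ (shape n m C [x, y]).count σ = 1 ∧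
      At (expand e (shape n m C [x, y])) σ (zs i) r ∧
      At (expand e (shape n m C [x, y])) σ q r' ∧ r ≠ r' := by
    intro i q hi hq hz
    have h1 := hC.at_ts_zs he hm hi
    rw [if_neg (Nat.not_lt_zero _)] at h1
    exact ⟨ts 0, _, _, rfl, by simp [hC.count_shape, hm], h1, hC.at_ts_bfr he hm hq hz, by simp⟩
  have zp_o : ∀ {i : ℕ} {q : Letter}, i < 2 * n → q = x ∨ q = y →
      ∃ σ r r', smp σ = true ∧ (shape n m C [x, y]).count σ = 1 ∧
      At (expand e (shape n m C [x, y])) σ (zp i) r ∧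
      At (expand e (shape n m C [x, y])) σ q r' ∧ r ≠ r' := by
    intro i q hi hq
    by_cases hin : i < n
    · have h1 := hC.at_tp he hi
      refine ⟨tp i, .str, .aft, rfl, by simp [hC.count_shape, hi], h1.1, ?_, by simp⟩
      rcases hq with rfl | rfl
      · exact (h1.2.2 hin).1
      · exact (h1.2.2 hin).2
    · refine ⟨t, .aft, .str, rfl, by simp [hC.count_shape], (hC.at_t he rfl).2 (by simp) (by simp) ?_,
        ?_, by simp⟩
      · intro j hj h
        injection h with h
        omega
      · rcases hq with rfl | rfl
        · exact (hC.at_t he rfl).1 (by simp)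
        · exact (hC.at_t he rfl).1 (by simp)
  have ys_o : ∀ {i : ℕ} {q : Letter}, smp q = false → (q = x ∨ q = y ∨ ∃ j < 2 * n, q = zp j) →
      ∃ σ r r', smp σ = true ∧ (shape n m C [x, y]).count σ = 1 ∧
      At (expand e (shape n m C [x, y])) σ (ys i) r ∧
      At (expand e (shape n m C [x, y])) σ q r' ∧ r ≠ r' := by
    intro i q hq h
    refine ⟨tp (2 * n - 1), .aft, .str, rfl, ?_, (hC.at_tp_last he rfl).2 (by simp) (by simp)
      (by simp), (hC.at_tp_last he hq).1 h, by simp⟩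
    simp only [hC.count_shape]
    rw [if_pos (by omega)]
  have flip : ∀ {p q : Letter}, (∃ σ r r', smp σ = true ∧ (shape n m C [x, y]).count σ = 1 ∧
      At (expand e (shape n m C [x, y])) σ p r ∧
      At (expand e (shape n m C [x, y])) σ q r' ∧ r ≠ r') →
      ∃ σ r r', smp σ = true ∧ (shape n m C [x, y]).count σ = 1 ∧
      At (expand e (shape n m C [x, y])) σ q r ∧
      At (expand e (shape n m C [x, y])) σ p r' ∧ r ≠ r' := by
    rintro p q ⟨σ, r, r', h1, h2, h3, h4, h5⟩
    exact ⟨σ, r', r, h1, h2, h4, h3, h5.symm⟩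
  rw [hC.count_shape] at hp' hq'
  cases p <;> cases q <;> simp only [smp, reduceCtorEq] at hp hq <;>
    dsimp only at hp' hq'
  case x.x | y.y => exact absurd rfl hpq
  case x.y | y.x => exact Or.inr (Or.inl (by simp))
  case ys.ys i j => exact Or.inr (Or.inr ⟨i, j, rfl, rfl⟩)
  case zs.zs i j =>
    have hi : i < m := by by_contra h; simp [h] at hp'
    have hj : j < m := by by_contra h; simp [h] at hq'
    rcases Nat.lt_trichotomy i j with h | h | h
    · exact Or.inl (zs_zs h hj)
    · exact absurd (by rw [h]) hpq
    · exact Or.inl (flip (zs_zs h hi))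
  case zp.zp i j =>
    have hi : i < 2 * n := by by_contra h; simp [h] at hp'
    have hj : j < 2 * n := by by_contra h; simp [h] at hq'
    rcases Nat.lt_trichotomy i j with h | h | h
    · exact Or.inl (zp_zp h hj)
    · exact absurd (by rw [h]) hpq
    · exact Or.inl (flip (zp_zp h hi))
  case zs.x i | zs.y i | zs.ys i _ | zs.zp i _ =>
    have hi : i < m := by by_contra h; simp [h] at hp'
    exact Or.inl (zs_o hi rfl (by simp))
  case x.zs i | y.zs i | ys.zs _ i | zp.zs _ i =>
    have hi : i < m := by by_contra h; simp [h] at hq'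
    exact Or.inl (flip (zs_o hi rfl (by simp)))
  case zp.x i | zp.y i =>
    have hi : i < 2 * n := by by_contra h; simp [h] at hp'
    exact Or.inl (zp_o hi (by simp))
  case x.zp i | y.zp i =>
    have hi : i < 2 * n := by by_contra h; simp [h] at hq'
    exact Or.inl (flip (zp_o hi (by simp)))
  case ys.zp _ i =>
    have hi : i < 2 * n := by by_contra h; simp [h] at hq'
    exact Or.inl (ys_o rfl (by simp [hi]))
  case zp.ys i _ =>
    have hi : i < 2 * n := by by_contra h; simp [h] at hp'
    exact Or.inl (flip (ys_o rfl (by simp [hi])))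
  case ys.x | ys.y => exact Or.inl (ys_o rfl (by simp))
  case x.ys | y.ys => exact Or.inl (flip (ys_o rfl (by simp)))

theorem HasCopy.mem (h : HasCopy n m C v ι e) {σ : Letter}
    (hσ : (shape n m C [x, y]).count σ = 1) : ι σ ∈ v := by
  rw [← List.count_pos_iff, h.count, hσ, mul_one]
  exact h.adm.sq_le σ

/-- Linked letters have equal locations relative to every simple letter, which leaves the pair x, y
and pairs of squares; occurrences of two squares are not interleaved. -/
theorem HasCopy.eq_xy_of_linked (h : HasCopy n m C v ι e) {S : Alph → Prop}
    (hS : ∀ σ, smp σ = true → S (ι σ)) {p q : Letter} (hpq : p ≠ q) (hp : smp p = false)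
    (hq : smp q = false) (hl : Linked S v (ι p) (ι q)) : p = x ∧ q = y ∨ p = y ∧ q = x := by
  have pos : ∀ {p : Letter}, ι p ∈ v → 0 < (shape n m C [x, y]).count p := by
    intro p hp
    rw [← List.count_pos_iff, h.count] at hp
    exact Nat.pos_of_mul_pos_left hp
  have hl' := hl
  obtain ⟨v0, A, r1, B, r3, hv, ⟨h1, h2, -, -⟩, -, -⟩ := hl'
  rcases hC.separated h.adm hpq hp hq (pos (by rw [hv]; simp [h1])) (pos (by rw [hv]; simp [h2]))
    with ⟨σ, r, r', h3, h4, h5, h6, h7⟩ | h3 | ⟨i, j, rfl, rfl⟩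
  · exact absurd (hl.loc_eq (hS σ h3) (h.mem hC h4) (h.at h3 h4 h5) (h.at h3 h4 h6)) h7
  · exact h3
  · have hne := h.inj.ne hpq
    have h3 := h.eq (ys i) (ys j) (by simp) (by simp)
    obtain ⟨a, b, h4 | h4⟩ := hC.filter2_sq h.adm (fun e => hpq (by rw [e]) : i ≠ j)
    · rw [h4, List.map_append, List.map_replicate, List.map_replicate] at h3
      exact absurd hl (not_linked_of_filter2 hne h3)
    · rw [h4, List.map_append, List.map_replicate, List.map_replicate, filter2_comm] at h3
      exact absurd hl.symm (not_linked_of_filter2 hne.symm h3)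

variable (hv : v ∈ Similar n m C)
include hv

theorem exists_hasCopy_one : ∃ e, HasCopy n m C v one e := by
  obtain ⟨e, he, h⟩ := exists_chain hC hv (ι := one) (π := fst) (fun l => rfl)
    (by rintro (l | l | _ | _) <;> simp [fst]) (fst_bigWord _ _ (by simp [fst])) (Or.inl rfl)
    (Or.inr (by simp [fst]))
  exact ⟨e, he, one_injective, h⟩

theorem exists_hasCopy_two : ∃ e, HasCopy n m C v two e := by
  obtain ⟨e, he, h⟩ := exists_chain hC hv (ι := two) (π := snd) (fun l => rfl)
    (by rintro (l | l | _ | _) <;> simp [snd]) (snd_bigWord _ _ (by simp [snd]))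
    (Or.inr (by simp [snd])) (Or.inl rfl)
  exact ⟨e, he, two_injective, h⟩

end Chain

/-- The letters that occur once. -/
def Smp : Alph → Prop
  | one l => smp l = true
  | two l => smp l = true
  | _ => False

/-- If `p` occurred after `σ`, where `q` no longer occurs, the projection onto `q`, `p` would end in
`p`. -/
theorem at_bfr_of_last {α : Type} [DecidableEq α] {v W : List α} {σ p q : α} (hσ : σ ≠ q)
    (hpq : p ≠ q) (h : filter2 q p v = W ++ [q]) (hq : At v σ q .bfr) : At v σ p .bfr := by
  rintro L R rfl hp
  have hR : q ∉ σ :: R := by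
    simp only [List.mem_cons, not_or]
    exact ⟨hσ.symm, hq L R rfl⟩
  have hp' : p ∈ σ :: R := by simp [hp]
  rw [filter2_append, filter2_of_notMem_left hR] at h
  obtain ⟨k, hk⟩ := Nat.exists_eq_add_of_lt (List.count_pos_iff.2 hp')
  rw [show List.count p (σ :: R) = k + 1 by omega, List.replicate_succ', ← List.append_assoc] at h
  have := List.append_inj_right' h rfl
  simp at this
  exact hpq this

section Separation

variable {n m : ℕ} {C : List Letter} (hC : Core n m C) {v : List Alph} (hv : v ∈ Similar n m C)
include hC

theorem filter2_y_last {e : Letter → ℕ} (he : Adm e) {p : Letter} (hp : p ∉ tailW m) :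
    ∃ W, filter2 y p (expand e (shape n m C [x, y])) = W ++ [y] := by
  rw [he.expand_shape_xy]
  have : shape n m (expand e C) [x, y] =
      (primes 0 n ++ ([x, y] ++ (t :: (primes n n ++ (x :: expand e C))))) ++ (y :: tailW m) := by
    simp [shape]
  rw [this, filter2_append, filter2_cons, if_pos (Or.inl rfl),
    filter2_eq_nil y_notMem_tailW hp]
  exact ⟨_, rfl⟩

include hv

/-- Except for `x`, which has its own projection, and `y` itself, such a letter has no occurrence
after the last `y` of its copy, and this `y` precedes `two t`. -/
theorem at_one_h {l : Letter} (hl : smp l = false) (hz : ∀ j, l ≠ zs j) :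
    At v (two t) (one l) .bfr := by
  obtain ⟨e, he⟩ := exists_hasCopy_one hC hv
  have hy := at_bfr_of_filter2 (by simp) (filter2_one_y_h hC hv)
  by_cases hx : l = x
  · subst hx
    exact at_bfr_of_filter2 (by simp) (filter2_one_x_h hC hv)
  · by_cases hly : l = y
    · exact hly ▸ hy
    · have hT : l ∉ tailW m := by
        intro h
        obtain ⟨i, -, rfl | rfl⟩ := mem_tailW.1 h
        · simp [smp] at hl
        · exact hz i rfl
      obtain ⟨W, hW⟩ := filter2_y_last hC he.adm hT
      have h := he.eq y l (by simp) (by simp [hx])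
      rw [hW, List.map_append] at h
      exact at_bfr_of_last (by simp) (by simpa using hly) h hy

/-- Within one copy this is `HasCopy.eq_xy_of_linked`. Any other pair of distinct nonsimple letters,
from different copies or involving `cc` or `dd`, is told apart by the location relative to one of
finitely many types of simple letters. -/
theorem special_of_linked {p q : Alph} (hpq : p ≠ q) (hp : ¬ Smp p) (hq : ¬ Smp q)
    (hl : Linked Smp v p q) :
    (p = one x ∧ q = one y ∨ p = one y ∧ q = one x) ∨
      (p = two x ∧ q = two y ∨ p = two y ∧ q = two x) := by
  obtain ⟨e1, h1⟩ := exists_hasCopy_one hC hv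
  obtain ⟨e2, h2⟩ := exists_hasCopy_two hC hv
  have hn := hC.pos
  have hm := hC.m_pos
  have cg : (shape n m C [x, y]).count (tp (2 * n - 1)) = 1 := by
    simp only [hC.count_shape]
    rw [if_pos (by omega)]
  have ct : (shape n m C [x, y]).count t = 1 := by simp [hC.count_shape]
  have ck : (shape n m C [x, y]).count (ts 0) = 1 := by simp [hC.count_shape, hm]
  have mg := h1.mem hC cg
  have mh := h2.mem hC ct
  have mk := h2.mem hC ck
  have ml := h1.mem hC ck
  have mem1 : ∀ {p q : Alph}, Linked Smp v p q → p ∈ v := by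
    rintro p q ⟨v0, A, r1, B, r3, rfl, ⟨h, -, -, -⟩, -, -⟩
    simp [h]
  have zlt : ∀ {ι : Letter → Alph} {e : Letter → ℕ}, HasCopy n m C v ι e → ∀ {j : ℕ},
      ι (zs j) ∈ v → j < m := by
    intro ι e h j hj
    rw [← List.count_pos_iff, h.count, hC.count_shape] at hj
    by_contra hjm
    simp [hjm] at hj
  have cch := at_str_of_filter2 (by simp) (filter2_cc_h hC hv)
  have ccg := at_str_of_filter2 (by simp) (filter2_cc_g hC hv)
  have ddh := at_aft_of_filter2 (by simp) (filter2_dd_h hC hv)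
  have ddk := at_str_of_filter2 (by simp) (filter2_dd_k hC hv)
  have ddl := at_str_of_filter2 (by simp) (filter2_dd_l hC hv)
  have no : ∀ {σ p q : Alph} {r r' : Loc}, Linked Smp v p q → σ ∈ v → Smp σ → r ≠ r' →
      At v σ p r → At v σ q r' → False := fun hl hσ hS hr hp hq => hr (hl.loc_eq hS hσ hp hq)
  have one_two : ∀ {l l' : Letter}, smp l = false → smp l' = false →
      Linked Smp v (one l) (two l') → False := by
    intro l l' hs hs' hl
    by_cases hz : ∃ j, l = zs j
    · obtain ⟨j, rfl⟩ := hz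
      have hj := zlt h1 (mem1 hl)
      by_cases hz' : ∃ j, l' = zs j
      · obtain ⟨j', rfl⟩ := hz'
        exact no hl mh rfl (by simp) (at_str_of_filter2 (by simp) (filter2_one_zs_h hC hv hj))
          (h2.at rfl ct ((hC.at_t h2.adm rfl).2 (by simp) (by simp) (by simp)))
      · push Not at hz'
        exact no hl mk rfl (by simp) (at_str_of_filter2 (by simp) (filter2_one_zs_k hC hv hj))
          (h2.at rfl ck (hC.at_ts_bfr h2.adm hm hs' hz'))
    · push Not at hz
      have hb := at_one_h hC hv hs hz
      by_cases h : l' = x ∨ l' = y ∨ ∃ i < n, l' = zp i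
      · exact no hl mh rfl (by simp) hb (h2.at rfl ct ((hC.at_t h2.adm hs').1 h))
      · push Not at h
        exact no hl mh rfl (by simp) hb (h2.at rfl ct ((hC.at_t h2.adm hs').2 h.1 h.2.1 h.2.2))
  have one_cc : ∀ {l : Letter}, smp l = false → Linked Smp v (one l) cc → False := by
    intro l hs hl
    by_cases hz : ∃ j, l = zs j
    · obtain ⟨j, rfl⟩ := hz
      have hj := zlt h1 (mem1 hl)
      exact no hl mg rfl (by simp) (at_aft_of_filter2 (by simp) (filter2_one_zs_g hC hv hj)) ccg
    · push Not at hz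
      exact no hl mh rfl (by simp) (at_one_h hC hv hs hz) cch
  have one_dd : ∀ {l : Letter}, smp l = false → Linked Smp v (one l) dd → False := by
    intro l hs hl
    by_cases hz : ∃ j, l = zs j
    · obtain ⟨j, rfl⟩ := hz
      have hj := zlt h1 (mem1 hl)
      exact no hl mh rfl (by simp) (at_str_of_filter2 (by simp) (filter2_one_zs_h hC hv hj)) ddh
    · push Not at hz
      exact no hl mh rfl (by simp) (at_one_h hC hv hs hz) ddh
  have two_cc : ∀ {l : Letter}, smp l = false → Linked Smp v (two l) cc → False := by
    intro l hs hl
    by_cases h : l = x ∨ l = y ∨ ∃ i < n, l = zp i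
    · rcases h with rfl | rfl | ⟨i, hi, rfl⟩
      · exact no hl mg rfl (by simp) (at_aft_of_filter2 (by simp) (filter2_two_x_g hC hv)) ccg
      · exact no hl mg rfl (by simp) (at_aft_of_filter2 (by simp) (filter2_two_y_g hC hv)) ccg
      · have ce : (shape n m C [x, y]).count (tp i) = 1 := by
          simp only [hC.count_shape]
          rw [if_pos (by omega)]
        exact no hl (h2.mem hC ce) rfl (by simp)
          (h2.at rfl ce (hC.at_tp h2.adm (by omega)).1)
          (at_aft_of_filter2 (by simp) (filter2_cc_e hC hv hi))
    · push Not at h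
      exact no hl mh rfl (by simp) (h2.at rfl ct ((hC.at_t h2.adm hs).2 h.1 h.2.1 h.2.2)) cch
  have two_dd : ∀ {l : Letter}, smp l = false → Linked Smp v (two l) dd → False := by
    intro l hs hl
    by_cases hz : ∃ j, l = zs j
    · obtain ⟨j, rfl⟩ := hz
      have hj := zlt h2 (mem1 hl)
      exact no hl ml rfl (by simp) (at_bfr_of_filter2 (by simp) (filter2_two_zs_l hC hv hj)) ddl
    · push Not at hz
      exact no hl mk rfl (by simp) (h2.at rfl ck (hC.at_ts_bfr h2.adm hm hs hz)) ddk
  have cc_dd : Linked Smp v cc dd → False := fun hl => no hl mh rfl (by simp) cch ddh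
  rcases p with l | l | _ | _ <;> rcases q with l' | l' | _ | _ <;>
    simp only [Smp, Bool.not_eq_true, not_false_eq_true] at hp hq
  · have := h1.eq_xy_of_linked hC (fun σ h => h) (fun h => hpq (by rw [h])) hp hq hl
    exact Or.inl (by simpa using this)
  · exact (one_two hp hq hl).elim
  · exact (one_cc hp hl).elim
  · exact (one_dd hp hl).elim
  · exact (one_two hq hp hl.symm).elim
  · have := h2.eq_xy_of_linked hC (fun σ h => h) (fun h => hpq (by rw [h])) hp hq hl
    exact Or.inr (by simpa using this)
  · exact (two_cc hp hl).elim
  · exact (two_dd hp hl).elim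
  · exact (one_cc hq hl.symm).elim
  · exact (two_cc hq hl.symm).elim
  · exact absurd rfl hpq
  · exact (cc_dd hl).elim
  · exact (one_dd hq hl.symm).elim
  · exact (two_dd hq hl.symm).elim
  · exact (cc_dd hl.symm).elim
  · exact absurd rfl hpq

end Separation

/-! ### Images of words under substitutions -/

section Lists

variable {α β : Type} [DecidableEq α] [DecidableEq β]

theorem count_mul_le_count_flatMap (φ : α → List β) (L : List α) (g : α) (p : β) :
    L.count g * (φ g).count p ≤ (L.flatMap φ).count p := by
  induction L with
  | nil => simp
  | cons a L ih =>
    rw [List.flatMap_cons, List.count_append, List.count_cons]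
    by_cases h : a = g
    · subst h
      simp only [beq_self_eq_true, if_true]
      rw [add_mul, one_mul]
      omega
    · simp only [beq_iff_eq, h, if_false, add_zero]
      omega

theorem count_le_count_flatMap {φ : α → List β} {L : List α} {g : α} {p : β} (hp : p ∈ φ g) :
    L.count g ≤ (L.flatMap φ).count p :=
  le_trans (Nat.le_mul_of_pos_right _ (List.count_pos_iff.2 hp))
    (count_mul_le_count_flatMap φ L g p)

theorem exists_of_two_le_count {L : List α} {g : α} (h : 2 ≤ L.count g) :
    ∃ a b c, L = a ++ g :: (b ++ g :: c) := by
  induction L with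
  | nil => simp at h
  | cons a L ih =>
    by_cases hag : a = g
    · subst hag
      rw [List.count_cons_self] at h
      obtain ⟨b, c, rfl⟩ := List.append_of_mem (List.count_pos_iff.1 (by omega : 0 < L.count a))
      exact ⟨[], b, c, rfl⟩
    · rw [List.count_cons_of_ne hag] at h
      obtain ⟨b, c, d, rfl⟩ := ih h
      exact ⟨a :: b, c, d, rfl⟩

theorem eq_replicate_of_forall_eq {L : List α} {p : α} (hp : p ∈ L) (h : ∀ q ∈ L, q = p) :
    ∃ k, L = List.replicate (k + 1) p := by
  refine ⟨L.length - 1, ?_⟩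
  rw [Nat.sub_add_cancel (List.length_pos_of_mem hp)]
  exact List.eq_replicate_iff.2 ⟨rfl, h⟩

/-- Pigeonhole principle: an image made of one letter can cover at most one element of `S`. -/
theorem card_le_card_of_forall_mem {φ : α → List β} {S : Finset β} {G : Finset α}
    (h1 : ∀ p ∈ S, ∃ g ∈ G, p ∈ φ g) (h2 : ∀ g ∈ G, ∀ p ∈ φ g, ∀ q ∈ φ g, p = q) :
    S.card ≤ G.card := by
  choose f hf using fun p : S => h1 p.1 p.2
  have hinj : Function.Injective fun p : S => (⟨f p, (hf p).1⟩ : G) := by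
    intro p q e
    have e' : f p = f q := congrArg Subtype.val e
    exact Subtype.ext (h2 _ (hf p).1 p (hf p).2 q (by rw [e']; exact (hf q).2))
  simpa using Fintype.card_le_of_injective _ hinj

end Lists

section Images

variable {n m : ℕ} {C : List Letter} {v : List Alph} {ι : Letter → Alph} {e : Letter → ℕ}

theorem HasCopy.filter2_x_zs (hC : Core n m C) (h : HasCopy n m C v ι e) {j : ℕ} (hj : j < m) :
    filter2 (ι x) (ι (zs j)) v = [ι x, ι x, ι (zs j), ι (zs j)] := by
  rw [h.eq x (zs j) (by simp) (by simp), hC.filter2_x_zs h.adm hj]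
  rfl

theorem HasCopy.filter2_y_zs (hC : Core n m C) (h : HasCopy n m C v ι e) {j : ℕ} (hj : j < m) :
    filter2 (ι y) (ι (zs j)) v = [ι y, ι (zs j), ι y, ι (zs j)] := by
  rw [h.eq y (zs j) (by simp) (by simp), hC.filter2_y_zs h.adm hj]
  rfl

theorem HasCopy.count_x (hC : Core n m C) (h : HasCopy n m C v ι e) : v.count (ι x) = 2 := by
  rw [h.count, h.adm.eq_one x rfl]
  simp [hC.count_shape]

theorem HasCopy.count_y (hC : Core n m C) (h : HasCopy n m C v ι e) : v.count (ι y) = 2 := by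
  rw [h.count, h.adm.eq_one y rfl]
  simp [hC.count_shape]

theorem HasCopy.count_zs (hC : Core n m C) (h : HasCopy n m C v ι e) {j : ℕ} (hj : j < m) :
    v.count (ι (zs j)) = 2 := by
  rw [h.count, h.adm.eq_one (zs j) rfl]
  simp [hC.count_shape, hj]

theorem HasCopy.count_zp (hC : Core n m C) (h : HasCopy n m C v ι e) {i : ℕ} (hi : i < 2 * n) :
    v.count (ι (zp i)) = 2 := by
  rw [h.count, h.adm.eq_one (zp i) rfl]
  simp [hC.count_shape, hi]

theorem HasCopy.count_smp (hC : Core n m C) (h : HasCopy n m C v ι e) {l : Letter}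
    (hl : smp l = true) : v.count (ι l) ≤ 1 := by
  rw [h.count, h.adm.eq_one l (by cases l <;> first | rfl | cases hl), one_mul, hC.count_shape]
  cases l <;> first | exact le_rfl | (dsimp only; split_ifs <;> omega) | (exfalso; cases hl)

/-- The second occurrence of `x` precedes that of `y`. -/
theorem HasCopy.count_x_of_count_y (hC : Core n m C) (h : HasCopy n m C v ι e) {L R : List Alph}
    (hv : v = L ++ R) (hy : L.count (ι y) = 2) : L.count (ι x) = 2 := by
  have h1 := counts_aabb (h.inj.ne (by simp)) (h.filter2_x_zs hC hC.m_pos) hv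
  have h2 := counts_abab (h.inj.ne (by simp)) (h.filter2_y_zs hC hC.m_pos) hv
  omega

variable (hC : Core n m C) (hv : v ∈ Similar n m C)
include hC hv

theorem count_le_one_of_smp {p : Alph} (hp : Smp p) : v.count p ≤ 1 := by
  obtain ⟨e1, h1⟩ := exists_hasCopy_one hC hv
  obtain ⟨e2, h2⟩ := exists_hasCopy_two hC hv
  rcases p with l | l | _ | _
  · exact h1.count_smp hC hp
  · exact h2.count_smp hC hp
  · exact hp.elim
  · exact hp.elim

variable {φ : Alph → List Alph} {pre post u : List Alph} (hu : v = pre ++ (u.flatMap φ ++ post))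
include hu

/-- A simple letter occurs at most once in `v`, while an image of `g` is repeated. -/
theorem not_smp_of_mem_image {g p : Alph} (hg : 2 ≤ u.count g) (hp : p ∈ φ g) : ¬ Smp p := by
  intro h
  have h1 := count_le_one_of_smp hC hv h
  have h2 := count_le_count_flatMap (L := u) hp
  rw [hu, List.count_append, List.count_append] at h1
  omega

/-- Two distinct letters of a repeated image are linked, so they are x and y of one copy. Then each
copy of the image contains one x and one y, and `zs 0`, which first occurs between the second x and
the second y, falls inside the image as well. This makes x and `zs 0` linked, which is impossible.
-/
theorem eq_of_mem_image {g : Alph} (hg : 2 ≤ u.count g) : ∀ p ∈ φ g, ∀ q ∈ φ g, p = q := by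
  obtain ⟨a, b, c, hu'⟩ := exists_of_two_le_count hg
  have hv' : v = (pre ++ a.flatMap φ) ++ (φ g ++ (b.flatMap φ ++ (φ g ++ (c.flatMap φ ++ post)))) := by
    rw [hu, hu']
    simp [List.flatMap_append, List.flatMap_cons]
  have hs : ∀ p ∈ φ g, ¬ Smp p := fun p hp => not_smp_of_mem_image hC hv hu hg hp
  have linked : ∀ {p q}, p ∈ φ g → q ∈ φ g → Linked Smp v p q := fun hp hq =>
    ⟨_, _, _, _, _, hv', ⟨hp, hq, hp, hq⟩, hs, hs⟩
  have key : ∀ {ι : Letter → Alph} {e : Letter → ℕ}, HasCopy n m C v ι e →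
      ι x ∈ φ g → ι y ∈ φ g → ι (zs 0) ∈ φ g := by
    intro ι e h hx hy
    by_contra hz
    have hv1 : v = (pre ++ a.flatMap φ ++ φ g ++ b.flatMap φ) ++ (φ g ++ (c.flatMap φ ++ post)) := by
      rw [hv']
      simp
    have hv2 : v = (pre ++ a.flatMap φ ++ φ g ++ b.flatMap φ ++ φ g) ++ (c.flatMap φ ++ post) := by
      rw [hv']
      simp
    have c1 := h.count_x hC
    have c2 := List.count_pos_iff.2 hx
    have c3 := List.count_pos_iff.2 hy
    have c4 := List.count_eq_zero.2 hz
    have h1 := counts_aabb (h.inj.ne (by simp)) (h.filter2_x_zs hC hC.m_pos) hv1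
    have h2 := counts_abab (h.inj.ne (by simp)) (h.filter2_y_zs hC hC.m_pos) hv2
    rw [hv1] at c1
    simp only [List.count_append] at c1 h1 h2
    omega
  intro p hp q hq
  by_contra hpq
  obtain ⟨e1, h1⟩ := exists_hasCopy_one hC hv
  obtain ⟨e2, h2⟩ := exists_hasCopy_two hC hv
  have done : ∀ {ι : Letter → Alph} {e : Letter → ℕ}, HasCopy n m C v ι e → (ι = one ∨ ι = two) →
      ι x ∈ φ g → ι y ∈ φ g → False := by
    intro ι e h hι hx hy
    have hz := key h hx hy
    have := special_of_linked hC hv (h.inj.ne (by simp)) (hs _ hx) (hs _ hz) (linked hx hz)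
    rcases hι with rfl | rfl <;> simp at this
  rcases special_of_linked hC hv hpq (hs p hp) (hs q hq) (linked hp hq) with
    (⟨rfl, rfl⟩ | ⟨rfl, rfl⟩) | (⟨rfl, rfl⟩ | ⟨rfl, rfl⟩)
  · exact done h1 (Or.inl rfl) hp hq
  · exact done h1 (Or.inl rfl) hq hp
  · exact done h2 (Or.inr rfl) hp hq
  · exact done h2 (Or.inr rfl) hq hp

/-- The images of the letters of a pair `x`, `y` commute, or they are such a pair. -/
theorem commute_or_of_image {ξ η : Alph} {X u0 u1 M u2 : List Alph}
    (hu' : u = u0 ++ (X ++ (u1 ++ ξ :: (M ++ η :: u2)))) (hne : ξ ≠ η)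
    (hX : X = [ξ, η] ∨ X = [η, ξ]) (hM : ∀ g ∈ M, 2 ≤ u.count g) :
    φ ξ ++ φ η = φ η ++ φ ξ ∨ ∃ ι, (ι = one ∨ ι = two) ∧ φ ξ = [ι x] ∧ φ η = [ι y] := by
  by_cases hξ0 : φ ξ = []
  · exact Or.inl (by simp [hξ0])
  by_cases hη0 : φ η = []
  · exact Or.inl (by simp [hη0])
  obtain ⟨p, hp⟩ := List.exists_mem_of_ne_nil _ hξ0
  obtain ⟨q, hq⟩ := List.exists_mem_of_ne_nil _ hη0
  have cX : X.count ξ = 1 ∧ X.count η = 1 := by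
    rcases hX with rfl | rfl <;> simp [hne, hne.symm]
  have cξ : 2 ≤ u.count ξ := by
    rw [hu']
    simp only [List.count_append, List.count_cons_self]
    omega
  have cη : 2 ≤ u.count η := by
    rw [hu']
    simp only [List.count_append, List.count_cons, beq_self_eq_true, if_true]
    omega
  obtain ⟨k, hk⟩ := eq_replicate_of_forall_eq hp fun r hr => eq_of_mem_image hC hv hu cξ r hr p hp
  obtain ⟨l, hl⟩ := eq_replicate_of_forall_eq hq fun r hr => eq_of_mem_image hC hv hu cη r hr q hq
  by_cases hpq : p = q
  · subst hpq
    rw [hk, hl]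
    simp [List.replicate_append_replicate, add_comm]
  have hv' : v = (pre ++ u0.flatMap φ) ++ (X.flatMap φ ++ (u1.flatMap φ ++
      ((φ ξ ++ (M.flatMap φ ++ φ η)) ++ (u2.flatMap φ ++ post)))) := by
    rw [hu, hu']
    simp [List.flatMap_append, List.flatMap_cons]
  have hs1 := fun r (hr : r ∈ φ ξ) => not_smp_of_mem_image hC hv hu cξ hr
  have hs2 := fun r (hr : r ∈ φ η) => not_smp_of_mem_image hC hv hu cη hr
  -- The two factors are the image of `X` and the image of the segment from `ξ` to `η`; the latter
  -- has no simple letters because every letter of `M` is repeated in `u`.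
  have hlink : Linked Smp v p q := by
    refine ⟨_, _, _, _, _, hv', ⟨?_, ?_, by simp [hp], by simp [hq]⟩, ?_, ?_⟩
    · rcases hX with rfl | rfl <;> simp [hp]
    · rcases hX with rfl | rfl <;> simp [hq]
    · intro r hr
      have : r ∈ φ ξ ∨ r ∈ φ η := by
        rcases hX with rfl | rfl <;> simp at hr
        · exact hr
        · exact hr.symm
      exact this.elim (hs1 r) (hs2 r)
    · intro r hr
      simp only [List.mem_append, List.mem_flatMap] at hr
      rcases hr with hr | ⟨g, hg, hr⟩ | hr
      · exact hs1 r hr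
      · exact not_smp_of_mem_image hC hv hu (hM g hg) hr
      · exact hs2 r hr
  -- Each of `ξ`, `η` occurs twice, and so does each of x, y in `v`; hence both powers have exponent
  -- one.
  have good : ∀ {ι : Letter → Alph} {e : Letter → ℕ}, HasCopy n m C v ι e → p = ι x → q = ι y →
      φ ξ = [ι x] ∧ φ η = [ι y] := by
    rintro ι e h rfl rfl
    have c1 := h.count_x hC
    have c2 := h.count_y hC
    have c3 := count_mul_le_count_flatMap φ u ξ (ι x)
    have c4 := count_mul_le_count_flatMap φ u η (ι y)
    rw [hk, List.count_replicate_self] at c3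
    rw [hl, List.count_replicate_self] at c4
    rw [hu, List.count_append, List.count_append] at c1 c2
    have c5 := Nat.mul_le_mul_right (k + 1) cξ
    have c6 := Nat.mul_le_mul_right (l + 1) cη
    have hk0 : k = 0 := by omega
    have hl0 : l = 0 := by omega
    subst hk0 hl0
    exact ⟨hk, hl⟩
  -- Here both occurrences of y would lie in a prefix that is followed by a further x.
  have bad : ∀ {ι : Letter → Alph} {e : Letter → ℕ}, HasCopy n m C v ι e → p = ι y → q = ι x →
      False := by
    rintro ι e h rfl rfl
    have hv1 : v = (pre ++ u0.flatMap φ ++ X.flatMap φ ++ u1.flatMap φ ++ φ ξ) ++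
        (M.flatMap φ ++ (φ η ++ (u2.flatMap φ ++ post))) := by
      rw [hv']
      simp
    have c1 := h.count_x hC
    have c2 := h.count_y hC
    have c3 := List.count_pos_iff.2 hp
    have c4 := List.count_pos_iff.2 hq
    have c5 := count_le_count_flatMap (L := X) hp
    have c6 := h.count_x_of_count_y hC hv1
    rw [hv1] at c1 c2
    simp only [List.count_append] at c1 c2 c6
    have := c6 (by omega)
    omega
  obtain ⟨e1, h1⟩ := exists_hasCopy_one hC hv
  obtain ⟨e2, h2⟩ := exists_hasCopy_two hC hv
  rcases special_of_linked hC hv hpq (hs1 p hp) (hs2 q hq) hlink with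
    (⟨e1, e2⟩ | ⟨e1, e2⟩) | (⟨e1, e2⟩ | ⟨e1, e2⟩)
  · exact Or.inr ⟨one, Or.inl rfl, good h1 e1 e2⟩
  · exact (bad h1 e1 e2).elim
  · exact Or.inr ⟨two, Or.inr rfl, good h2 e1 e2⟩
  · exact (bad h2 e1 e2).elim

end Images

/-! ### The segments between the second occurrences of x and y -/

section Pairs

variable {n m : ℕ} {C : List Letter}

/-- The part of the interlocked word before the second occurrence of `x` of the first copy, without
the first occurrences of `x` and `y`. -/
def midOne (n : ℕ) : List Alph :=
  one t :: ((primes 0 n).map two ++ (cc :: (primes n n).map one))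

/-- The part of the interlocked word after the second occurrence of `y` of the first copy. -/
def endOne (n m : ℕ) (C : List Letter) : List Alph :=
  two t :: ((primes n n).map two ++ (two x :: dd :: cc :: ((expand stdExp C).map two ++
    (two y :: ((tailW m).map two ++ ((tailW m).map one ++ [dd]))))))

/-- The part of the interlocked word between the first and second occurrences of `x` and `y` of
the second copy. -/
def midTwo (n : ℕ) (C : List Letter) : List Alph :=
  (expand stdExp C).map one ++ (one y :: two t :: (primes n n).map two)

theorem bigWord_eq_one (X Y : List Alph) : bigWord n m C X Y = (primes 0 n).map one ++ (X ++
    (midOne n ++ one x :: ((Y ++ (expand stdExp C).map one) ++ one y :: endOne n m C))) := by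
  simp [bigWord, midOne, endOne]

theorem bigWord_eq_two (X Y : List Alph) : bigWord n m C X Y =
    ((primes 0 n).map one ++ (X ++ (midOne n ++ [one x]))) ++ (Y ++
      (midTwo n C ++ two x :: ((dd :: cc :: (expand stdExp C).map two) ++ two y ::
      ((tailW m).map two ++ ((tailW m).map one ++ [dd]))))) := by
  simp [bigWord, midOne, midTwo]

theorem bigWord_split_one (X Y : List Alph) : bigWord n m C X Y =
    ((primes 0 n).map one ++ (X ++ midOne n)) ++ one x ::
      ((Y ++ (expand stdExp C).map one) ++ one y :: endOne n m C) := by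
  rw [bigWord_eq_one]
  simp

theorem bigWord_split_two (X Y : List Alph) : bigWord n m C X Y =
    (((primes 0 n).map one ++ (X ++ (midOne n ++ [one x]))) ++ (Y ++ midTwo n C)) ++ two x ::
      ((dd :: cc :: (expand stdExp C).map two) ++ two y ::
      ((tailW m).map two ++ ((tailW m).map one ++ [dd]))) := by
  rw [bigWord_eq_two]
  simp

theorem Core.cases_of_mem_expand (hC : Core n m C) {l : Letter} (hl : l ∈ expand stdExp C) :
    (∃ j < m, l = zs j) ∨ (∃ i < 2 * n, l = zp i) ∨ (expand stdExp C).count l = 2 := by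
  have hl' := mem_expand hl
  cases l with
  | x => exact absurd hl' hC.x_notMem
  | y => exact absurd hl' hC.y_notMem
  | t => exact absurd hl' (hC.smp_notMem _ rfl)
  | ts i => exact absurd hl' (hC.smp_notMem _ rfl)
  | tp i => exact absurd hl' (hC.smp_notMem _ rfl)
  | zs j => exact Or.inl ⟨j, (hC.zs_mem j).1 hl', rfl⟩
  | zp i => exact Or.inr (Or.inl ⟨i, (hC.zp_mem i).1 hl', rfl⟩)
  | ys i =>
    refine Or.inr (Or.inr ?_)
    rw [count_expand, hC.count, if_pos hl']
    rfl

theorem zp_mem {i : ℕ} (hi : i < 2 * n) : zp i ∈ primes 0 n ∨ zp i ∈ primes n n := by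
  rw [zp_mem_primes, zp_mem_primes]
  omega

theorem zp_mem_one (X : List Alph) {i : ℕ} (hi : i < 2 * n) :
    one (zp i) ∈ (primes 0 n).map one ++ (X ++ midOne n) := by
  rcases zp_mem hi with h | h <;> simp [midOne, h]

theorem zp_mem_two (X Y : List Alph) {i : ℕ} (hi : i < 2 * n) :
    two (zp i) ∈ ((primes 0 n).map one ++ (X ++ (midOne n ++ [one x]))) ++ (Y ++ midTwo n C) := by
  rcases zp_mem hi with h | h <;> simp [midOne, midTwo, h]

theorem zs_mem_endOne {j : ℕ} (hj : j < m) : one (zs j) ∈ endOne n m C := by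
  simp [endOne, zs_mem_tailW, hj]

theorem two_le_count {α : Type} [DecidableEq α] {A M B : List α} {ξ η g : α} (hg : g ∈ M)
    (h : g ∈ A ∨ g ∈ B ∨ 2 ≤ M.count g) : 2 ≤ (A ++ ξ :: (M ++ η :: B)).count g := by
  have h1 := List.count_pos_iff.2 hg
  have h2 : (A ++ ξ :: (M ++ η :: B)).count g =
      A.count g + ([ξ].count g + (M.count g + ([η].count g + B.count g))) := by
    rw [← List.count_append, ← List.count_append, ← List.count_append, ← List.count_append]
    rfl
  rcases h with h | h | h
  · have := List.count_pos_iff.2 h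
    omega
  · have := List.count_pos_iff.2 h
    omega
  · omega

variable (hC : Core n m C)
include hC

/-- A `zs` recurs in the tail, a `zp` occurs in the head, a square is doubled inside the segment,
and the letters of `Y` recur in the second copy. -/
theorem two_le_count_one {X Y : List Alph} (hY : ∀ g ∈ Y, g = two x ∨ g = two y) :
    ∀ g ∈ Y ++ (expand stdExp C).map one, 2 ≤ (bigWord n m C X Y).count g := by
  intro g hg
  rw [bigWord_split_one]
  refine two_le_count hg ?_
  rcases List.mem_append.1 hg with hg | hg
  · refine Or.inr (Or.inl ?_)
    rcases hY g hg with rfl | rfl <;> simp [endOne]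
  · obtain ⟨l, hl, rfl⟩ := List.mem_map.1 hg
    rcases hC.cases_of_mem_expand hl with ⟨j, hj, rfl⟩ | ⟨i, hi, rfl⟩ | h
    · exact Or.inr (Or.inl (zs_mem_endOne hj))
    · exact Or.inl (zp_mem_one X hi)
    · refine Or.inr (Or.inr ?_)
      rw [List.count_append, List.count_map_of_injective _ _ one_injective]
      omega

theorem two_le_count_two {X Y : List Alph} :
    ∀ g ∈ dd :: cc :: (expand stdExp C).map two, 2 ≤ (bigWord n m C X Y).count g := by
  intro g hg
  rw [bigWord_split_two]
  refine two_le_count hg ?_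
  rcases List.mem_cons.1 hg with rfl | hg
  · exact Or.inr (Or.inl (by simp))
  rcases List.mem_cons.1 hg with rfl | hg
  · exact Or.inl (by simp [midOne])
  · obtain ⟨l, hl, rfl⟩ := List.mem_map.1 hg
    rcases hC.cases_of_mem_expand hl with ⟨j, hj, rfl⟩ | ⟨i, hi, rfl⟩ | h
    · exact Or.inr (Or.inl (by simp [zs_mem_tailW, hj]))
    · exact Or.inl (zp_mem_two X Y hi)
    · refine Or.inr (Or.inr ?_)
      rw [List.count_cons, List.count_cons, List.count_map_of_injective _ _ two_injective]
      omega

end Pairs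

/-! ### Letters whose images cover the segment between x and y -/

section Cover

variable {n m : ℕ} {C : List Letter} (hC : Core n m C) {v : List Alph} (hv : v ∈ Similar n m C)
  {φ : Alph → List Alph} {pre post A M B : List Alph} {ξ η : Alph}
  (hu : v = pre ++ ((A ++ ξ :: (M ++ η :: B)).flatMap φ ++ post))

/-- Exactly one occurrence of `p` lies in the image of `M`, so a covering letter occurs once in `M`;
this excludes squares. If that occurrence is the first one (c = 0), the covering letter cannot occur
in `A`; if it is the second one (c = 1), it cannot occur in `B`. -/
theorem exists_mem_image {v : List Alph} {φ : Alph → List Alph} {pre post A M B : List Alph}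
    {ξ η p : Alph} (hu : v = pre ++ ((A ++ ξ :: (M ++ η :: B)).flatMap φ ++ post))
    (hp : v.count p = 2) (hξ : p ∉ φ ξ) (hη : p ∉ φ η) {c : ℕ}
    (h1 : (pre ++ A.flatMap φ).count p = c)
    (h2 : (pre ++ A.flatMap φ ++ φ ξ ++ M.flatMap φ ++ φ η).count p = c + 1) :
    ∃ g ∈ M, p ∈ φ g ∧ M.count g = 1 ∧ (c = 0 → g ∉ A) ∧ (c = 1 → g ∉ B) := by
  have e1 := List.count_eq_zero.2 hξ
  have e2 := List.count_eq_zero.2 hη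
  rw [hu] at hp
  simp only [List.flatMap_append, List.flatMap_cons, List.count_append] at hp h1 h2
  obtain ⟨g, hg, hpg⟩ := List.mem_flatMap.1
    (List.count_pos_iff.1 (by omega : 0 < (M.flatMap φ).count p))
  have e3 := count_le_count_flatMap (L := M) hpg
  have e4 := count_le_count_flatMap (L := A) hpg
  have e5 := count_le_count_flatMap (L := B) hpg
  have e6 := List.count_pos_iff.2 hg
  refine ⟨g, hg, hpg, by omega, fun hc h => ?_, fun hc h => ?_⟩
  · have := List.count_pos_iff.2 h
    omega
  · have := List.count_pos_iff.2 h
    omega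

include hC hv hu

/-- The projections xxpp and ypyp put the first occurrence of `p` between the second x and the
second y. -/
theorem exists_image_of_one (hξA : ξ ∈ A) (hηA : η ∈ A) (hξ : φ ξ = [one x])
    (hη : φ η = [one y]) {p : Alph} (hp : p = two x ∨ p = two y ∨ ∃ j < m, p = one (zs j)) :
    ∃ g ∈ M, p ∈ φ g ∧ M.count g = 1 ∧ g ∉ A := by
  obtain ⟨e1, h1⟩ := exists_hasCopy_one hC hv
  obtain ⟨e2, h2⟩ := exists_hasCopy_two hC hv
  have hpx : p ≠ one x := by rcases hp with rfl | rfl | ⟨j, -, rfl⟩ <;> simp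
  have hpy : p ≠ one y := by rcases hp with rfl | rfl | ⟨j, -, rfl⟩ <;> simp
  have cp : v.count p = 2 := by
    rcases hp with rfl | rfl | ⟨j, hj, rfl⟩
    · exact h2.count_x hC
    · exact h2.count_y hC
    · exact h1.count_zs hC hj
  have fx : filter2 (one x) p v = [one x, one x, p, p] := by
    rcases hp with rfl | rfl | ⟨j, hj, rfl⟩
    · exact filter2_one_x_two_x hC hv
    · exact filter2_one_x_two_y hC hv
    · exact h1.filter2_x_zs hC hj
  have fy : filter2 (one y) p v = [one y, p, one y, p] := by
    rcases hp with rfl | rfl | ⟨j, hj, rfl⟩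
    · exact filter2_one_y_two_x hC hv
    · exact filter2_one_y_two_y hC hv
    · exact h1.filter2_y_zs hC hj
  have hv1 : v = (pre ++ A.flatMap φ) ++ (φ ξ ++ (M.flatMap φ ++ (φ η ++ (B.flatMap φ ++ post)))) := by
    rw [hu]
    simp [List.flatMap_append, List.flatMap_cons]
  have hv2 : v = (pre ++ A.flatMap φ ++ φ ξ ++ M.flatMap φ) ++ (φ η ++ (B.flatMap φ ++ post)) := by
    rw [hv1]
    simp
  have hv3 : v = (pre ++ A.flatMap φ ++ φ ξ ++ M.flatMap φ ++ φ η) ++ (B.flatMap φ ++ post) := by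
    rw [hv1]
    simp
  have cx := h1.count_x hC
  have cy := h1.count_y hC
  have ax := count_le_count_flatMap (L := A) (show one x ∈ φ ξ by simp [hξ])
  have ay := count_le_count_flatMap (L := A) (show one y ∈ φ η by simp [hη])
  have aξ := List.count_pos_iff.2 hξA
  have aη := List.count_pos_iff.2 hηA
  have a1 := counts_aabb hpx.symm fx hv1
  have a2 := counts_abab hpy.symm fy hv2
  have a3 := counts_abab hpy.symm fy hv3
  rw [hv1] at cx cy
  have b1 : (φ ξ).count (one x) = 1 := by simp [hξ]
  have b2 : (φ η).count (one y) = 1 := by simp [hη]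
  have b3 : (φ η).count p = 0 := by
    rw [hη]
    exact List.count_eq_zero.2 (by simpa using hpy)
  simp only [List.count_append] at cx cy a1 a2 a3
  obtain ⟨g, h3, h4, h5, h6, -⟩ := exists_mem_image hu cp (by simpa [hξ] using hpx)
    (by simpa [hη] using hpy) (c := 0) (by simp only [List.count_append]; omega)
    (by simp only [List.count_append]; omega)
  exact ⟨g, h3, h4, h5, h6 rfl⟩

/-- Dual to `exists_image_of_one`: here the second occurrence of `p` lies between the second x and
the second y. -/
theorem exists_image_of_two (hξA : ξ ∈ A) (hηA : η ∈ A) (hξ : φ ξ = [two x])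
    (hη : φ η = [two y]) {p : Alph} (hp : p = cc ∨ ∃ i < 2 * n, p = two (zp i)) :
    ∃ g ∈ M, p ∈ φ g ∧ M.count g = 1 ∧ g ∉ B := by
  obtain ⟨e1, h1⟩ := exists_hasCopy_one hC hv
  obtain ⟨e2, h2⟩ := exists_hasCopy_two hC hv
  have hpx : p ≠ two x := by rcases hp with rfl | ⟨j, -, rfl⟩ <;> simp
  have hpy : p ≠ two y := by rcases hp with rfl | ⟨j, -, rfl⟩ <;> simp
  have hv1 : v = (pre ++ A.flatMap φ) ++ (φ ξ ++ (M.flatMap φ ++ (φ η ++ (B.flatMap φ ++ post)))) := by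
    rw [hu]
    simp [List.flatMap_append, List.flatMap_cons]
  have hv2 : v = (pre ++ A.flatMap φ ++ φ ξ) ++ (M.flatMap φ ++ (φ η ++ (B.flatMap φ ++ post))) := by
    rw [hv1]
    simp
  have hv3 : v = (pre ++ A.flatMap φ ++ φ ξ ++ M.flatMap φ ++ φ η) ++ (B.flatMap φ ++ post) := by
    rw [hv1]
    simp
  have cx := h2.count_x hC
  have cy := h2.count_y hC
  have ax := count_le_count_flatMap (L := A) (show two x ∈ φ ξ by simp [hξ])
  have ay := count_le_count_flatMap (L := A) (show two y ∈ φ η by simp [hη])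
  have aξ := List.count_pos_iff.2 hξA
  have aη := List.count_pos_iff.2 hηA
  have b1 : (φ ξ).count (two x) = 1 := by simp [hξ]
  have b2 : (φ η).count (two y) = 1 := by simp [hη]
  have cx' := cx
  have cy' := cy
  rw [hv1] at cx' cy'
  simp only [List.count_append] at cx' cy'
  have d1 : (pre ++ A.flatMap φ).count (two x) = 1 := by
    simp only [List.count_append]
    omega
  have d2 : (pre ++ A.flatMap φ ++ φ ξ).count (two x) = 2 := by
    rw [List.count_append]
    omega
  have d3 : (pre ++ A.flatMap φ ++ φ ξ ++ M.flatMap φ ++ φ η).count (two y) = 2 := by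
    simp only [List.count_append]
    omega
  have b3 : (φ ξ).count p = 0 := by
    rw [hξ]
    exact List.count_eq_zero.2 (by simpa using hpx)
  have mono : ∀ p, (pre ++ A.flatMap φ ++ φ ξ ++ M.flatMap φ ++ φ η).count p ≤ v.count p := by
    intro p
    exact (List.IsPrefix.sublist ⟨_, hv3.symm⟩).count_le p
  have main : v.count p = 2 ∧ (pre ++ A.flatMap φ).count p = 1 ∧
      (pre ++ A.flatMap φ ++ φ ξ ++ M.flatMap φ ++ φ η).count p = 2 := by
    rcases hp with rfl | ⟨i, hi, rfl⟩
    · have cp : v.count cc = 2 := by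
        have := congrArg (List.count cc) (filter2_cc_h hC hv)
        rw [count_filter2_left] at this
        simpa using this
      -- The simple letter `tp (2 * n - 1)` of the first copy precedes every `two x` and separates
      -- the two occurrences of `cc`.
      have low : 1 ≤ (pre ++ A.flatMap φ).count cc := by
        have hg : one (tp (2 * n - 1)) ∈ pre ++ A.flatMap φ := by
          by_contra hg
          have hm : one (tp (2 * n - 1)) ∈ v := by
            rw [← List.count_pos_iff, ← count_filter2_right cc, filter2_cc_g hC hv]
            simp
          rw [hv1] at hm
          obtain ⟨L, R, hLR⟩ := List.append_of_mem ((List.mem_append.1 hm).resolve_left hg)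
          refine at_aft_of_filter2 (by simp) (filter2_two_x_g hC hv) ((pre ++ A.flatMap φ) ++ L) R
            (by rw [hv1, hLR]; simp) ?_
          exact List.mem_append_left _ (List.count_pos_iff.1 (by omega))
        obtain ⟨L, R, hLR⟩ := List.append_of_mem hg
        have := (at_str_of_filter2 (by simp) (filter2_cc_g hC hv) L (R ++ (φ ξ ++ (M.flatMap φ ++
          (φ η ++ (B.flatMap φ ++ post))))) (by rw [hv1, hLR]; simp)).1
        rw [hLR, List.count_append]
        omega
      -- Both `two x` precede `dd`, and the first `dd` precedes the second `cc`; so only one `cc`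
      -- comes before the second `two x`. This is the purpose of `dd`. The letter `zs 0` then places
      -- the second `cc` before the second `two y`.
      have a1 := counts_aabb (by simp) (filter2_two_x_dd hC hv) hv1
      have a2 := counts_abab (by simp) (filter2_cc_dd hC hv) hv1
      have a3 := counts_aabb (by simp) (filter2_cc_two_zs hC hv hC.m_pos) hv3
      have a4 := counts_abab (h2.inj.ne (by simp)) (h2.filter2_y_zs hC hC.m_pos) hv3
      have a5 := mono cc
      omega
    · have cp := h2.count_zp hC hi
      have fx := h2.eq x (zp i) (by simp) (by simp)
      have fy := h2.eq y (zp i) (by simp) (by simp)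
      rw [hC.filter2_x_zp h2.adm hi] at fx
      rw [hC.filter2_y_zp h2.adm hi] at fy
      have a5 := mono (two (zp i))
      have hS2 : (pre ++ A.flatMap φ ++ φ ξ).count (two (zp i)) =
          (pre ++ A.flatMap φ).count (two (zp i)) := by
        rw [List.count_append, b3, add_zero]
      split_ifs at fx fy with h
      · rw [filter2_comm] at fx fy
        have a1 := counts_abba (by simp) (p := two (zp i)) (q := two x) fx hv1
        have a2 := counts_abab (by simp) (p := two (zp i)) (q := two y) fy hv3
        omega
      · have a1 := counts_abab (by simp) (p := two x) (q := two (zp i)) fx hv1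
        have a1' := counts_abab (by simp) (p := two x) (q := two (zp i)) fx hv2
        have a2 := counts_abba (by simp) (p := two y) (q := two (zp i)) fy hv3
        omega
  obtain ⟨g, h3, h4, h5, -, h6⟩ := exists_mem_image hu main.1 (by simpa [hξ] using hpx)
    (by simpa [hη] using hpy) main.2.1 main.2.2
  exact ⟨g, h3, h4, h5, h6 rfl⟩

end Cover

/-! ### Pigeonhole arguments for the images of the two pairs -/

section Cases

variable {n m : ℕ} {C : List Letter} (hC : Core n m C) {v : List Alph} (hv : v ∈ Similar n m C)
  {φ : Alph → List Alph} {pre post X Y : List Alph}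
  (hX : X = [one x, one y] ∨ X = [one y, one x]) (hY : Y = [two x, two y] ∨ Y = [two y, two x])
  (hu : v = pre ++ ((bigWord n m C X Y).flatMap φ ++ post))

theorem Core.mem_expand_zp (hC : Core n m C) {i : ℕ} (hi : i < 2 * n) :
    zp i ∈ expand stdExp C := by
  rw [← List.count_pos_iff, hC.count_expand_C adm_stdExp ((hC.zp_mem i).2 hi) rfl]
  exact Nat.one_pos

theorem Core.mem_expand_zs (hC : Core n m C) {j : ℕ} (hj : j < m) :
    zs j ∈ expand stdExp C := by
  rw [← List.count_pos_iff, hC.count_expand_C adm_stdExp ((hC.zs_mem j).2 hj) rfl]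
  exact Nat.one_pos

theorem card_insert_insert_image (m : ℕ) :
    (insert (two x) (insert (two y) ((Finset.range m).image fun j => one (zs j)))).card = m + 2 := by
  rw [Finset.card_insert_of_notMem (by simp), Finset.card_insert_of_notMem (by simp),
    Finset.card_image_of_injective _ fun i j h => by simpa using h, Finset.card_range]

include hC hv hX hY hu

/-- The letters `cc` and `two (zp i)`, 2n + 1 in all, must be covered by letters of the first
segment that do not occur later and are not squares: only the 2n letters `one (zp i)`. -/
theorem not_image_one_eq_two (h1 : φ (one x) = [two x]) (h2 : φ (one y) = [two y]) : False := by
  have hYm : ∀ g ∈ Y, g = two x ∨ g = two y := by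
    rcases hY with rfl | rfl <;> simp [or_comm]
  have hu' := hu
  rw [bigWord_split_one] at hu'
  have key := card_le_card_of_forall_mem (φ := φ)
    (S := insert cc ((Finset.range (2 * n)).image fun i => two (zp i)))
    (G := (Finset.range (2 * n)).image fun i => one (zp i)) ?_ ?_
  · rw [Finset.card_insert_of_notMem (by simp),
      Finset.card_image_of_injective _ fun i j h => by simpa using h,
      Finset.card_image_of_injective _ fun i j h => by simpa using h, Finset.card_range] at key
    omega
  · intro p hp
    obtain ⟨g, hg, hpg, hg1, hgB⟩ := exists_image_of_two hC hv hu'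
      (by rcases hX with rfl | rfl <;> simp) (by rcases hX with rfl | rfl <;> simp) h1 h2 (p := p)
      (by
        simp only [Finset.mem_insert, Finset.mem_image, Finset.mem_range] at hp
        rcases hp with rfl | ⟨i, hi, rfl⟩
        · exact Or.inl rfl
        · exact Or.inr ⟨i, hi, rfl⟩)
    refine ⟨g, ?_, hpg⟩
    rcases List.mem_append.1 hg with h | h
    · exact absurd (by rcases hYm g h with rfl | rfl <;> simp [endOne]) hgB
    · obtain ⟨l, hl, rfl⟩ := List.mem_map.1 h
      rcases hC.cases_of_mem_expand hl with ⟨j, hj, rfl⟩ | ⟨i, hi, rfl⟩ | h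
      · exact absurd (zs_mem_endOne hj) hgB
      · simpa using hi
      · rw [List.count_append, List.count_map_of_injective _ _ one_injective] at hg1
        omega
  · intro g hg
    simp only [Finset.mem_image, Finset.mem_range] at hg
    obtain ⟨i, hi, rfl⟩ := hg
    exact eq_of_mem_image hC hv hu (two_le_count_one hC hYm _ (by simp [hC.mem_expand_zp hi]))

/-- Now m + 2 letters must be covered by letters that begin in the second segment and are not
squares: only `dd` and the m letters `two (zs j)`. -/
theorem not_image_two_eq_one (h1 : φ (two x) = [one x]) (h2 : φ (two y) = [one y]) : False := by
  have hu' := hu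
  rw [bigWord_split_two] at hu'
  have key := card_le_card_of_forall_mem (φ := φ)
    (S := insert (two x) (insert (two y) ((Finset.range m).image fun j => one (zs j))))
    (G := insert dd ((Finset.range m).image fun j => two (zs j))) ?_ ?_
  · rw [card_insert_insert_image] at key
    have h3 := Finset.card_insert_le dd ((Finset.range m).image fun j => two (zs j))
    have h4 := Finset.card_image_le (s := Finset.range m) (f := fun j => two (zs j))
    rw [Finset.card_range] at h4
    omega
  · intro p hp
    obtain ⟨g, hg, hpg, hg1, hgA⟩ := exists_image_of_one hC hv hu'
      (by rcases hY with rfl | rfl <;> simp) (by rcases hY with rfl | rfl <;> simp) h1 h2 (p := p)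
      (by
        simp only [Finset.mem_insert, Finset.mem_image, Finset.mem_range] at hp
        rcases hp with rfl | rfl | ⟨i, hi, rfl⟩
        · exact Or.inl rfl
        · exact Or.inr (Or.inl rfl)
        · exact Or.inr (Or.inr ⟨i, hi, rfl⟩))
    refine ⟨g, ?_, hpg⟩
    rcases List.mem_cons.1 hg with rfl | hg
    · simp
    rcases List.mem_cons.1 hg with rfl | hg
    · exact absurd (by simp [midOne]) hgA
    obtain ⟨l, hl, rfl⟩ := List.mem_map.1 hg
    rcases hC.cases_of_mem_expand hl with ⟨j, hj, rfl⟩ | ⟨i, hi, rfl⟩ | h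
    · simpa using hj
    · exact absurd (zp_mem_two X Y hi) hgA
    · rw [List.count_cons, List.count_cons, List.count_map_of_injective _ _ two_injective] at hg1
      omega
  · intro g hg
    simp only [Finset.mem_insert, Finset.mem_image, Finset.mem_range] at hg
    rcases hg with rfl | ⟨i, hi, rfl⟩
    · exact eq_of_mem_image hC hv hu (two_le_count_two hC _ (by simp))
    · exact eq_of_mem_image hC hv hu (two_le_count_two hC _ (by simp [hC.mem_expand_zs hi]))

theorem commute_or_of_image_one :
    φ (one x) ++ φ (one y) = φ (one y) ++ φ (one x) ∨ φ (one x) = [one x] ∧ φ (one y) = [one y] := by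
  have hYm : ∀ g ∈ Y, g = two x ∨ g = two y := by
    rcases hY with rfl | rfl <;> simp [or_comm]
  rcases commute_or_of_image hC hv hu (bigWord_eq_one X Y) (by simp) hX (two_le_count_one hC hYm)
    with h | ⟨ι, rfl | rfl, h⟩
  · exact Or.inl h
  · exact Or.inr h
  · exact (not_image_one_eq_two hC hv hX hY hu h.1 h.2).elim

theorem commute_or_of_image_two :
    φ (two x) ++ φ (two y) = φ (two y) ++ φ (two x) ∨ φ (two x) = [two x] ∧ φ (two y) = [two y] := by
  rcases commute_or_of_image hC hv hu (bigWord_eq_two X Y) (by simp) hY (two_le_count_two hC)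
    with h | ⟨ι, rfl | rfl, h⟩
  · exact Or.inl h
  · exact (not_image_two_eq_one hC hv hX hY hu h.1 h.2).elim
  · exact Or.inr h

/-- The m + 2 letters that begin in the first segment must be covered by the images of the m letters
`one (zs j)`, of `two x` and of `two y`. If the last two images commuted, they would be powers of a
common letter, and at most m + 1 letters could be covered. -/
theorem image_two_eq_two (h1 : φ (one x) = [one x]) (h2 : φ (one y) = [one y]) :
    φ (two x) = [two x] ∧ φ (two y) = [two y] := by
  refine (commute_or_of_image_two hC hv hX hY hu).resolve_left fun hcomm => ?_
  have hYm : ∀ g, g ∈ Y ↔ g = two x ∨ g = two y := by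
    rcases hY with rfl | rfl <;> simp [or_comm]
  have sx := eq_of_mem_image hC hv hu (two_le_count_one hC (fun g => (hYm g).1) (two x)
    (by simp [hYm]))
  have sy := eq_of_mem_image hC hv hu (two_le_count_one hC (fun g => (hYm g).1) (two y)
    (by simp [hYm]))
  -- One letter `g0` stands for both `two x` and `two y`, since their commuting images involve at
  -- most one letter.
  obtain ⟨g0, hg0, hg0'⟩ : ∃ g0, (g0 = two x ∨ g0 = two y) ∧
      ∀ p, p ∈ φ (two x) ∨ p ∈ φ (two y) → p ∈ φ g0 := by
    by_cases hx0 : φ (two x) = []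
    · exact ⟨two y, Or.inr rfl, by simp [hx0]⟩
    by_cases hy0 : φ (two y) = []
    · exact ⟨two x, Or.inl rfl, by simp [hy0]⟩
    obtain ⟨p, hp⟩ := List.exists_mem_of_ne_nil _ hx0
    obtain ⟨q, hq⟩ := List.exists_mem_of_ne_nil _ hy0
    obtain ⟨k, hk⟩ := eq_replicate_of_forall_eq hp fun r hr => sx r hr p hp
    obtain ⟨l, hl⟩ := eq_replicate_of_forall_eq hq fun r hr => sy r hr q hq
    have hpq : p = q := by
      rw [hk, hl, List.replicate_succ, List.replicate_succ] at hcomm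
      simpa using congrArg List.head? hcomm
    subst hpq
    refine ⟨two x, Or.inl rfl, fun r hr => ?_⟩
    rcases hr with hr | hr
    · exact hr
    · rw [hl] at hr
      rw [List.eq_of_mem_replicate hr]
      exact hp
  have hu' := hu
  rw [bigWord_split_one] at hu'
  have key := card_le_card_of_forall_mem (φ := φ)
    (S := insert (two x) (insert (two y) ((Finset.range m).image fun j => one (zs j))))
    (G := insert g0 ((Finset.range m).image fun j => one (zs j))) ?_ ?_
  · rw [card_insert_insert_image] at key
    have h3 := Finset.card_insert_le g0 ((Finset.range m).image fun j => one (zs j))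
    have h4 := Finset.card_image_le (s := Finset.range m) (f := fun j => one (zs j))
    rw [Finset.card_range] at h4
    omega
  · intro p hp
    obtain ⟨g, hg, hpg, hg1, hgA⟩ := exists_image_of_one hC hv hu'
      (by rcases hX with rfl | rfl <;> simp) (by rcases hX with rfl | rfl <;> simp) h1 h2 (p := p)
      (by
        simp only [Finset.mem_insert, Finset.mem_image, Finset.mem_range] at hp
        rcases hp with rfl | rfl | ⟨i, hi, rfl⟩
        · exact Or.inl rfl
        · exact Or.inr (Or.inl rfl)
        · exact Or.inr (Or.inr ⟨i, hi, rfl⟩))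
    rcases List.mem_append.1 hg with h | h
    · refine ⟨g0, by simp, hg0' p ?_⟩
      rcases (hYm g).1 h with rfl | rfl
      · exact Or.inl hpg
      · exact Or.inr hpg
    · refine ⟨g, ?_, hpg⟩
      obtain ⟨l, hl, rfl⟩ := List.mem_map.1 h
      rcases hC.cases_of_mem_expand hl with ⟨j, hj, rfl⟩ | ⟨i, hi, rfl⟩ | h
      · simp [hj]
      · exact absurd (zp_mem_one X hi) hgA
      · rw [List.count_append, List.count_map_of_injective _ _ one_injective] at hg1
        omega
  · intro g hg
    simp only [Finset.mem_insert, Finset.mem_image, Finset.mem_range] at hg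
    rcases hg with rfl | ⟨i, hi, rfl⟩
    · rcases hg0 with rfl | rfl
      · exact sx
      · exact sy
    · exact eq_of_mem_image hC hv hu (two_le_count_one hC (fun g => (hYm g).1) _
        (by simp [hC.mem_expand_zs hi]))

end Cases

/-! ### The two languages and their closure properties -/

section Languages

variable {n m : ℕ} {C : List Letter}

theorem flatMap_bigWord_congr {β : Type} {φ : Alph → List β} {X X' Y Y' : List Alph}
    (hX : X.flatMap φ = X'.flatMap φ) (hY : Y.flatMap φ = Y'.flatMap φ) :
    (bigWord n m C X Y).flatMap φ = (bigWord n m C X' Y').flatMap φ := by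
  simp [bigWord, List.flatMap_append, List.flatMap_cons, hX, hY]

theorem mem_similar_congr {v v' : List Alph} (h : ∀ ψ : Alph → List Letter,
    ψ (one x) ++ ψ (one y) = ψ (one y) ++ ψ (one x) →
    ψ (two x) ++ ψ (two y) = ψ (two y) ++ ψ (two x) → v.flatMap ψ = v'.flatMap ψ) :
    v ∈ Similar n m C ↔ v' ∈ Similar n m C := by
  constructor
  · intro hv ψ pre post h1 h2 h3
    rw [← h ψ h1 h2]
    exact hv ψ pre post h1 h2 h3
  · intro hv ψ pre post h1 h2 h3
    rw [h ψ h1 h2]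
    exact hv ψ pre post h1 h2 h3

theorem bigWord_mem_similar {X Y : List Alph} (hX : X = [one x, one y] ∨ X = [one y, one x])
    (hY : Y = [two x, two y] ∨ Y = [two y, two x]) : bigWord n m C X Y ∈ Similar n m C := by
  intro ψ pre post h1 h2 h3
  rw [flatMap_bigWord_congr (X' := [one x, one y]) (Y' := [two x, two y])]
  · exact h3
  · rcases hX with rfl | rfl <;> simp [List.flatMap_cons, h1]
  · rcases hY with rfl | rfl <;> simp [List.flatMap_cons, h2]

/-- The words whose second copy is not the standard one. -/
def langA (n m : ℕ) (C : List Letter) : Set (List Alph) :=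
  {v | v ∈ Similar n m C ∧ v.flatMap snd ∉ shapeClass n m C}

/-- The words whose first copy is the standard one. -/
def langB (n m : ℕ) (C : List Letter) : Set (List Alph) :=
  {v | v ∈ Similar n m C ∧ v.flatMap fst ∈ shapeClass n m C}

theorem filter2_of_mem_shapeClass (hC : Core n m C) {w : List Letter}
    (hw : w ∈ shapeClass n m C) : filter2 x y w = [x, y, x, y] := by
  obtain ⟨e, he, rfl⟩ := hw
  exact hC.filter2_x_y he

variable (hC : Core n m C) {φ : Alph → List Alph} {pre post X X' Y Y' : List Alph}
  (hX : X = [one x, one y] ∨ X = [one y, one x]) (hY : Y = [two x, two y] ∨ Y = [two y, two x])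
  (hX' : X' = [one x, one y] ∨ X' = [one y, one x])
  (hY' : Y' = [two x, two y] ∨ Y' = [two y, two x])
include hC hX hY

-- The swap of the first pair is invisible to every `ψ` whose images of `one x` and `one y` commute,
-- because φ either makes the pair commute or fixes it. The projection `snd` is such a `ψ`.
include hX' in
theorem mem_langA_of_mem
    (h : pre ++ ((bigWord n m C X Y).flatMap φ ++ post) ∈ langA n m C) :
    pre ++ ((bigWord n m C X' Y).flatMap φ ++ post) ∈ langA n m C := by
  have key : ∀ ψ : Alph → List Letter, ψ (one x) ++ ψ (one y) = ψ (one y) ++ ψ (one x) →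
      (pre ++ ((bigWord n m C X Y).flatMap φ ++ post)).flatMap ψ =
      (pre ++ ((bigWord n m C X' Y).flatMap φ ++ post)).flatMap ψ := by
    intro ψ hψ
    have hc : X.flatMap (fun g => (φ g).flatMap ψ) = X'.flatMap (fun g => (φ g).flatMap ψ) := by
      have : (φ (one x)).flatMap ψ ++ (φ (one y)).flatMap ψ =
          (φ (one y)).flatMap ψ ++ (φ (one x)).flatMap ψ := by
        rcases commute_or_of_image_one hC h.1 hX hY rfl with h1 | ⟨h1, h2⟩
        · rw [← List.flatMap_append, h1, List.flatMap_append]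
        · simpa [h1, h2] using hψ
      rcases hX with rfl | rfl <;> rcases hX' with rfl | rfl <;> simp [List.flatMap_cons, this]
    simp only [List.flatMap_append, List.flatMap_assoc]
    rw [flatMap_bigWord_congr hc rfl]
  refine ⟨(mem_similar_congr fun ψ h1 _ => key ψ h1).1 h.1, ?_⟩
  rw [← key snd rfl]
  exact h.2

-- The same argument for the second pair, with `fst` in place of `snd`.
include hY' in
theorem mem_langB_of_mem
    (h : pre ++ ((bigWord n m C X Y).flatMap φ ++ post) ∈ langB n m C) :
    pre ++ ((bigWord n m C X Y').flatMap φ ++ post) ∈ langB n m C := by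
  have key : ∀ ψ : Alph → List Letter, ψ (two x) ++ ψ (two y) = ψ (two y) ++ ψ (two x) →
      (pre ++ ((bigWord n m C X Y).flatMap φ ++ post)).flatMap ψ =
      (pre ++ ((bigWord n m C X Y').flatMap φ ++ post)).flatMap ψ := by
    intro ψ hψ
    have hc : Y.flatMap (fun g => (φ g).flatMap ψ) = Y'.flatMap (fun g => (φ g).flatMap ψ) := by
      have : (φ (two x)).flatMap ψ ++ (φ (two y)).flatMap ψ =
          (φ (two y)).flatMap ψ ++ (φ (two x)).flatMap ψ := by
        rcases commute_or_of_image_two hC h.1 hX hY rfl with h1 | ⟨h1, h2⟩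
        · rw [← List.flatMap_append, h1, List.flatMap_append]
        · simpa [h1, h2] using hψ
      rcases hY with rfl | rfl <;> rcases hY' with rfl | rfl <;> simp [List.flatMap_cons, this]
    simp only [List.flatMap_append, List.flatMap_assoc]
    rw [flatMap_bigWord_congr rfl hc]
  refine ⟨(mem_similar_congr fun ψ _ h2 => key ψ h2).1 h.1, ?_⟩
  rw [← key fst rfl]
  exact h.2

end Languages

theorem filter2_eq_of_two_occurrences {α : Type} [DecidableEq α] {p q : α} (hpq : p ≠ q)
    {v a b c d : List α} (hv : v = a ++ p :: q :: (b ++ p :: (c ++ q :: d)))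
    (hp : v.count p = 2) (hq : v.count q = 2) : filter2 p q v = [p, q, p, q] := by
  subst hv
  simp only [List.count_append, List.count_cons, beq_self_eq_true, beq_iff_eq, hpq, hpq.symm,
    if_true, if_false] at hp hq
  have z : ∀ L : List α, L.count p = 0 → L.count q = 0 → filter2 p q L = [] := fun L h1 h2 =>
    filter2_eq_nil (List.count_eq_zero.1 h1) (List.count_eq_zero.1 h2)
  simp only [filter2_append, filter2_cons, true_or, or_true, if_true]
  rw [z a (by omega) (by omega), z b (by omega) (by omega), z c (by omega) (by omega),
    z d (by omega) (by omega)]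
  rfl

/-! ### Assembly of the pentagon -/

section Final

variable {n m : ℕ} {C : List Letter}

/-- Otherwise φ fixes x and y of both copies. The second copy in the word then has x before y at
first occurrence too, so all its two-letter projections are standard, contrary to `langA`. -/
theorem commute_of_mem_langA (hC : Core n m C) {φ : Alph → List Alph}
    {pre post X : List Alph} (hX : X = [one x, one y] ∨ X = [one y, one x])
    (h : pre ++ ((bigWord n m C X [two x, two y]).flatMap φ ++ post) ∈ langA n m C) :
    φ (one x) ++ φ (one y) = φ (one y) ++ φ (one x) := by
  refine (commute_or_of_image_one hC h.1 hX (Or.inl rfl) rfl).resolve_right ?_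
  rintro ⟨h1, h2⟩
  obtain ⟨h3, h4⟩ := image_two_eq_two hC h.1 hX (Or.inl rfl) rfl h1 h2
  refine h.2 ?_
  have hv := h.1
  obtain ⟨e, he⟩ := exists_hasCopy_two hC hv
  have cx := he.count_x hC
  have cy := he.count_y hC
  have hxy : filter2 (two x) (two y) (pre ++ ((bigWord n m C X [two x, two y]).flatMap φ ++ post)) =
      [two x, two y, two x, two y] := by
    refine filter2_eq_of_two_occurrences (by simp) ?_ cx cy
      (a := pre ++ ((primes 0 n).map one ++ (X ++ (midOne n ++ [one x]))).flatMap φ)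
      (b := (midTwo n C).flatMap φ)
      (c := (dd :: cc :: (expand stdExp C).map two).flatMap φ)
      (d := ((tailW m).map two ++ ((tailW m).map one ++ [dd])).flatMap φ ++ post)
    rw [bigWord_eq_two]
    simp [List.flatMap_append, List.flatMap_cons, h3, h4]
  refine ⟨e, he.adm, eq_of_filter2_eq fun p q => ?_⟩
  have proj : ∀ (w : List Alph) (p q : Letter),
      (filter2 p q (w.flatMap snd)).map two = filter2 (two p) (two q) w := by
    intro w p q
    induction w with
    | nil => rfl
    | cons g w ih =>
      rw [List.flatMap_cons, filter2_append, List.map_append, ih, filter2_cons]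
      rcases g with l | l | _ | _
      · simp [snd]
      · simp only [snd, filter2_cons, Alph.two.injEq]
        split_ifs <;> simp
      · simp [snd]
      · simp [snd]
  apply List.map_injective_iff.2 two_injective
  rw [proj]
  by_cases h5 : p = x ∧ q = y
  · rw [h5.1, h5.2, hxy, hC.filter2_x_y he.adm]
    rfl
  by_cases h6 : p = y ∧ q = x
  · rw [h6.1, h6.2, filter2_comm, hxy, filter2_comm, hC.filter2_x_y he.adm]
    rfl
  exact he.eq p q h5 h6

theorem toList_lift {Γ Δ : Type} (ψ : Γ → List Δ) (a : FreeMonoid Γ) :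
    (FreeMonoid.lift (fun g => FreeMonoid.ofList (ψ g)) a).toList = a.toList.flatMap ψ := by
  induction a using FreeMonoid.inductionOn' with
  | one => rfl
  | of_mul g a ih =>
    rw [map_mul, FreeMonoid.toList_mul, ih]
    rfl

/-- The image of `a` is a factor of the generating class, so it is not collapsed in the Rees
quotient; hence the image of `b` is `gamma'`-related to it. -/
theorem mem_shapeClass_of_satOver (hC : Core n m C) {e : Letter → ℕ} (he : Adm e)
    {a b : FreeMonoid Alph}
    (h : SatOver (MAlpha gamma'
      {((FreeMonoid.ofList (expand e (shape n m C [x, y])) : Word) : gamma'.Quotient)}) a b)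
    (ψ : Alph → List Letter) (pre post : List Letter)
    (ha : pre ++ (a.toList.flatMap ψ ++ post) ∈ shapeClass n m C) :
    pre ++ (b.toList.flatMap ψ ++ post) ∈ shapeClass n m C := by
  set W : Set gamma'.Quotient :=
    {((FreeMonoid.ofList (expand e (shape n m C [x, y])) : Word) : gamma'.Quotient)} with hW
  have key : ∀ c : FreeMonoid Alph, FreeMonoid.lift
      (fun g => (((FreeMonoid.ofList (ψ g) : Word) : gamma'.Quotient) : (reesCon W).Quotient)) c =
      (((FreeMonoid.ofList (c.toList.flatMap ψ) : Word) : gamma'.Quotient) :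
        (reesCon W).Quotient) := by
    intro c
    rw [← toList_lift]
    exact (FreeMonoid.hom_map_lift ((reesCon W).mk'.comp gamma'.mk') _ c).symm
  have h1 := h fun g => (((FreeMonoid.ofList (ψ g) : Word) : gamma'.Quotient) :
    (reesCon W).Quotient)
  rw [key, key, Con.eq] at h1
  have ha' := (hC.gamma'_iff he _).2 ha
  refine (hC.gamma'_iff he _).1 ?_
  rcases h1 with h1 | ⟨h1, -⟩
  · rw [Con.eq] at h1
    refine gamma'.trans ?_ ha'
    rw [FreeMonoid.ofList_append, FreeMonoid.ofList_append, FreeMonoid.ofList_append,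
      FreeMonoid.ofList_append]
    exact gamma'.mul (gamma'.refl _) (gamma'.mul (gamma'.symm h1) (gamma'.refl _))
  · refine absurd ⟨_, hW ▸ Set.mem_singleton _, ((FreeMonoid.ofList pre : Word) : gamma'.Quotient),
      ((FreeMonoid.ofList post : Word) : gamma'.Quotient), ?_⟩ h1
    rw [← Con.coe_mul, ← Con.coe_mul, ← FreeMonoid.ofList_append, ← FreeMonoid.ofList_append,
      List.append_assoc, eq_comm, Con.eq]
    exact ha'

theorem not_isModularLattice_varGamma' (hC : Core n m C) {e : Letter → ℕ} (he : Adm e) :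
    ¬ IsModularLattice
      (Set.Iic (varGamma' (FreeMonoid.ofList (expand e (shape n m C [x, y]))))) := by
  have apply : ∀ (φ : Alph → FreeMonoid Alph) (p s : FreeMonoid Alph) (L : List Alph),
      (p * FreeMonoid.lift φ (FreeMonoid.ofList L) * s).toList =
        p.toList ++ (L.flatMap (fun g => (φ g).toList) ++ s.toList) := by
    intro φ p s L
    rw [FreeMonoid.toList_mul, FreeMonoid.toList_mul, List.append_assoc]
    congr 2
    exact toList_lift (fun g => (φ g).toList) (FreeMonoid.ofList L)
  have hx : [one x, one y] = [one x, one y] ∨ [one x, one y] = [one y, one x] := Or.inl rfl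
  have hx' : [one y, one x] = [one x, one y] ∨ [one y, one x] = [one y, one x] := Or.inr rfl
  have hy : [two x, two y] = [two x, two y] ∨ [two x, two y] = [two y, two x] := Or.inl rfl
  have hy' : [two y, two x] = [two x, two y] ∨ [two y, two x] = [two y, two x] := Or.inr rfl
  have similar : ∀ {a b : FreeMonoid Alph}, SatOver (MAlpha gamma'
      {((FreeMonoid.ofList (expand e (shape n m C [x, y])) : Word) : gamma'.Quotient)}) a b →
      a.toList ∈ Similar n m C → b.toList ∈ Similar n m C := fun h ha ψ pre post h1 h2 h3 =>
    mem_shapeClass_of_satOver hC he h ψ pre post (ha ψ pre post h1 h2 h3)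
  have single : ∀ {a b : FreeMonoid Alph}, SatOver (MAlpha gamma'
      {((FreeMonoid.ofList (expand e (shape n m C [x, y])) : Word) : gamma'.Quotient)}) a b →
      ∀ ψ : Alph → List Letter, a.toList.flatMap ψ ∈ shapeClass n m C →
      b.toList.flatMap ψ ∈ shapeClass n m C := fun h ψ ha => by
    simpa using mem_shapeClass_of_satOver hC he h ψ [] [] (by simpa using ha)
  refine not_isModularLattice_of_languages (Γ := Alph) _
    {w | w.toList ∈ langA n m C} {w | w.toList ∈ langB n m C}
    (FreeMonoid.ofList (bigWord n m C [one x, one y] [two x, two y]))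
    (FreeMonoid.ofList (bigWord n m C [one x, one y] [two y, two x]))
    (FreeMonoid.ofList (bigWord n m C [one y, one x] [two x, two y]))
    (FreeMonoid.ofList (bigWord n m C [one y, one x] [two y, two x]))
    -- The condition on the second copy in `langA` is negative, so the identity is used in the
    -- reverse direction.
    (fun a b h ha => ⟨similar h ha.1, fun hb => ha.2 (single (fun ψ => (h ψ).symm) snd hb)⟩)
    (fun a b h ha => ⟨similar h ha.1, single h fst ha.2⟩) ?_ ?_ ?_ ?_ ?_ ?_ ?_
  · intro φ p s
    simp only [Set.mem_ofPred_eq, apply]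
    exact ⟨mem_langA_of_mem hC hx hy hx', mem_langA_of_mem hC hx' hy hx⟩
  · intro φ p s
    simp only [Set.mem_ofPred_eq, apply]
    exact ⟨mem_langA_of_mem hC hx hy' hx', mem_langA_of_mem hC hx' hy' hx⟩
  · intro φ p s
    simp only [Set.mem_ofPred_eq, apply]
    exact ⟨mem_langB_of_mem hC hx hy hy', mem_langB_of_mem hC hx hy' hy⟩
  · intro φ p s
    simp only [Set.mem_ofPred_eq, apply]
    exact ⟨mem_langB_of_mem hC hx' hy hy', mem_langB_of_mem hC hx' hy' hy⟩
  · intro φ p s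
    simp only [Set.mem_inter_iff, Set.mem_ofPred_eq, apply]
    -- Inside the intersection the images commute by `commute_of_mem_langA`, so applying u_00 ≈ u_10
    -- changes nothing at all.
    have eq : φ (one x) * φ (one y) = φ (one y) * φ (one x) →
        (bigWord n m C [one x, one y] [two x, two y]).flatMap (fun g => (φ g).toList) =
        (bigWord n m C [one y, one x] [two x, two y]).flatMap fun g => (φ g).toList := fun h =>
      flatMap_bigWord_congr (by simpa [List.flatMap_cons] using congrArg FreeMonoid.toList h) rfl
    constructor
    · intro h
      rwa [← eq (commute_of_mem_langA hC hx h.1)]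
    · intro h
      rwa [eq (commute_of_mem_langA hC hx' h.1)]
  · constructor
    · refine ⟨bigWord_mem_similar hx hy', fun h => ?_⟩
      have h := filter2_of_mem_shapeClass hC h
      rw [FreeMonoid.toList_ofList, snd_bigWord _ _ (by simp [snd])] at h
      simp [shape, snd, filter2_append, filter2_cons, filter2_eq_nil] at h
    · refine ⟨bigWord_mem_similar hx hy', ?_⟩
      rw [FreeMonoid.toList_ofList, fst_bigWord _ _ (by simp [fst])]
      exact ⟨stdExp, adm_stdExp, adm_stdExp.expand_shape_xy.symm⟩
  · rintro ⟨-, -, h⟩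
    have h := filter2_of_mem_shapeClass hC h
    rw [FreeMonoid.toList_ofList, fst_bigWord _ _ (by simp [fst])] at h
    simp [shape, fst, filter2_append, filter2_cons, filter2_eq_nil] at h

end Final

/-! ### The four families of words satisfy the common conditions -/

section Words

theorem prod_ofFn_ofList {α : Type} {k : ℕ} (g : Fin k → List α) :
    (List.ofFn fun i => FreeMonoid.ofList (g i)).prod =
      FreeMonoid.ofList (List.ofFn g).flatten := by
  induction k with
  | zero => rfl
  | succ k ih =>
    rw [List.ofFn_succ, List.ofFn_succ, List.prod_cons, ih, List.flatten_cons,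
      FreeMonoid.ofList_append]

theorem flatten_ofFn_primes (a k : ℕ) :
    (List.ofFn fun i : Fin k => [zp (a + i), tp (a + i)]).flatten = primes a k := by
  induction k with
  | zero => rfl
  | succ k ih =>
    rw [List.ofFn_succ', List.concat_eq_append, List.flatten_append, primes, ← ih]
    simp

theorem flatten_ofFn_tailW (k : ℕ) :
    (List.ofFn fun i : Fin k => [ts i, zs i]).flatten = tailW k := by
  induction k with
  | zero => rfl
  | succ k ih =>
    rw [List.ofFn_succ', List.concat_eq_append, List.flatten_append, tailW, ← ih]
    simp

theorem expand_flatten_ofFn {k : ℕ} (e : Letter → ℕ) (g : Fin k → List Letter) :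
    expand e (List.ofFn g).flatten = (List.ofFn fun i => expand e (g i)).flatten := by
  induction k with
  | zero => rfl
  | succ k ih =>
    rw [List.ofFn_succ, List.ofFn_succ, List.flatten_cons, List.flatten_cons, expand_append, ih]

theorem cHead_eq (n : ℕ) : cHead n =
    FreeMonoid.ofList (primes 0 n ++ ([x, y] ++ (t :: (primes n n ++ [x])))) := by
  have h1 := prod_ofFn_ofList fun i : Fin n => [zp (0 + i), tp (0 + i)]
  have h2 := prod_ofFn_ofList fun i : Fin n => [zp (n + i), tp (n + i)]
  rw [flatten_ofFn_primes] at h1 h2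
  simp only [zero_add] at h1
  have e : primes 0 n ++ ([x, y] ++ (t :: (primes n n ++ [x]))) =
      ((primes 0 n ++ [x, y, t]) ++ primes n n) ++ [x] := by simp
  rw [e, FreeMonoid.ofList_append, FreeMonoid.ofList_append, FreeMonoid.ofList_append, ← h1, ← h2]
  rfl

theorem cTail_eq (m : ℕ) : cTail m = FreeMonoid.ofList (tailW m) := by
  rw [← flatten_ofFn_tailW, ← prod_ofFn_ofList]
  rfl

/-- The common form of the words. -/
theorem eq_expand_shape {n m k : ℕ} {f : Fin k → Word} (g : Fin k → List Letter)
    (hf : ∀ i, f i = FreeMonoid.ofList (expand stdExp (g i))) (j : ℕ) :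
    cHead n * (List.ofFn f).prod * (ltr (zs j) * ltr y) * cTail m = FreeMonoid.ofList
      (expand stdExp (shape n m ((List.ofFn g).flatten ++ [zs j]) [x, y])) := by
  have hf' : f = fun i => FreeMonoid.ofList (expand stdExp (g i)) := funext hf
  rw [hf', prod_ofFn_ofList, ← expand_flatten_ofFn, cHead_eq, cTail_eq,
    adm_stdExp.expand_shape_xy, expand_append]
  have e : ∀ E : List Letter, shape n m (E ++ expand stdExp [zs j]) [x, y] =
      (((primes 0 n ++ ([x, y] ++ (t :: (primes n n ++ [x])))) ++ E) ++ [zs j, y]) ++ tailW m := by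
    intro E
    simp [shape, expand_cons, stdExp, sq]
  rw [e, FreeMonoid.ofList_append, FreeMonoid.ofList_append, FreeMonoid.ofList_append]
  rfl

/-- The middle block is a concatenation of disjoint blocks, each starting with a letter `zs`,
followed by one more `zs`; this supplies the end letters required by `Core`. -/
theorem core_of_blocks {n m k : ℕ} (hn : 1 ≤ n) (hk : 1 ≤ k) {g : Fin k → List Letter} {j : ℕ}
    (hnd : ∀ i, (g i).Nodup) (hdis : ∀ i i', i < i' → List.Disjoint (g i) (g i'))
    (hj : ∀ i, zs j ∉ g i) (hhead : ∀ i, ∃ a L, g i = zs a :: L)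
    (hmem : ∀ i, ∀ l ∈ g i, (∃ a < m, l = zs a) ∨ (∃ a < 2 * n, l = zp a) ∨ ∃ a, l = ys a)
    (hjm : j < m) (hzs : ∀ a < m, a ≠ j → ∃ i, zs a ∈ g i) (hzp : ∀ a < 2 * n, ∃ i, zp a ∈ g i) :
    Core n m ((List.ofFn g).flatten ++ [zs j]) := by
  have mem : ∀ l, l ∈ (List.ofFn g).flatten ++ [zs j] ↔ (∃ i, l ∈ g i) ∨ l = zs j := by
    intro l
    simp [List.mem_ofFn]
  have hmem' : ∀ l ∈ (List.ofFn g).flatten ++ [zs j],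
      (∃ a < m, l = zs a) ∨ (∃ a < 2 * n, l = zp a) ∨ ∃ a, l = ys a := by
    intro l hl
    rcases (mem l).1 hl with ⟨i, hi⟩ | rfl
    · exact hmem i l hi
    · exact Or.inl ⟨j, hjm, rfl⟩
  refine ⟨hn, ?_, fun a => ⟨fun h => ?_, fun h => ?_⟩, fun a => ⟨fun h => ?_, fun h => ?_⟩,
    fun h => ?_, fun h => ?_, fun l hl h => ?_, ?_, ⟨j, _, rfl⟩⟩
  · rw [List.nodup_append]
    refine ⟨List.nodup_flatten.2 ⟨?_, ?_⟩, by simp, ?_⟩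
    · intro L hL
      obtain ⟨i, rfl⟩ := List.mem_ofFn.1 hL
      exact hnd i
    · exact List.pairwise_ofFn.2 fun i i' h => hdis i i' h
    · intro a ha b hb hab
      obtain rfl : b = zs j := by simpa using hb
      subst hab
      obtain ⟨L, hL, h⟩ := List.mem_flatten.1 ha
      obtain ⟨i, rfl⟩ := List.mem_ofFn.1 hL
      exact hj i h
  · rcases hmem' _ h with ⟨b, hb, e⟩ | ⟨b, hb, e⟩ | ⟨b, e⟩ <;> cases e
    exact hb
  · by_cases haj : a = j
    · exact (mem _).2 (Or.inr (by rw [haj]))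
    · exact (mem _).2 (Or.inl (hzs a h haj))
  · rcases hmem' _ h with ⟨b, hb, e⟩ | ⟨b, hb, e⟩ | ⟨b, e⟩ <;> cases e
    exact hb
  · exact (mem _).2 (Or.inl (hzp a h))
  · rcases hmem' _ h with ⟨b, hb, e⟩ | ⟨b, hb, e⟩ | ⟨b, e⟩ <;> cases e
  · rcases hmem' _ h with ⟨b, hb, e⟩ | ⟨b, hb, e⟩ | ⟨b, e⟩ <;> cases e
  · rcases hmem' _ h with ⟨b, hb, rfl⟩ | ⟨b, hb, rfl⟩ | ⟨b, rfl⟩ <;> cases hl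
  · obtain ⟨k, rfl⟩ := Nat.exists_eq_add_of_le' hk
    obtain ⟨a, L, h⟩ := hhead 0
    rw [List.ofFn_succ, List.flatten_cons, h]
    exact ⟨a, _, rfl⟩

theorem exists_perm_eq {k : ℕ} (π : Equiv.Perm (Fin k)) {a : ℕ} (ha : a < k) :
    ∃ i : Fin k, (π i : ℕ) = a := ⟨π.symm ⟨a, ha⟩, by simp⟩

theorem perm_val_eq_iff {k : ℕ} (π : Equiv.Perm (Fin k)) (i j : Fin k) :
    (π i : ℕ) = π j ↔ (i : ℕ) = j := by
  rw [← Fin.ext_iff, π.injective.eq_iff, Fin.ext_iff]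

variable {n : ℕ} (hn : 1 ≤ n)
include hn

theorem not_isModularLattice_c1 (π : Equiv.Perm (Fin (4 * n + 1))) (τ : Equiv.Perm (Fin (2 * n))) :
    ¬ IsModularLattice (Set.Iic (varGamma' (c1 n π τ))) := by
  have e : c1 n π τ = _ := eq_expand_shape (n := n) (m := 4 * n + 1) (fun i : Fin (2 * n) =>
    [zs (π ⟨2 * i, by omega⟩), ys i, zs (π ⟨2 * i + 1, by omega⟩), zp (τ i)]) (fun i => rfl)
    (π (Fin.last (4 * n)))
  rw [e]
  refine not_isModularLattice_varGamma' (core_of_blocks hn (by omega) ?_ ?_ ?_ ?_ ?_ ?_ ?_ ?_)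
    adm_stdExp
  · intro i
    simp [perm_val_eq_iff]
  · intro i i' h
    have h' : (i : ℕ) < i' := h
    simp only [List.disjoint_left, List.mem_cons, List.not_mem_nil, or_false]
    rintro l (rfl | rfl | rfl | rfl) <;> simp [perm_val_eq_iff] <;> omega
  · intro i
    simp [perm_val_eq_iff]
    omega
  · intro i
    exact ⟨_, _, rfl⟩
  · intro i l hl
    simp only [List.mem_cons, List.not_mem_nil, or_false] at hl
    rcases hl with rfl | rfl | rfl | rfl <;> simp [Fin.is_le]
  · exact Fin.is_lt _
  · intro a ha hne
    obtain ⟨i, rfl⟩ := exists_perm_eq π ha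
    rw [Ne, perm_val_eq_iff, Fin.val_last] at hne
    -- Block k holds the letters `zs` at positions 2k and 2k + 1 of the permutation.
    refine ⟨⟨i / 2, by omega⟩, ?_⟩
    simp only [List.mem_cons, Letter.zs.injEq, perm_val_eq_iff, reduceCtorEq, false_or]
    omega
  · intro a ha
    obtain ⟨i, rfl⟩ := exists_perm_eq τ ha
    exact ⟨i, by simp⟩

theorem not_isModularLattice_c2 (π : Equiv.Perm (Fin (n + 1))) (τ : Equiv.Perm (Fin (2 * n))) :
    ¬ IsModularLattice (Set.Iic (varGamma' (c2 n π τ))) := by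
  have e : c2 n π τ = _ := eq_expand_shape (n := n) (m := n + 1) (fun i : Fin n =>
    [zs (π i.castSucc), zp (τ ⟨2 * i, by omega⟩), ys i, zp (τ ⟨2 * i + 1, by omega⟩)])
    (fun i => rfl) (π (Fin.last n))
  rw [e]
  refine not_isModularLattice_varGamma' (core_of_blocks hn (by omega) ?_ ?_ ?_ ?_ ?_ ?_ ?_ ?_)
    adm_stdExp
  · intro i
    simp [perm_val_eq_iff]
  · intro i i' h
    have h' : (i : ℕ) < i' := h
    simp only [List.disjoint_left, List.mem_cons, List.not_mem_nil, or_false]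
    rintro l (rfl | rfl | rfl | rfl) <;> simp [perm_val_eq_iff] <;> omega
  · intro i
    simp [perm_val_eq_iff]
    omega
  · intro i
    exact ⟨_, _, rfl⟩
  · intro i l hl
    simp only [List.mem_cons, List.not_mem_nil, or_false] at hl
    rcases hl with rfl | rfl | rfl | rfl <;> simp [Fin.is_le]
  · exact Fin.is_lt _
  · intro a ha hne
    obtain ⟨i, rfl⟩ := exists_perm_eq π ha
    rw [Ne, perm_val_eq_iff, Fin.val_last] at hne
    refine ⟨⟨i, by omega⟩, ?_⟩
    simp
  · intro a ha
    obtain ⟨i, rfl⟩ := exists_perm_eq τ ha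
    -- Here each block holds two consecutive letters `zp`.
    refine ⟨⟨i / 2, by omega⟩, ?_⟩
    simp only [List.mem_cons, Letter.zp.injEq, perm_val_eq_iff, reduceCtorEq, false_or]
    omega

theorem not_isModularLattice_c3 (π : Equiv.Perm (Fin (2 * n + 1))) (τ : Equiv.Perm (Fin (2 * n))) :
    ¬ IsModularLattice (Set.Iic (varGamma' (c3 n π τ))) := by
  have e : c3 n π τ = _ := eq_expand_shape (n := n) (m := 2 * n + 1) (fun i : Fin (2 * n) =>
    [zs (π i.castSucc), zp (τ i), ys i]) (fun i => rfl) (π (Fin.last (2 * n)))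
  rw [e]
  refine not_isModularLattice_varGamma' (core_of_blocks hn (by omega) ?_ ?_ ?_ ?_ ?_ ?_ ?_ ?_)
    adm_stdExp
  · intro i
    simp
  · intro i i' h
    have h' : (i : ℕ) < i' := h
    simp only [List.disjoint_left, List.mem_cons, List.not_mem_nil, or_false]
    rintro l (rfl | rfl | rfl) <;> simp [perm_val_eq_iff] <;> omega
  · intro i
    simp [perm_val_eq_iff]
    omega
  · intro i
    exact ⟨_, _, rfl⟩
  · intro i l hl
    simp only [List.mem_cons, List.not_mem_nil, or_false] at hl
    rcases hl with rfl | rfl | rfl <;> simp [Fin.is_le]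
  · exact Fin.is_lt _
  · intro a ha hne
    obtain ⟨i, rfl⟩ := exists_perm_eq π ha
    rw [Ne, perm_val_eq_iff, Fin.val_last] at hne
    refine ⟨⟨i, by omega⟩, ?_⟩
    simp
  · intro a ha
    obtain ⟨i, rfl⟩ := exists_perm_eq τ ha
    exact ⟨i, by simp⟩

theorem not_isModularLattice_c4 (π : Equiv.Perm (Fin (2 * n + 1))) (τ : Equiv.Perm (Fin (2 * n))) :
    ¬ IsModularLattice (Set.Iic (varGamma' (c4 n π τ))) := by
  have e : c4 n π τ = _ := eq_expand_shape (n := n) (m := 2 * n + 1) (fun i : Fin (2 * n) =>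
    [zs (π i.castSucc), ys i, zp (τ i)]) (fun i => rfl) (π (Fin.last (2 * n)))
  rw [e]
  refine not_isModularLattice_varGamma' (core_of_blocks hn (by omega) ?_ ?_ ?_ ?_ ?_ ?_ ?_ ?_)
    adm_stdExp
  · intro i
    simp
  · intro i i' h
    have h' : (i : ℕ) < i' := h
    simp only [List.disjoint_left, List.mem_cons, List.not_mem_nil, or_false]
    rintro l (rfl | rfl | rfl) <;> simp [perm_val_eq_iff] <;> omega
  · intro i
    simp [perm_val_eq_iff]
    omega
  · intro i
    exact ⟨_, _, rfl⟩
  · intro i l hl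
    simp only [List.mem_cons, List.not_mem_nil, or_false] at hl
    rcases hl with rfl | rfl | rfl <;> simp [Fin.is_le]
  · exact Fin.is_lt _
  · intro a ha hne
    obtain ⟨i, rfl⟩ := exists_perm_eq π ha
    rw [Ne, perm_val_eq_iff, Fin.val_last] at hne
    refine ⟨⟨i, by omega⟩, ?_⟩
    simp
  · intro a ha
    obtain ⟨i, rfl⟩ := exists_perm_eq τ ha
    exact ⟨i, by simp⟩

end Words

end MonVar

/-- For each variety `V` below, `Set.Iic V` is the lattice of all subvarieties of `V`. -/
theorem mainTheorem11 (n : ℕ) (hn : 1 ≤ n)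
    (π₁ : Equiv.Perm (Fin (4 * n + 1))) (π₂ : Equiv.Perm (Fin (n + 1)))
    (π₃ π₄ : Equiv.Perm (Fin (2 * n + 1))) (τ : Equiv.Perm (Fin (2 * n))) :
    ¬ IsModularLattice (Set.Iic (MonVar.varGamma' (MonVar.c1 n π₁ τ))) ∧
    ¬ IsModularLattice (Set.Iic (MonVar.varGamma' (MonVar.c2 n π₂ τ))) ∧
    ¬ IsModularLattice (Set.Iic (MonVar.varGamma' (MonVar.c3 n π₃ τ))) ∧
    ¬ IsModularLattice (Set.Iic (MonVar.varGamma' (MonVar.c4 n π₄ τ))) :=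
  ⟨MonVar.not_isModularLattice_c1 hn π₁ τ, MonVar.not_isModularLattice_c2 hn π₂ τ,
    MonVar.not_isModularLattice_c3 hn π₃ τ, MonVar.not_isModularLattice_c4 hn π₄ τ⟩
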